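/- Manifolds are smooth, Hausdorff and second countable, of constant dimension, and (unless said otherwise) possibly with boundary; $\lambda(V)=\Lambda^{\mathrm{top}}_{\mathbb R}V$. **Relative orientations.** A relative orientation $\mathfrak o$ of a continuous map $\varphi:A\to B$ of manifolds is an orientation of the line bundle $\varphi^*\lambda(TB)^*\otimes\lambda(TA)$, i.e. a continuous choice of homotopy classes $\mathfrak o_u$ of isomorphisms $\lambda(T_uA)\to\lambda(T_{\varphi(u)}B)$. It induces a relative orientation $\partial\mathfrak o$ of $\varphi|_{\partial A}$ by composing with $\lambda(T_u\partial A)\to\lambda(T_uA)$, $\eta\mapsto\eta\wedge\nu$, where $\nu$ is an outward normal vector (in the last position). **Pseudocycles.** The limit set of a continuous map $f:\mathcal Z\to Y$ is $\Omega(f)=\bigcap_{K\subset\mathcal Z\text{ compact}}\overline{f(\mathcal Z\setminus K)}$. The map $f$ is a bordered $\mathbb Z_2$-pseudocycle with boundary $f|_{\mathcal Z_0}$, where $\mathcal Z_0\subset\partial\mathcal Z$, if $\overline{f(\mathcal Z)}$ is compact and there is a smooth map $h:\mathcal Z'\to Y$ from a manifold without boundary with $\dim\mathcal Z'\le\dim\mathcal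 Z-2$ (the empty manifold is allowed in every dimension), $\Omega(f)\subset h(\mathcal Z')$ and $f(\partial\mathcal Z\setminus\mathcal Z_0)\subset\partial Y\cup h(\mathcal Z')$. Two bordered $\mathbb Z_2$-pseudocycles $f:\mathcal Z\to Y$ and $g:\Upsilon\to Y$ are transverse if they are smooth, $f$ and $f|_{\partial\mathcal Z}$ are both transverse to both $g$ and $g|_{\partial\Upsilon}$, and there are smooth maps $h_1:\mathcal Z'\to Y$ and $h_2:\Upsilon'\to Y$ from manifolds without boundary such that $\dim\mathcal Z'\le\dim\mathcal Z-2$, $\dim\Upsilon'\le\dim\Upsilon-2$, $\Omega(f)\subset h_1(\mathcal Z')$, $\Omega(g)\subset h_2(\Upsilon')$, $h_1$ is transverse to $g$ and $g|_{\partial\Upsilon}$, $h_2$ is transverse to $f$ and $f|_{\partial\mathcal Z}$, and $h_1$ is transverse to $h_2$. **Signs.** Let $Y=X\times\mathcal M$ be a product of manifolds, $f=(f_1,f_2):\mathcal Z\to Y$, $g=(g_1,g_2):\Upsilon\to Y$, and let $\mathfrak o_1$, $\mathfrak o_2$ be relative orientations of $f_1:\mathcal Z\to X$ and of $g_2:\Upsilon\to\mathcal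 M$. If $f(u)=g(P)$ and $T_u\mathcal Z\oplus T_P\Upsilon\to T_{f(u)}Y$, $(v,w)\mapsto d_uf(v)+d_Pg(w)$, is an isomorphism, the sign of $(u,P)$ with respect to $\mathfrak o_1,\mathfrak o_2$ is $+1$ if the top exterior power $\lambda(T_u\mathcal Z)\otimes\lambda(T_P\Upsilon)\to\lambda(T_{f_1(u)}X)\otimes\lambda(T_{g_2(P)}\mathcal M)$ of this isomorphism lies in the homotopy class determined by $(\mathfrak o_1)_u$ and $(\mathfrak o_2)_P$, and $-1$ otherwise. For a finite fiber product all of whose points have this property, $|\cdot|^{\pm}_{\mathfrak o_1,\mathfrak o_2}$ is the sum of the signs of its points. The same conventions apply to $f,\,g|_{\partial\Upsilon}$ with $\mathfrak o_1,\partial\mathfrak o_2$ and to $f|_{\partial\mathcal Z},\,g$ with $\partial\mathfrak o_1,\mathfrak o_2$. **Lemma.** Let $\mathcal Z,\Upsilon,X,\mathcal M,Y,f,g,\mathfrak o_1,\mathfrak o_2$ be as above, with $\dim\mathcal Z+\dim\Upsilon=\dim Y+1$. If $f$ and $g$ are transverse bordered $\mathbb Z_2$-pseudocycles, then the fiber products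 $$\mathcal Z\,{}_f\!\times_g(\partial\Upsilon)=\{(u,P)\in\mathcal Z\times\partial\Upsilon: f(u)=g(P)\},\qquad (\partial\mathcal Z)\,{}_f\!\times_g\Upsilon=\{(u,P)\in\partial\mathcal Z\times\Upsilon: f(u)=g(P)\}$$ are finite sets and $$\big|\mathcal Z\,{}_f\!\times_g(\partial\Upsilon)\big|^{\pm}_{\mathfrak o_1,\partial\mathfrak o_2}=(-1)^{\dim\Upsilon}\,\big|(\partial\mathcal Z)\,{}_f\!\times_g\Upsilon\big|^{\pm}_{\partial\mathfrak o_1,\mathfrak o_2}.$$ -/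

import Mathlib

open Set Module
open scoped Manifold ContDiff Topology

noncomputable section

namespace Steenrod

/-! ### Manifolds with boundary -/

section Boundary

variable {E : Type*} [NormedAddCommGroup E] [NormedSpace ℝ E] {H : Type*} [TopologicalSpace H]

/-- A model for manifolds possibly with boundary: its image is a closed linear half-space
`{0 ≤ ℓ}`. The case `ℓ = 0` is that of manifolds without boundary, in any dimension
(including `0`). Corners are excluded. -/
def IsBorderedModel (I : ModelWithCorners ℝ E H) : Prop :=
  ∃ l : E →L[ℝ] ℝ, range I = {x | 0 ≤ l x}

/-- The tangent space of `∂Z` at a boundary point `u`, inside `T_u Z = E`: the boundary hyperplane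
of the model half-space. -/
def boundaryTangent (I : ModelWithCorners ℝ E H) : Submodule ℝ E :=
  Submodule.span ℝ (frontier (range I))

/-- A tangent vector at a boundary point that points strictly out of the manifold. -/
def IsOutward (I : ModelWithCorners ℝ E H) (ν : E) : Prop :=
  -ν ∈ interior (range I)

end Boundary

/-! ### Linear algebra of relative orientations -/

section Linear

/-- The sign of (any representative of) `θ` on the tuple `v`. For `n = 0` this is the sign of `θ`. -/
def orientSign {V : Type*} [AddCommGroup V] [Module ℝ V] {n : ℕ}
    (θ : Orientation ℝ V (Fin n)) (v : Fin n → V) : SignType :=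
  SignType.sign (θ.someVector v)

/-- A homotopy class of isomorphisms `λ(V) → λ(W)` of top exterior powers, given by its action on
orientations. -/
structure LinearRelOrientation (V W : Type*) [AddCommGroup V] [Module ℝ V]
    [AddCommGroup W] [Module ℝ W] (n m : ℕ) where
  toFun : Orientation ℝ V (Fin n) → Orientation ℝ W (Fin m)
  map_neg : ∀ θ, toFun (-θ) = -toFun θ

/-- For bases `v` of `V` and `w` of `W`: the class contains an isomorphism that takes
`v₁ ∧ ⋯ ∧ vₙ` to a positive multiple of `w₁ ∧ ⋯ ∧ wₘ`. -/
def LinearRelOrientation.Pos {V W : Type*} [AddCommGroup V] [Module ℝ V]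
    [AddCommGroup W] [Module ℝ W] {n m : ℕ} (σ : LinearRelOrientation V W n m)
    (v : Fin n → V) (w : Fin m → W) : Prop :=
  ∃ θ, 0 < orientSign θ v * orientSign (σ.toFun θ) w

/-- `(b₁, …, bₙ₋₁, ν)`. -/
def appendLast {V : Type*} {n : ℕ} (b : Fin (n - 1) → V) (ν : V) : Fin n → V :=
  fun i => if h : (i : ℕ) < n - 1 then b ⟨i, h⟩ else ν

/-- The induced class `∂σ : λ(T∂Z) → λ(TZ) → λ(W)` on the boundary hyperplane; the first arrow is
the co-orientation of `∂Z` by the outer normal, through `λ(TZ) = λ(T∂Z) ⊗ λ(N)`, that is with the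
outer normal in the last position. -/
def LinearRelOrientation.BoundaryPos {E H W : Type*} [NormedAddCommGroup E] [NormedSpace ℝ E]
    [TopologicalSpace H] [AddCommGroup W] [Module ℝ W] {n m : ℕ}
    (I : ModelWithCorners ℝ E H) (σ : LinearRelOrientation E W n m)
    (b : Fin (n - 1) → boundaryTangent I) (w : Fin m → W) : Prop :=
  ∃ ν, IsOutward I ν ∧ σ.Pos (appendLast (fun i => (b i : E)) ν) w

open Classical in
/-- `+1` if `p` holds and `-1` otherwise. -/
def signOf (p : Prop) : ℤ := if p then 1 else -1

/-- Let `pos₁`, `pos₂` be the positivity relations of classes of isomorphisms `λ(V₁) → λ(W₁)` and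
`λ(V₂) → λ(W₂)`. If `(v, w) ↦ A v + B w` is an isomorphism `V₁ ⊕ V₂ → W₁ ⊕ W₂`, this is `+1` if its
top exterior power lies in the class of `λ(V₁) ⊗ λ(V₂) → λ(W₁) ⊗ λ(W₂)` and `-1` otherwise. It is
computed in bases; the outcome does not depend on them. -/
def crossSign {V₁ V₂ W₁ W₂ : Type*} [AddCommGroup V₁] [Module ℝ V₁] [AddCommGroup V₂] [Module ℝ V₂]
    [AddCommGroup W₁] [Module ℝ W₁] [AddCommGroup W₂] [Module ℝ W₂] {n₁ n₂ m₁ m₂ : ℕ}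
    (pos₁ : (Fin n₁ → V₁) → (Fin m₁ → W₁) → Prop) (pos₂ : (Fin n₂ → V₂) → (Fin m₂ → W₂) → Prop)
    (A : V₁ →ₗ[ℝ] W₁ × W₂) (B : V₂ →ₗ[ℝ] W₁ × W₂) : ℤ :=
  signOf (∃ (b₁ : Basis (Fin n₁) ℝ V₁) (b₂ : Basis (Fin n₂) ℝ V₂)
    (c₁ : Basis (Fin m₁) ℝ W₁) (c₂ : Basis (Fin m₂) ℝ W₂) (h : m₁ + m₂ = n₁ + n₂),
    0 < (signOf (pos₁ b₁ c₁) * signOf (pos₂ b₂ c₂) : ℝ) *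
      ((c₁.prod c₂).reindex finSumFinEquiv).det
        (Fin.append (fun i => A (b₁ i)) (fun j => B (b₂ j)) ∘ Fin.cast h))

end Linear

/-! ### Relative orientations of maps -/

/-- A relative orientation of a continuous map `f : Z → X`: a continuous choice of homotopy classes
of isomorphisms `λ(T_u Z) → λ(T_{f u} X)`; continuity means that the classes are locally constant in
local trivializations of the tangent bundles. -/
structure RelOrientation {E H E' H' : Type*} [NormedAddCommGroup E] [NormedSpace ℝ E]
    [TopologicalSpace H] [NormedAddCommGroup E'] [NormedSpace ℝ E'] [TopologicalSpace H']
    (I : ModelWithCorners ℝ E H) (I' : ModelWithCorners ℝ E' H')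
    {Z X : Type*} [TopologicalSpace Z] [ChartedSpace H Z] [IsManifold I ∞ Z]
    [TopologicalSpace X] [ChartedSpace H' X] [IsManifold I' ∞ X] (f : Z → X) where
  at_ (u : Z) : LinearRelOrientation (TangentSpace I u) (TangentSpace I' (f u))
    (finrank ℝ E) (finrank ℝ E')
  locallyConstant : ∀ u₀ : Z,
    ∃ τ : Orientation ℝ E (Fin (finrank ℝ E)) → Orientation ℝ E' (Fin (finrank ℝ E')),
    ∀ᶠ u in 𝓝 u₀,
      ∀ (hu : u ∈ (trivializationAt E (TangentSpace I) u₀).baseSet)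
        (hx : f u ∈ (trivializationAt E' (TangentSpace I') (f u₀)).baseSet)
        (θ : Orientation ℝ (TangentSpace I u) (Fin (finrank ℝ E))),
        Orientation.map _ ((trivializationAt E' (TangentSpace I') (f u₀)).continuousLinearEquivAt ℝ
            (f u) hx).toLinearEquiv ((at_ u).toFun θ) =
          τ (Orientation.map _ ((trivializationAt E (TangentSpace I) u₀).continuousLinearEquivAt ℝ
            u hu).toLinearEquiv θ)

/-! ### Transversality -/

section Transverse

variable {E : Type*} [NormedAddCommGroup E] [NormedSpace ℝ E] {H : Type*} [TopologicalSpace H]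
  (I : ModelWithCorners ℝ E H) {Z : Type*} [TopologicalSpace Z] [ChartedSpace H Z]
  {E' : Type*} [NormedAddCommGroup E'] [NormedSpace ℝ E'] {H' : Type*} [TopologicalSpace H']
  (I' : ModelWithCorners ℝ E' H') {Υ : Type*} [TopologicalSpace Υ] [ChartedSpace H' Υ]
  {F : Type*} [NormedAddCommGroup F] [NormedSpace ℝ F] {G : Type*} [TopologicalSpace G]
  (J : ModelWithCorners ℝ F G) {Y : Type*} [TopologicalSpace Y] [ChartedSpace G Y]

/-- The differential `d_u f : T_u Z → T_{f u} Y`; each tangent space is read in the preferred chart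
at its base point. -/
def differential (f : Z → Y) (u : Z) : E →ₗ[ℝ] F :=
  (mfderiv I J f u).toLinearMap

/-- The differential at `u ∈ ∂Z` of the restriction of `f` to `∂Z`. -/
def boundaryDifferential (f : Z → Y) (u : Z) : boundaryTangent I →ₗ[ℝ] F :=
  (differential I J f u).domRestrict (boundaryTangent I)

/-- `f` is transverse to `g`. -/
def Transverse (f : Z → Y) (g : Υ → Y) : Prop :=
  ∀ u P, f u = g P →
    (differential I J f u).range ⊔ (differential I' J g P).range = ⊤

/-- `f` is transverse to the restriction of `g` to the boundary of its domain. -/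
def TransverseBoundary (f : Z → Y) (g : Υ → Y) : Prop :=
  ∀ u, ∀ P ∈ I'.boundary Υ, f u = g P →
    (differential I J f u).range ⊔ (boundaryDifferential I' J g P).range = ⊤

/-- The restrictions of `f` and `g` to the boundaries of their domains are transverse. -/
def BoundaryTransverseBoundary (f : Z → Y) (g : Υ → Y) : Prop :=
  ∀ u ∈ I.boundary Z, ∀ P ∈ I'.boundary Υ, f u = g P →
    (boundaryDifferential I J f u).range ⊔ (boundaryDifferential I' J g P).range = ⊤

/-- `f` and `g` are smooth, and `f` and `f|∂Z` are transverse to `g` and `g|∂Υ`. -/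
structure StronglyTransverse (f : Z → Y) (g : Υ → Y) : Prop where
  smooth_left : ContMDiff I J ∞ f
  smooth_right : ContMDiff I' J ∞ g
  transverse : Transverse I I' J f g
  transverse_boundary : TransverseBoundary I I' J f g
  boundary_transverse : TransverseBoundary I' I J g f
  boundary_transverse_boundary : BoundaryTransverseBoundary I I' J f g

/-! ### Pseudocycles -/

/-- The limit set of `f`. -/
def limitSet (f : Z → Y) : Set Y :=
  ⋂ (K : Set Z) (_ : IsCompact K), closure (f '' Kᶜ)

/-- A smooth map into `Y` from a manifold (Hausdorff, second countable, without boundary, possibly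
empty). A manifold has at most the cardinality of the continuum, so `Type` is large enough. -/
structure SmoothMapInto (Y : Type*) [TopologicalSpace Y] [ChartedSpace G Y] where
  dim : ℕ
  carrier : Type
  [topology : TopologicalSpace carrier]
  [charted : ChartedSpace (EuclideanSpace ℝ (Fin dim)) carrier]
  [manifold : IsManifold (𝓡 dim) ∞ carrier]
  [hausdorff : T2Space carrier]
  [secondCountable : SecondCountableTopology carrier]
  map : carrier → Y
  smooth : ContMDiff (𝓡 dim) J ∞ map

attribute [instance] SmoothMapInto.topology SmoothMapInto.charted SmoothMapInto.manifold
  SmoothMapInto.hausdorff SmoothMapInto.secondCountable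

/-- The dimension of the domain is at most `n - 2`; the empty manifold has every dimension. -/
def SmoothMapInto.DimLeSubTwo {J : ModelWithCorners ℝ F G} (h : SmoothMapInto J Y) (n : ℕ) : Prop :=
  Nonempty h.carrier → h.dim + 2 ≤ n

/-- `f` is a bordered `ℤ₂`-pseudocycle whose boundary is its restriction to `Z₀ ⊆ ∂Z`. -/
structure IsBorderedPseudocycle (f : Z → Y) (Z₀ : Set Z) : Prop where
  continuous : Continuous f
  isCompact_closure : IsCompact (closure (range f))
  subset_boundary : Z₀ ⊆ I.boundary Z
  exists_map : ∃ h : SmoothMapInto J Y, h.DimLeSubTwo (finrank ℝ E) ∧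
    limitSet f ⊆ range h.map ∧ f '' (I.boundary Z \ Z₀) ⊆ J.boundary Y ∪ range h.map

/-- `f` and `g` are transverse as bordered `ℤ₂`-pseudocycles: they are strongly transverse, and their
limit sets are covered by smooth maps `h₁`, `h₂` from manifolds of codimension at least `2` such that
`h₁` is transverse to `g`, `g|∂Υ`, `h₂` to `f`, `f|∂Z`, and `h₁` to `h₂`. -/
structure TransversePseudocycles (f : Z → Y) (g : Υ → Y) : Prop where
  stronglyTransverse : StronglyTransverse I I' J f g
  exists_maps : ∃ h₁ h₂ : SmoothMapInto J Y,
    h₁.DimLeSubTwo (finrank ℝ E) ∧ h₂.DimLeSubTwo (finrank ℝ E') ∧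
    limitSet f ⊆ range h₁.map ∧ limitSet g ⊆ range h₂.map ∧
    Transverse (𝓡 h₁.dim) I' J h₁.map g ∧ TransverseBoundary (𝓡 h₁.dim) I' J h₁.map g ∧
    Transverse (𝓡 h₂.dim) I J h₂.map f ∧ TransverseBoundary (𝓡 h₂.dim) I J h₂.map f ∧
    Transverse (𝓡 h₁.dim) (𝓡 h₂.dim) J h₁.map h₂.map

/-! ### Fiber products with the boundary -/

/-- The fiber product of `f` and `g|∂Υ`. -/
def fiberProdBoundary (f : Z → Y) (g : Υ → Y) : Set (Z × Υ) :=
  {p | p.2 ∈ I'.boundary Υ ∧ f p.1 = g p.2}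

/-- The fiber product of `f|∂Z` and `g`. -/
def boundaryFiberProd (f : Z → Y) (g : Υ → Y) : Set (Z × Υ) :=
  {p | p.1 ∈ I.boundary Z ∧ f p.1 = g p.2}

end Transverse

/-! ### Intersection signs at boundary points -/

section Signs

variable {E₁ H₁ E₂ H₂ F₁ G₁ F₂ G₂ : Type*}
  [NormedAddCommGroup E₁] [NormedSpace ℝ E₁] [TopologicalSpace H₁]
  [NormedAddCommGroup E₂] [NormedSpace ℝ E₂] [TopologicalSpace H₂]
  [NormedAddCommGroup F₁] [NormedSpace ℝ F₁] [TopologicalSpace G₁]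
  [NormedAddCommGroup F₂] [NormedSpace ℝ F₂] [TopologicalSpace G₂]
  {I₁ : ModelWithCorners ℝ E₁ H₁} {I₂ : ModelWithCorners ℝ E₂ H₂}
  {J₁ : ModelWithCorners ℝ F₁ G₁} {J₂ : ModelWithCorners ℝ F₂ G₂}
  {Z Υ X M : Type*}
  [TopologicalSpace Z] [ChartedSpace H₁ Z] [IsManifold I₁ ∞ Z]
  [TopologicalSpace Υ] [ChartedSpace H₂ Υ] [IsManifold I₂ ∞ Υ]
  [TopologicalSpace X] [ChartedSpace G₁ X] [IsManifold J₁ ∞ X]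
  [TopologicalSpace M] [ChartedSpace G₂ M] [IsManifold J₂ ∞ M]

/-- The class of a relative orientation at `u`, with the tangent spaces read in the preferred
charts. -/
def RelOrientation.linear {f : Z → X} (o : RelOrientation I₁ J₁ f) (u : Z) :
    LinearRelOrientation E₁ F₁ (finrank ℝ E₁) (finrank ℝ F₁) :=
  o.at_ u

/-- The sign of `(u, P)`, `P ∈ ∂Υ`, in the fiber product of `f` and `g|∂Υ`, with respect to `o₁`
and `∂o₂`. -/
def signRight (f : Z → X × M) (g : Υ → X × M)
    (o₁ : RelOrientation I₁ J₁ (fun u => (f u).1)) (o₂ : RelOrientation I₂ J₂ (fun P => (g P).2))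
    (p : Z × Υ) : ℤ :=
  crossSign (o₁.linear p.1).Pos ((o₂.linear p.2).BoundaryPos I₂)
    (differential I₁ (J₁.prod J₂) f p.1) (boundaryDifferential I₂ (J₁.prod J₂) g p.2)

/-- The sign of `(u, P)`, `u ∈ ∂Z`, in the fiber product of `f|∂Z` and `g`, with respect to `∂o₁`
and `o₂`. -/
def signLeft (f : Z → X × M) (g : Υ → X × M)
    (o₁ : RelOrientation I₁ J₁ (fun u => (f u).1)) (o₂ : RelOrientation I₂ J₂ (fun P => (g P).2))
    (p : Z × Υ) : ℤ :=
  crossSign ((o₁.linear p.1).BoundaryPos I₁) (o₂.linear p.2).Pos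
    (boundaryDifferential I₁ (J₁.prod J₂) f p.1) (differential I₂ (J₁.prod J₂) g p.2)

end Signs

end Steenrod

end

open Filter Asymptotics
open scoped NNReal

namespace Steenrod

/-! ### Signed boundary count of a compact set covered by oriented arcs -/

section Jumps

variable {α : Type*}

/-! The fiber product N = {f u = g P} (`fiberProd f g`) is a compact oriented one-dimensional
manifold whose ends are exactly the points of the two fiber products with a boundary. Its ends,
counted with sign, add up to zero, and each end sign differs from the intersection sign by a factor
fixed by the determinant conventions.

Compactness (`TransversePseudocycles.isCompact_fiberProd`): points of N can escape only towards the
limit sets of f or g. These are covered by maps of codimension at least two, which by transversality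
and a dimension count miss the other map and each other. A similar count excludes points with both u
and P on the boundary, so N has no corners.

Orientation: the tangent line of N at p is ker(df - dg). A functional s counts as positive on it
when `fiberDet`, the determinant of (df - dg, s) corrected by the signs of the relative
orientations, is positive. Up to a positive factor this does not depend on bases
(`orientedDet_change`). It is the value of s at a fixed kernel vector
(`exists_orientedDet_eq_apply`), and its positivity persists at nearby points of N
(`eventually_fiberDet_pos`).

Local structure: with s positive at p, the pair (difference of f and g in charts, s) is a local
homeomorphism, also at boundary points (`exists_homeomorph_eventuallyEq`), so N is an arc with
parameter s (`exists_isArc`). The orientation is recorded only through the filters `L x` and `R x`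
of points of N before and after x; by `nhdsWithin_side_eq` they do not depend on the functional
used.

Counting: one-manifolds are not classified. The constant function 1 on N jumps only at ends, by
`endSign`. Subtracting from a step function its restriction to one arc leaves the total jump
unchanged, because jumps of a compactly supported step function on the line telescope. Finitely many
arcs cover N, so the function is reduced to 0 (`finsum_endSign_eq_zero`).

Signs: at a boundary point take for s the functional defining the half-space, so that s(ν) < 0 for
outward ν. Placing ν in its slot and replacing -dg by +dg costs (-1)^(dim Υ - 1) on ∂Υ
(`frameDet_snoc_right`) and nothing on ∂Z (`frameDet_snoc_left`), whence the factor (-1)^(dim Υ). -/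

open Classical in
/-- The eventual value of `h` along the filter `F`, and `0` if `F = ⊥` or there is no such value. -/
noncomputable def sideVal (F : Filter α) (h : α → ℤ) : ℤ :=
  if H : F ≠ ⊥ ∧ ∃ l, ∀ᶠ y in F, h y = l then H.2.choose else 0

theorem sideVal_bot (h : α → ℤ) : sideVal ⊥ h = 0 := by simp [sideVal]

theorem sideVal_eq {F : Filter α} [NeBot F] {h : α → ℤ} {l : ℤ} (hl : ∀ᶠ y in F, h y = l) :
    sideVal F h = l := by
  have H : F ≠ ⊥ ∧ ∃ l, ∀ᶠ y in F, h y = l := ⟨NeBot.ne ‹_›, l, hl⟩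
  rw [sideVal, dif_pos H]
  obtain ⟨y, h1, h2⟩ := (H.2.choose_spec.and hl).exists
  rw [← h1, ← h2]

theorem sideVal_eq_zero {F : Filter α} {h : α → ℤ} (hl : ∀ᶠ y in F, h y = 0) :
    sideVal F h = 0 := by
  rcases F.eq_or_neBot with rfl | hF
  · exact sideVal_bot h
  · exact sideVal_eq hl

theorem sideVal_congr {F : Filter α} {h h' : α → ℤ} (hl : ∀ᶠ y in F, h y = h' y) :
    sideVal F h = sideVal F h' := by
  have : (∃ l, ∀ᶠ y in F, h y = l) ↔ ∃ l, ∀ᶠ y in F, h' y = l := by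
    constructor
    · rintro ⟨l, hh⟩
      exact ⟨l, by filter_upwards [hl, hh] with y a b using a ▸ b⟩
    · rintro ⟨l, hh⟩
      exact ⟨l, by filter_upwards [hl, hh] with y a b using a.trans b⟩
  rcases F.eq_or_neBot with rfl | hF
  · rw [sideVal_bot, sideVal_bot]
  by_cases H : ∃ l, ∀ᶠ y in F, h' y = l
  · obtain ⟨l, hh⟩ := H
    rw [sideVal_eq hh, sideVal_eq]
    filter_upwards [hl, hh] with y a b using a.trans b
  · rw [sideVal, sideVal, dif_neg (fun h => H (this.1 h.2)), dif_neg (fun h => H h.2)]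

theorem sideVal_map {β : Type*} (γ : β → α) (F : Filter β) (h : α → ℤ) :
    sideVal (map γ F) h = sideVal F (h ∘ γ) := by
  rcases F.eq_or_neBot with rfl | hF
  · rw [map_bot, sideVal_bot, sideVal_bot]
  by_cases H : ∃ l, ∀ᶠ y in map γ F, h y = l
  · obtain ⟨l, hl⟩ := H
    rw [sideVal_eq hl, sideVal_eq (h := h ∘ γ) (l := l) (eventually_map.1 hl)]
  · rw [sideVal, sideVal, dif_neg (fun h => H h.2), dif_neg (fun h => H h.2)]

theorem sideVal_sub {F : Filter α} {h h' : α → ℤ} (hl : ∃ l, ∀ᶠ y in F, h y = l)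
    (hl' : ∃ l, ∀ᶠ y in F, h' y = l) :
    sideVal F (fun x => h x - h' x) = sideVal F h - sideVal F h' := by
  rcases F.eq_or_neBot with rfl | hF
  · simp [sideVal_bot]
  obtain ⟨l, hl⟩ := hl
  obtain ⟨l', hl'⟩ := hl'
  rw [sideVal_eq hl, sideVal_eq hl', sideVal_eq]
  filter_upwards [hl, hl'] with y a b
  rw [a, b]

/-- The jump of `h` between the filters of left and right germs. -/
noncomputable def jump (L R : α → Filter α) (h : α → ℤ) (x : α) : ℤ :=
  sideVal (L x) h - sideVal (R x) h

/-- `h` is eventually constant along every left and every right germ at the points of `N`. -/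
def IsStep (N : Set α) (L R : α → Filter α) (h : α → ℤ) : Prop :=
  ∀ x ∈ N, (∃ l, ∀ᶠ y in L x, h y = l) ∧ ∃ r, ∀ᶠ y in R x, h y = r

theorem finite_inter_of_isCompact [TopologicalSpace α] {N : Set α} (hN : IsCompact N) {P : α → Prop}
    (h : ∀ x ∈ N, ∀ᶠ y in 𝓝[≠] x, y ∈ N → ¬ P y) : {x ∈ N | P x}.Finite := by
  by_contra hinf
  obtain ⟨x, hx, hacc⟩ := Set.Infinite.exists_accPt_of_subset_isCompact hinf hN
    (fun y hy => hy.1)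
  rw [accPt_iff_frequently_nhdsNE] at hacc
  obtain ⟨y, hy, hy'⟩ := (hacc.and_eventually (h x hx)).exists
  exact hy' hy.1 hy.2

/-- Turns a one-sided limit at a point into local constancy at the nearby points on that side; this
is why the jumps of a step function are isolated. -/
theorem eventually_nhds_of_eventually_nhdsWithin_isOpen [TopologicalSpace α] {U : Set α}
    (hU : IsOpen U) {x : α} {p : α → Prop} (h : ∀ᶠ y in 𝓝[U] x, p y) :
    ∀ᶠ y in 𝓝[U] x, ∀ᶠ z in 𝓝 y, p z := by
  filter_upwards [eventually_eventually_nhdsWithin.2 h, self_mem_nhdsWithin] with y hy hyU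
  rwa [hU.nhdsWithin_eq hyU] at hy

/-- The jumps of a compactly supported step function on the line add up to zero. -/
theorem finsum_jump_real {k : ℝ → ℤ} {a b : ℝ} (hk : ∀ t ∉ Icc a b, k t = 0)
    (hs : IsStep univ (fun t => 𝓝[<] t) (fun t => 𝓝[>] t) k) :
    ∑ᶠ t, jump (fun t => 𝓝[<] t) (fun t => 𝓝[>] t) k t = 0 := by
  set l : ℝ → ℤ := fun t => sideVal (𝓝[<] t) k with hldef
  set r : ℝ → ℤ := fun t => sideVal (𝓝[>] t) k with hrdef
  set J : ℝ → ℤ := jump (fun t => 𝓝[<] t) (fun t => 𝓝[>] t) k with hJdef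
  have hJ : ∀ t, J t = l t - r t := fun t => rfl
  have lval : ∀ {t : ℝ} {m : ℤ}, (∀ᶠ z in 𝓝 t, k z = m) → l t = m ∧ r t = m := fun h =>
    ⟨sideVal_eq (h.filter_mono nhdsWithin_le_nhds), sideVal_eq (h.filter_mono nhdsWithin_le_nhds)⟩
  have hleft : ∀ t, ∀ᶠ y in 𝓝[<] t, l y = l t ∧ J y = 0 := fun t => by
    obtain ⟨m, hm⟩ := (hs t trivial).1
    have : l t = m := sideVal_eq hm
    filter_upwards [eventually_nhds_of_eventually_nhdsWithin_isOpen isOpen_Iio hm] with y hy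
    rw [hJ, (lval hy).1, (lval hy).2, this]
    simp
  have hright : ∀ t, ∀ᶠ y in 𝓝[>] t, l y = r t ∧ J y = 0 := fun t => by
    obtain ⟨m, hm⟩ := (hs t trivial).2
    have : r t = m := sideVal_eq hm
    filter_upwards [eventually_nhds_of_eventually_nhdsWithin_isOpen isOpen_Ioi hm] with y hy
    rw [hJ, (lval hy).1, (lval hy).2, this]
    simp
  have hout : ∀ t ∉ Icc a b, l t = 0 ∧ J t = 0 := fun t ht => by
    have : ∀ᶠ z in 𝓝 t, k z = 0 := by
      filter_upwards [isClosed_Icc.isOpen_compl.mem_nhds ht] with z hz using hk z hz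
    rw [hJ, (lval this).1, (lval this).2]
    simp
  have hfin : J.support.Finite := by
    refine (finite_inter_of_isCompact (P := fun t => J t ≠ 0) (isCompact_Icc (a := a) (b := b))
      fun x _ => ?_).subset fun t ht => ⟨by_contra fun h => ht (hout t h).2, ht⟩
    rw [← Iio_union_Ioi, nhdsWithin_union, eventually_sup]
    exact ⟨(hleft x).mono fun y hy _ => not_not.2 hy.2,
      (hright x).mono fun y hy _ => not_not.2 hy.2⟩
  set S := hfin.toFinset with hS
  have hSJ : ∀ t ∉ S, J t = 0 := fun t ht => by simpa [hS] using ht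
  rw [finsum_eq_sum_of_support_subset J (s := S) (by simp [hS])]
  -- The jumps already passed plus the current left limit. Crossing `t` adds `J t` to the sum and
  -- turns the left limit `l t` into `r t = l t - J t`, so `G` is locally constant; comparing its
  -- values on both sides of `[a, b]` gives the claim.
  let G : ℝ → ℤ := fun x => (∑ t ∈ S, if t < x then J t else 0) + l x
  have hG : IsLocallyConstant G := by
    rw [IsLocallyConstant.iff_eventually_eq]
    intro x
    rw [← nhdsLT_sup_nhdsGE, ← nhdsGT_sup_nhdsWithin_singleton, nhdsWithin_singleton, eventually_sup,
      eventually_sup]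
    refine ⟨?_, ?_, by simp⟩
    · obtain ⟨δ, hδ, hsub⟩ := mem_nhdsLT_iff_exists_Ioo_subset.1 (hleft x)
      filter_upwards [Ioo_mem_nhdsLT hδ] with y hy
      have hlx : l y = l x := (hsub hy).1
      simp only [G, hlx, add_left_inj]
      refine Finset.sum_congr rfl fun t _ => ?_
      by_cases h1 : t < y
      · rw [if_pos h1, if_pos (h1.trans hy.2)]
      · by_cases h2 : t < x
        · have : J t = 0 := (hsub ⟨hy.1.trans_le (not_lt.1 h1), h2⟩).2
          simp [this]
        · rw [if_neg h1, if_neg h2]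
    · obtain ⟨δ, hδ, hsub⟩ := mem_nhdsGT_iff_exists_Ioo_subset.1 (hright x)
      filter_upwards [Ioo_mem_nhdsGT hδ] with y hy
      have hlx : l y = r x := (hsub hy).1
      have key : ∑ t ∈ S, (if t < y then J t else 0)
          = ∑ t ∈ S, (if t < x then J t else 0) + J x := by
        have : J x = ∑ t ∈ S, if t = x then J t else 0 := by
          rw [Finset.sum_ite_eq']
          split_ifs with h
          · rfl
          · exact hSJ x h
        rw [this, ← Finset.sum_add_distrib]
        refine Finset.sum_congr rfl fun t _ => ?_
        rcases lt_trichotomy t x with h | h | h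
        · rw [if_pos (h.trans hy.1), if_pos h, if_neg h.ne, add_zero]
        · subst h
          simp [hy.1]
        · rw [if_neg h.not_gt, if_neg h.ne', add_zero]
          by_cases h2 : t < y
          · rw [if_pos h2]
            exact (hsub ⟨h, h2.trans hy.2⟩).2
          · rw [if_neg h2]
      simp only [G, hlx, key, hJ x]
      ring
  have h1 : G (a - 1) = 0 := by
    simp only [G]
    rw [(hout (a - 1) (by simp)).1, add_zero]
    refine Finset.sum_eq_zero fun t ht => ?_
    split_ifs with h
    · exact (hout t fun h' => by linarith [h'.1]).2
    · rfl
  have h2 : G (b + 1) = ∑ t ∈ S, J t := by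
    simp only [G]
    rw [(hout (b + 1) (by simp)).1, add_zero]
    refine Finset.sum_congr rfl fun t ht => ?_
    split_ifs with h
    · rfl
    · exact (hout t fun h' => by linarith [h'.2]).2.symm
  rw [← h2, hG.apply_eq_of_preconnectedSpace (b + 1) (a - 1), h1]

end Jumps

section Arcs

variable {α : Type*} [TopologicalSpace α]

/-- `C ⊆ N` is an arc parametrized by `γ : [a, b] → C` with inverse `s`, compatible with the filters
`L` and `R` of left and right germs of `N`. -/
structure IsArc (N : Set α) (L R : α → Filter α) (C : Set α) (a b : ℝ) (γ : ℝ → α)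
    (s : α → ℝ) : Prop where
  lt : a < b
  continuousOn : ContinuousOn γ (Icc a b)
  image : γ '' Icc a b = C
  subset : C ⊆ N
  left_inv : ∀ t ∈ Icc a b, s (γ t) = t
  continuousOn_inv : ContinuousOn s C
  left : ∀ t ∈ Ioc a b, L (γ t) = map γ (𝓝[<] t)
  left_end : ∀ᶠ y in L (γ a), y ∉ C
  right : ∀ t ∈ Ico a b, R (γ t) = map γ (𝓝[>] t)
  right_end : ∀ᶠ y in R (γ b), y ∉ C

variable {N : Set α} {L R : α → Filter α} {C : Set α} {a b : ℝ} {γ : ℝ → α} {s : α → ℝ}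

theorem IsArc.isClosed [T2Space α] (h : IsArc N L R C a b γ s) : IsClosed C :=
  h.image ▸ (isCompact_Icc.image_of_continuousOn h.continuousOn).isClosed

theorem IsArc.mem (h : IsArc N L R C a b γ s) {t : ℝ} (ht : t ∈ Icc a b) : γ t ∈ C :=
  h.image ▸ mem_image_of_mem γ ht

/-- Read through the parameter, `h ∘ γ` is constant on each side of `t`, hence locally constant at
nearby inner parameters, where both one-sided values agree. -/
theorem IsArc.eventually_jump_eq_zero (hC : IsArc N L R C a b γ s) {h : α → ℤ}
    (hh : IsStep N L R h) {p : α} (hp : p ∈ N) (hCp : C ∈ 𝓝[N] p) :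
    ∀ᶠ y in 𝓝[≠] p, y ∈ N → ¬ jump L R h y ≠ 0 := by
  have hpC : p ∈ C := mem_of_mem_nhdsWithin hp hCp
  obtain ⟨t, ht, rfl⟩ : p ∈ γ '' Icc a b := hC.image ▸ hpC
  have inner : ∀ τ ∈ Ioo a b, ∀ m, (∀ᶠ z in 𝓝 τ, h (γ z) = m) → jump L R h (γ τ) = 0 := by
    intro τ hτ m hm
    rw [jump, hC.left τ ⟨hτ.1, hτ.2.le⟩, hC.right τ ⟨hτ.1.le, hτ.2⟩, sideVal_map, sideVal_map,
      sideVal_eq (h := h ∘ γ) (l := m) (hm.filter_mono nhdsWithin_le_nhds),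
      sideVal_eq (h := h ∘ γ) (l := m) (hm.filter_mono nhdsWithin_le_nhds), sub_self]
  have hl : ∀ᶠ τ in 𝓝[<] t, τ ∈ Icc a b → jump L R h (γ τ) = 0 := by
    rcases ht.1.eq_or_lt with rfl | hat
    · filter_upwards [self_mem_nhdsWithin] with τ hτ hτ'
      exact absurd hτ'.1 (not_le.2 hτ)
    · obtain ⟨m, hm⟩ := (hh _ hp).1
      rw [hC.left t ⟨hat, ht.2⟩, eventually_map] at hm
      filter_upwards [eventually_nhds_of_eventually_nhdsWithin_isOpen isOpen_Iio hm,
        Ioo_mem_nhdsLT hat] with τ hτ hτ' _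
      exact inner τ ⟨hτ'.1, hτ'.2.trans_le ht.2⟩ m hτ
  have hr : ∀ᶠ τ in 𝓝[>] t, τ ∈ Icc a b → jump L R h (γ τ) = 0 := by
    rcases ht.2.eq_or_lt with rfl | hat
    · filter_upwards [self_mem_nhdsWithin] with τ hτ hτ'
      exact absurd hτ'.2 (not_le.2 hτ)
    · obtain ⟨m, hm⟩ := (hh _ hp).2
      rw [hC.right t ⟨ht.1, hat⟩, eventually_map] at hm
      filter_upwards [eventually_nhds_of_eventually_nhdsWithin_isOpen isOpen_Ioi hm,
        Ioo_mem_nhdsGT hat] with τ hτ hτ' _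
      exact inner τ ⟨ht.1.trans_lt hτ'.1, hτ'.2⟩ m hτ
  have hlr : ∀ᶠ τ in 𝓝[≠] t, τ ∈ Icc a b → jump L R h (γ τ) = 0 := by
    rw [← Iio_union_Ioi, nhdsWithin_union, eventually_sup]
    exact ⟨hl, hr⟩
  -- The inverse parameter carries punctured neighbourhoods in the arc back to punctured
  -- neighbourhoods of `t`, where `hlr` applies.
  have hs : Tendsto s (𝓝[C ∩ {γ t}ᶜ] (γ t)) (𝓝[≠] t) := by
    refine tendsto_nhdsWithin_of_tendsto_nhds_of_eventually_within _ ?_ ?_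
    · have := (hC.continuousOn_inv (γ t) hpC).mono (inter_subset_left (t := {γ t}ᶜ))
      rwa [ContinuousWithinAt, hC.left_inv t ht] at this
    · filter_upwards [self_mem_nhdsWithin] with y hy
      rintro (h' : s y = t)
      obtain ⟨τ, hτ, rfl⟩ : y ∈ γ '' Icc a b := hC.image ▸ hy.1
      rw [hC.left_inv τ hτ] at h'
      exact hy.2 (by rw [h']; rfl)
  have h1 := eventually_nhdsWithin_iff.1 (hs.eventually hlr)
  rw [← eventually_nhdsWithin_iff] at h1
  have h2 := eventually_nhdsWithin_iff.1 hCp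
  rw [eventually_nhdsWithin_iff] at h1 ⊢
  filter_upwards [h1, h2] with y h1 h2 hne hyN
  have hyC := h2 hyN
  have := h1 ⟨hyC, hne⟩
  obtain ⟨τ, hτ, rfl⟩ : y ∈ γ '' Icc a b := hC.image ▸ hyC
  rw [hC.left_inv τ hτ] at this
  exact not_not.2 (this hτ)

/-- The restriction of `h` to the arc is the image of a step function on the line supported in `[a,
b]`, with the same jumps, so `finsum_jump_real` applies. Cutting `h` off creates new jumps at the
ends of the arc, and these are included in the sum. -/
theorem IsArc.finsum_jump_indicator [T2Space α] (hC : IsArc N L R C a b γ s)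
    (hL : ∀ x ∈ N, L x ≤ 𝓝[N] x) (hR : ∀ x ∈ N, R x ≤ 𝓝[N] x) {h : α → ℤ} (hh : IsStep N L R h) :
    IsStep N L R (C.indicator h) ∧ ∑ᶠ x ∈ N, jump L R (C.indicator h) x = 0 := by
  classical
  have hcl := hC.isClosed
  have outside : ∀ {F : Filter α} {x : α}, x ∉ C → F ≤ 𝓝[N] x → ∀ᶠ y in F, C.indicator h y = 0 := by
    intro F x hx hF
    filter_upwards [hF (nhdsWithin_le_nhds (hcl.isOpen_compl.mem_nhds hx))] with y hy
    exact indicator_of_notMem hy h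
  have lend : ∀ᶠ y in L (γ a), C.indicator h y = 0 :=
    hC.left_end.mono fun y hy => indicator_of_notMem hy h
  have rend : ∀ᶠ y in R (γ b), C.indicator h y = 0 :=
    hC.right_end.mono fun y hy => indicator_of_notMem hy h
  -- Extension by zero on the line corresponds to the indicator on N: `left_end` and `right_end` say
  -- that the arc does not continue beyond its ends on the outer sides.
  let k : ℝ → ℤ := fun t => if t ∈ Icc a b then h (γ t) else 0
  have hk : ∀ t ∈ Icc a b, C.indicator h (γ t) = k t := fun t ht => by
    simp only [k, if_pos ht, indicator_of_mem (hC.mem ht)]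
  have hk0 : ∀ t ∉ Icc a b, k t = 0 := fun t ht => if_neg ht
  have kl : ∀ t ∈ Ioc a b, ∀ᶠ y in 𝓝[<] t, C.indicator h (γ y) = k y := fun t ht => by
    filter_upwards [Ioo_mem_nhdsLT ht.1] with y hy using hk y ⟨hy.1.le, hy.2.le.trans ht.2⟩
  have kr : ∀ t ∈ Ico a b, ∀ᶠ y in 𝓝[>] t, C.indicator h (γ y) = k y := fun t ht => by
    filter_upwards [Ioo_mem_nhdsGT ht.2] with y hy using hk y ⟨ht.1.trans hy.1.le, hy.2.le⟩
  have kl0 : ∀ t ∉ Ioc a b, ∀ᶠ y in 𝓝[<] t, k y = 0 := fun t ht => by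
    by_cases hta : t ≤ a
    · filter_upwards [self_mem_nhdsWithin] with y hy
      exact hk0 y fun hy' => absurd (hy'.1.trans_lt hy) (not_lt.2 hta)
    · have hbt : b < t := lt_of_not_ge fun h => ht ⟨not_le.1 hta, h⟩
      filter_upwards [Ioo_mem_nhdsLT hbt] with y hy
      exact hk0 y fun hy' => absurd hy'.2 (not_le.2 hy.1)
  have kr0 : ∀ t ∉ Ico a b, ∀ᶠ y in 𝓝[>] t, k y = 0 := fun t ht => by
    by_cases hta : b ≤ t
    · filter_upwards [self_mem_nhdsWithin] with y hy
      exact hk0 y fun hy' => absurd (hta.trans_lt hy) (not_lt.2 hy'.2)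
    · have hbt : t < a := lt_of_not_ge fun h => ht ⟨h, not_le.1 hta⟩
      filter_upwards [Ioo_mem_nhdsGT hbt] with y hy
      exact hk0 y fun hy' => absurd hy'.1 (not_le.2 hy.2)
  have hstep : IsStep N L R (C.indicator h) := by
    intro x hx
    by_cases hxC : x ∈ C
    · obtain ⟨t, ht, rfl⟩ : x ∈ γ '' Icc a b := hC.image ▸ hxC
      constructor
      · rcases ht.1.eq_or_lt with rfl | hat
        · exact ⟨0, lend⟩
        · obtain ⟨m, hm⟩ := (hh _ hx).1
          refine ⟨m, ?_⟩
          rw [hC.left t ⟨hat, ht.2⟩, eventually_map] at hm ⊢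
          filter_upwards [hm, Ioo_mem_nhdsLT hat] with y h1 h2
          rw [indicator_of_mem (hC.mem ⟨h2.1.le, h2.2.le.trans ht.2⟩), h1]
      · rcases ht.2.eq_or_lt with rfl | hat
        · exact ⟨0, rend⟩
        · obtain ⟨m, hm⟩ := (hh _ hx).2
          refine ⟨m, ?_⟩
          rw [hC.right t ⟨ht.1, hat⟩, eventually_map] at hm ⊢
          filter_upwards [hm, Ioo_mem_nhdsGT hat] with y h1 h2
          rw [indicator_of_mem (hC.mem ⟨ht.1.trans h2.1.le, h2.2.le⟩), h1]
    · exact ⟨⟨0, outside hxC (hL x hx)⟩, ⟨0, outside hxC (hR x hx)⟩⟩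
  refine ⟨hstep, ?_⟩
  have kstep : IsStep univ (fun t => 𝓝[<] t) (fun t => 𝓝[>] t) k := by
    intro t _
    constructor
    · by_cases ht : t ∈ Ioc a b
      · obtain ⟨m, hm⟩ := (hstep _ (hC.subset (hC.mem ⟨ht.1.le, ht.2⟩))).1
        rw [hC.left t ht, eventually_map] at hm
        refine ⟨m, ?_⟩
        filter_upwards [hm, kl t ht] with y h1 h2
        rw [← h2, h1]
      · exact ⟨0, kl0 t ht⟩
    · by_cases ht : t ∈ Ico a b
      · obtain ⟨m, hm⟩ := (hstep _ (hC.subset (hC.mem ⟨ht.1, ht.2.le⟩))).2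
        rw [hC.right t ht, eventually_map] at hm
        refine ⟨m, ?_⟩
        filter_upwards [hm, kr t ht] with y h1 h2
        rw [← h2, h1]
      · exact ⟨0, kr0 t ht⟩
  have hinj : InjOn γ (Icc a b) := fun t ht t' ht' h => by
    rw [← hC.left_inv t ht, ← hC.left_inv t' ht', h]
  have e1 : ∑ᶠ x ∈ N, jump L R (C.indicator h) x = ∑ᶠ x ∈ C, jump L R (C.indicator h) x := by
    refine finsum_congr fun x => ?_
    by_cases hxC : x ∈ C
    · simp [hxC, hC.subset hxC]
    · have : jump L R (C.indicator h) x = 0 ∨ x ∉ N := by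
        by_cases hx : x ∈ N
        · left
          rw [jump, sideVal_eq_zero (outside hxC (hL x hx)), sideVal_eq_zero (outside hxC (hR x hx)),
            sub_self]
        · exact Or.inr hx
      rcases this with h0 | h0
      · simp [h0]
      · simp [h0, hxC]
  rw [e1, ← hC.image, finsum_mem_image hinj, ← finsum_jump_real hk0 kstep]
  refine finsum_congr fun t => ?_
  by_cases ht : t ∈ Icc a b
  · simp only [ht, finsum_true, jump]
    congr 1
    · rcases ht.1.eq_or_lt with rfl | hat
      · rw [hC.image, sideVal_eq_zero lend, sideVal_eq_zero (kl0 a (by simp))]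
      · rw [hC.image, hC.left t ⟨hat, ht.2⟩, sideVal_map]
        exact sideVal_congr (kl t ⟨hat, ht.2⟩)
    · rcases ht.2.eq_or_lt with rfl | hat
      · rw [hC.image, sideVal_eq_zero rend, sideVal_eq_zero (kr0 t (by simp))]
      · rw [hC.image, hC.right t ⟨ht.1, hat⟩, sideVal_map]
        exact sideVal_congr (kr t ⟨ht.1, hat⟩)
  · rw [show jump (fun t => 𝓝[<] t) (fun t => 𝓝[>] t) k t
      = sideVal (𝓝[<] t) k - sideVal (𝓝[>] t) k from rfl, sideVal_eq_zero (kl0 t fun h => ht ⟨h.1.le, h.2⟩),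
      sideVal_eq_zero (kr0 t fun h => ht ⟨h.1, h.2.le⟩)]
    simp [ht]

open Classical in
/-- `+1` at the final points and `-1` at the initial points of `N`. -/
noncomputable def endSign (L R : α → Filter α) (x : α) : ℤ :=
  (if L x = ⊥ then 0 else 1) - (if R x = ⊥ then 0 else 1)

/-- The signed number of end points of a compact set covered by compatibly oriented arcs is zero. -/
theorem finsum_endSign_eq_zero [T2Space α] (hN : IsCompact N)
    (hL : ∀ x ∈ N, L x ≤ 𝓝[N] x) (hR : ∀ x ∈ N, R x ≤ 𝓝[N] x)
    (harc : ∀ p ∈ N, ∃ C a b γ s, IsArc N L R C a b γ s ∧ C ∈ 𝓝[N] p) :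
    {x ∈ N | endSign L R x ≠ 0}.Finite ∧ ∑ᶠ x ∈ N, endSign L R x = 0 := by
  classical
  -- The default value 0 of `sideVal` on `⊥` makes the constant function 1 jump exactly where one of
  -- the two sides is missing.
  have one : endSign L R = jump L R fun _ => 1 := by
    funext x
    have : ∀ F : Filter α, sideVal F (fun _ => 1) = if F = ⊥ then 0 else 1 := fun F => by
      rcases F.eq_or_neBot with rfl | hF
      · simp [sideVal_bot]
      · rw [sideVal_eq (l := 1) (by simp), if_neg hF.ne]
    rw [endSign, jump, this, this]
  have hfin : ∀ h : α → ℤ, IsStep N L R h → {x ∈ N | jump L R h x ≠ 0}.Finite := fun h hh =>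
    finite_inter_of_isCompact hN fun x hx => by
      obtain ⟨C, a, b, γ, s, hC, hCx⟩ := harc x hx
      exact hC.eventually_jump_eq_zero hh hx hCx
  have hstep1 : IsStep N L R fun _ => 1 := fun x _ => ⟨⟨1, by simp⟩, ⟨1, by simp⟩⟩
  refine ⟨one ▸ hfin _ hstep1, ?_⟩
  choose! C a b γ s hC hCx using harc
  obtain ⟨t, htN, htc⟩ := hN.elim_nhdsWithin_subcover C hCx
  -- Arcs are removed one at a time. What is subtracted is the indicator of the current `h`, not of
  -- 1, so overlapping arcs cause no trouble: `h` stays zero on the arcs already treated.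
  have key : ∀ t : Finset α, (∀ p ∈ t, p ∈ N) → ∃ h : α → ℤ, IsStep N L R h ∧
      (∀ p ∈ t, ∀ x ∈ C p, h x = 0) ∧ ∑ᶠ x ∈ N, jump L R h x = ∑ᶠ x ∈ N, endSign L R x := by
    intro t
    induction t using Finset.induction_on with
    | empty => exact fun _ => ⟨fun _ => 1, hstep1, by simp, by rw [one]⟩
    | insert p t hp ih =>
      intro htN
      obtain ⟨h, hh, h0, hsum⟩ := ih fun q hq => htN q (Finset.mem_insert_of_mem hq)
      have hpN := htN p (Finset.mem_insert_self p t)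
      obtain ⟨hi, hi0⟩ := (hC p hpN).finsum_jump_indicator hL hR hh
      have hd : IsStep N L R fun x => h x - (C p).indicator h x := fun x hx => by
        obtain ⟨⟨l, hl⟩, ⟨r, hr⟩⟩ := hh x hx
        obtain ⟨⟨l', hl'⟩, ⟨r', hr'⟩⟩ := hi x hx
        refine ⟨⟨l - l', ?_⟩, ⟨r - r', ?_⟩⟩
        · filter_upwards [hl, hl'] with y h1 h2
          rw [h1, h2]
        · filter_upwards [hr, hr'] with y h1 h2
          rw [h1, h2]
      have hj : ∀ x ∈ N, jump L R h x = jump L R (fun x => h x - (C p).indicator h x) x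
          + jump L R ((C p).indicator h) x := fun x hx => by
        simp only [jump]
        rw [sideVal_sub (hh x hx).1 (hi x hx).1, sideVal_sub (hh x hx).2 (hi x hx).2]
        ring
      refine ⟨fun x => h x - (C p).indicator h x, hd, fun q hq x hx => ?_, ?_⟩
      · rcases Finset.mem_insert.1 hq with rfl | hq
        · simp [hx]
        · have := h0 q hq x hx
          by_cases hxp : x ∈ C p
          · simp [hxp]
          · simp [hxp, this]
      · rw [← hsum, finsum_mem_congr rfl hj, finsum_mem_add_distrib' (hfin _ hd) (hfin _ hi), hi0,
          add_zero]
  obtain ⟨h, hh, h0, hsum⟩ := key t htN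
  have hN0 : ∀ x ∈ N, h x = 0 := fun x hx => by
    obtain ⟨p, hp, hxp⟩ := mem_iUnion₂.1 (htc hx)
    exact h0 p hp x hxp
  rw [← hsum]
  refine finsum_mem_eq_zero_of_forall_eq_zero fun x hx => ?_
  rw [jump, sideVal_eq_zero, sideVal_eq_zero, sub_self]
  · filter_upwards [hR x hx self_mem_nhdsWithin] with y hy using hN0 y hy
  · filter_upwards [hL x hx self_mem_nhdsWithin] with y hy using hN0 y hy

end Arcs

/-! ### Determinants and relative orientations -/

section OrientSign

variable {V W : Type*} [AddCommGroup V] [Module ℝ V] [AddCommGroup W] [Module ℝ W] {n m : ℕ}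

/-- Two representatives of a ray are positively proportional, so the arbitrary choice behind
`someVector` does not affect signs. -/
theorem orientSign_rayOfNeZero {φ : V [⋀^Fin n]→ₗ[ℝ] ℝ} (hφ : φ ≠ 0) (v : Fin n → V) :
    orientSign (rayOfNeZero ℝ φ hφ) v = SignType.sign (φ v) := by
  set θ := rayOfNeZero ℝ φ hφ
  have h : SameRay ℝ θ.someVector φ := by
    rw [← ray_eq_iff θ.someVector_ne_zero hφ]
    exact θ.someVector_ray
  obtain ⟨r₁, r₂, h₁, h₂, h⟩ := h.exists_pos θ.someVector_ne_zero hφ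
  have h' : r₁ * θ.someVector v = r₂ * φ v := by
    simpa using congrArg (fun ψ : V [⋀^Fin n]→ₗ[ℝ] ℝ => ψ v) h
  have := congrArg SignType.sign h'
  rwa [sign_mul, sign_mul, sign_pos h₁, sign_pos h₂, one_mul, one_mul] at this

theorem orientSign_neg (θ : Orientation ℝ V (Fin n)) (v : Fin n → V) :
    orientSign (-θ) v = -orientSign θ v := by
  induction θ using Module.Ray.ind with
  | h φ hφ =>
    rw [neg_rayOfNeZero, orientSign_rayOfNeZero, orientSign_rayOfNeZero]
    simp [Left.sign_neg]

theorem orientSign_map (e : V ≃ₗ[ℝ] W) (θ : Orientation ℝ V (Fin n)) (v : Fin n → V) :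
    orientSign (Orientation.map _ e θ) (e ∘ v) = orientSign θ v := by
  induction θ using Module.Ray.ind with
  | h φ hφ =>
    rw [Orientation.map_apply, orientSign_rayOfNeZero, orientSign_rayOfNeZero]
    simp [Function.comp_def]

/-- Given a basis there are only the orientations `θ` and `-θ`, and by `map_neg` replacing one by
the other flips both factors; the existential in `Pos` can therefore be tested on any single
orientation. -/
theorem LinearRelOrientation.pos_iff (σ : LinearRelOrientation V W n m) (e : Basis (Fin n) ℝ V)
    (θ : Orientation ℝ V (Fin n)) (v : Fin n → V) (w : Fin m → W) :
    σ.Pos v w ↔ 0 < orientSign θ v * orientSign (σ.toFun θ) w := by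
  refine ⟨fun ⟨θ', h⟩ => ?_, fun h => ⟨θ, h⟩⟩
  have : θ' = θ ∨ θ' = -θ := by
    rcases e.orientation_eq_or_eq_neg θ with h1 | h1 <;>
      rcases e.orientation_eq_or_eq_neg θ' with h2 | h2
    · exact Or.inl (h2.trans h1.symm)
    · exact Or.inr (by rw [h1, h2])
    · exact Or.inr (by rw [h1, h2]; exact (neg_neg (e.orientation : Module.Ray ℝ (V [⋀^Fin n]→ₗ[ℝ] ℝ))).symm)
    · exact Or.inl (h2.trans h1.symm)
  rcases this with rfl | rfl
  · exact h
  · rwa [σ.map_neg, orientSign_neg, orientSign_neg, neg_mul_neg] at h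

theorem LinearRelOrientation.pos_iff_mul_pos (σ : LinearRelOrientation V W n m)
    (e : Basis (Fin n) ℝ V) (v : Fin n → V) (w : Fin m → W) :
    σ.Pos v w ↔ 0 < e.orientation.someVector v * (σ.toFun e.orientation).someVector w := by
  rw [σ.pos_iff e e.orientation, orientSign, orientSign, ← sign_mul]
  generalize e.orientation.someVector v * (σ.toFun e.orientation).someVector w = x
  rcases lt_trichotomy x 0 with h | h | h
  · simp [sign_neg h, h.not_gt]
  · simp [h]
  · simp [sign_pos h, h]

theorem LinearRelOrientation.pos_map_iff {V' W' : Type*} [AddCommGroup V'] [Module ℝ V']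
    [AddCommGroup W'] [Module ℝ W'] (σ : LinearRelOrientation V W n m)
    (σ' : LinearRelOrientation V' W' n m) (b : Basis (Fin n) ℝ V) (T : V ≃ₗ[ℝ] V') (S : W ≃ₗ[ℝ] W')
    (h : ∀ θ, Orientation.map _ S (σ.toFun θ) = σ'.toFun (Orientation.map _ T θ))
    (v : Fin n → V) (w : Fin m → W) : σ'.Pos (T ∘ v) (S ∘ w) ↔ σ.Pos v w := by
  rw [σ.pos_iff b b.orientation, σ'.pos_iff (b.map T) (Orientation.map _ T b.orientation), ← h,
    orientSign_map, orientSign_map]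

theorem signOf_mul_self (p : Prop) : (signOf p : ℝ) * signOf p = 1 := by
  unfold signOf
  split_ifs <;> norm_num

theorem signOf_congr {p q : Prop} (h : p ↔ q) : signOf p = signOf q := by
  rw [propext h]

theorem signOf_mul_pos {x y : ℝ} (hx : x ≠ 0) (hy : y ≠ 0) :
    0 < (signOf (0 < x * y) : ℝ) * signOf (0 < x) * y := by
  unfold signOf
  rcases hx.lt_or_gt with hx | hx <;> rcases hy.lt_or_gt with hy | hy
  · simp [hx.not_gt, mul_pos_of_neg_of_neg hx hy, hy]
  · simp [hx.not_gt, (mul_neg_of_neg_of_pos hx hy).not_gt, hy]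
  · simp [hx, (mul_neg_of_pos_of_neg hx hy).not_gt, hy]
  · simp [hx, mul_pos hx hy, hy]

/-- Top forms scale by the determinant under a change of frame, so the relative sign of two pairs of
frames is that of the product of the two determinants. -/
theorem LinearRelOrientation.signOf_pos_change (σ : LinearRelOrientation V W n m)
    (b : Basis (Fin n) ℝ V) (c : Basis (Fin m) ℝ W) {v : Fin n → V} {w : Fin m → W}
    (hv : b.det v ≠ 0) (hw : c.det w ≠ 0) :
    0 < (signOf (σ.Pos v w) : ℝ) * signOf (σ.Pos b c) * (b.det v * c.det w) := by
  set α := b.orientation.someVector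
  set β := (σ.toFun b.orientation).someVector
  have hα : α b ≠ 0 := fun h => b.orientation.someVector_ne_zero (by
    have := AlternatingMap.eq_smul_basis_det b α
    rw [h, zero_smul] at this
    exact this)
  have hβ : β c ≠ 0 := fun h => (σ.toFun b.orientation).someVector_ne_zero (by
    have := AlternatingMap.eq_smul_basis_det c β
    rw [h, zero_smul] at this
    exact this)
  have e : α v * β w = α b * β c * (b.det v * c.det w) := by
    have h1 := congrArg (fun φ : V [⋀^Fin n]→ₗ[ℝ] ℝ => φ v) (AlternatingMap.eq_smul_basis_det b α)
    have h2 := congrArg (fun φ : W [⋀^Fin m]→ₗ[ℝ] ℝ => φ w) (AlternatingMap.eq_smul_basis_det c β)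
    simp only [AlternatingMap.smul_apply, smul_eq_mul] at h1 h2
    rw [h1, h2]
    ring
  rw [signOf_congr (σ.pos_iff_mul_pos b v w), signOf_congr (σ.pos_iff_mul_pos b b c)]
  change 0 < (signOf (0 < α v * β w) : ℝ) * signOf (0 < α b * β c) * _
  rw [e]
  exact signOf_mul_pos (mul_ne_zero hα hβ) (mul_ne_zero hv hw)

end OrientSign

section FrameDet

variable {V₁ V₂ W₁ W₂ : Type*} [AddCommGroup V₁] [Module ℝ V₁] [AddCommGroup V₂] [Module ℝ V₂]
  [AddCommGroup W₁] [Module ℝ W₁] [AddCommGroup W₂] [Module ℝ W₂] {n₁ n₂ m₁ m₂ : ℕ}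

theorem det_basis_prod {ι₁ ι₂ : Type*} [Fintype ι₁] [DecidableEq ι₁] [Fintype ι₂] [DecidableEq ι₂]
    (b₁ : Basis ι₁ ℝ V₁) (b₂ : Basis ι₂ ℝ V₂) (v₁ : ι₁ → V₁) (v₂ : ι₂ → V₂) :
    (b₁.prod b₂).det (Sum.elim (fun i => (v₁ i, (0 : V₂))) fun i => ((0 : V₁), v₂ i))
      = b₁.det v₁ * b₂.det v₂ := by
  rw [Basis.det_apply, Basis.det_apply, Basis.det_apply, ← Matrix.det_fromBlocks_zero₁₂ _ 0]
  congr 1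
  ext (i | i) (j | j) <;> simp [Basis.toMatrix_apply]

/-- The frame of `V₁ × V₂` made of frames of the factors. -/
def prodFrame {V₁ V₂ : Type*} [Zero V₁] [Zero V₂] (v₁ : Fin n₁ → V₁) (v₂ : Fin n₂ → V₂) : Fin (n₁ + n₂) → V₁ × V₂ :=
  Fin.append (fun i => (v₁ i, 0)) (fun i => (0, v₂ i))

theorem prodFrame_comp_finSumFinEquiv {V₁ V₂ : Type*} [Zero V₁] [Zero V₂]
    (v₁ : Fin n₁ → V₁) (v₂ : Fin n₂ → V₂) :
    prodFrame v₁ v₂ ∘ finSumFinEquiv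
      = Sum.elim (fun i => (v₁ i, (0 : V₂))) fun i => ((0 : V₁), v₂ i) := by
  funext i
  rcases i with i | i <;> simp [prodFrame]

/-- The basis of `V₁ × V₂` made of bases of the factors. -/
noncomputable def prodBasis (b₁ : Basis (Fin n₁) ℝ V₁) (b₂ : Basis (Fin n₂) ℝ V₂) :
    Basis (Fin (n₁ + n₂)) ℝ (V₁ × V₂) :=
  (b₁.prod b₂).reindex finSumFinEquiv

theorem coe_prodBasis (b₁ : Basis (Fin n₁) ℝ V₁) (b₂ : Basis (Fin n₂) ℝ V₂) :
    ⇑(prodBasis b₁ b₂) = prodFrame b₁ b₂ := by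
  funext i
  obtain ⟨j, rfl⟩ := finSumFinEquiv.surjective i
  rcases j with j | j <;> simp [prodBasis, prodFrame]

theorem prodBasis_det (b₁ : Basis (Fin n₁) ℝ V₁) (b₂ : Basis (Fin n₂) ℝ V₂) (v₁ : Fin n₁ → V₁)
    (v₂ : Fin n₂ → V₂) : (prodBasis b₁ b₂).det (prodFrame v₁ v₂) = b₁.det v₁ * b₂.det v₂ := by
  rw [prodBasis, Basis.det_reindex, prodFrame_comp_finSumFinEquiv, det_basis_prod]

/-- The basis of `V × ℝ` with the unit vector of `ℝ` in the last position. -/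
noncomputable def snocBasis (c : Basis (Fin n₁) ℝ V₁) : Basis (Fin (n₁ + 1)) ℝ (V₁ × ℝ) :=
  prodBasis c (Basis.singleton (Fin 1) ℝ)

theorem snocBasis_det (c : Basis (Fin n₁) ℝ V₁) (w : Fin (n₁ + 1) → V₁ × ℝ) :
    (snocBasis c).det w = ∑ j : Fin (n₁ + 1), (-1) ^ (n₁ + (j : ℕ)) * (w j).2 *
      c.det (fun i => (w (j.succAbove i)).1) := by
  rw [Basis.det_apply, Matrix.det_succ_row _ (Fin.last n₁)]
  refine Finset.sum_congr rfl fun j _ => ?_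
  have h1 : (snocBasis c).toMatrix w (Fin.last n₁) j = (w j).2 := by
    have : Fin.last n₁ = finSumFinEquiv (Sum.inr (0 : Fin 1)) := by
      ext
      simp
    rw [this]
    simp [snocBasis, prodBasis, Basis.toMatrix_apply, -finSumFinEquiv_apply_right]
  have h2 : ((snocBasis c).toMatrix w).submatrix (Fin.last n₁).succAbove j.succAbove
      = c.toMatrix (fun i => (w (j.succAbove i)).1) := by
    ext i k
    have : (Fin.last n₁).succAbove i = finSumFinEquiv (Sum.inl i : Fin n₁ ⊕ Fin 1) := by
      ext
      simp
    rw [Matrix.submatrix_apply, this]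
    simp [snocBasis, prodBasis, Basis.toMatrix_apply, -finSumFinEquiv_apply_left]
  rw [h1, h2, Fin.val_last, Basis.det_apply]

/-- The determinant of `T : V₁ ⊕ V₂ → W₁ ⊕ W₂ ⊕ ℝ` with respect to a frame of the domain and a basis
of the target. -/
noncomputable def frameDet (h : m₁ + m₂ + 1 = n₁ + n₂) (v₁ : Fin n₁ → V₁) (v₂ : Fin n₂ → V₂)
    (c₁ : Basis (Fin m₁) ℝ W₁) (c₂ : Basis (Fin m₂) ℝ W₂) (T : V₁ × V₂ →ₗ[ℝ] (W₁ × W₂) × ℝ) : ℝ :=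
  (snocBasis (prodBasis c₁ c₂)).det (fun j => T (prodFrame v₁ v₂ (Fin.cast h j)))

theorem frameDet_change_frame (h : m₁ + m₂ + 1 = n₁ + n₂) (b₁ : Basis (Fin n₁) ℝ V₁)
    (b₂ : Basis (Fin n₂) ℝ V₂) (v₁ : Fin n₁ → V₁) (v₂ : Fin n₂ → V₂)
    (c₁ : Basis (Fin m₁) ℝ W₁) (c₂ : Basis (Fin m₂) ℝ W₂) (T : V₁ × V₂ →ₗ[ℝ] (W₁ × W₂) × ℝ) :
    frameDet h v₁ v₂ c₁ c₂ T = frameDet h b₁ b₂ c₁ c₂ T * (b₁.det v₁ * b₂.det v₂) := by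
  let B := (prodBasis b₁ b₂).reindex (finCongr h.symm)
  have := congrArg (fun φ : (V₁ × V₂) [⋀^Fin (m₁ + m₂ + 1)]→ₗ[ℝ] ℝ =>
      φ (fun j => prodFrame v₁ v₂ (Fin.cast h j)))
    (AlternatingMap.eq_smul_basis_det B ((snocBasis (prodBasis c₁ c₂)).det.compLinearMap T))
  simp only [AlternatingMap.compLinearMap_apply, AlternatingMap.smul_apply, smul_eq_mul] at this
  rw [frameDet, this, frameDet, ← prodBasis_det b₁ b₂ v₁ v₂, Basis.det_reindex]
  congr 2
  funext j
  simp [B, coe_prodBasis]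

theorem frameDet_change_basis (h : m₁ + m₂ + 1 = n₁ + n₂) (v₁ : Fin n₁ → V₁) (v₂ : Fin n₂ → V₂)
    (c₁ c₁' : Basis (Fin m₁) ℝ W₁) (c₂ c₂' : Basis (Fin m₂) ℝ W₂)
    (T : V₁ × V₂ →ₗ[ℝ] (W₁ × W₂) × ℝ) :
    frameDet h v₁ v₂ c₁' c₂' T
      = frameDet h v₁ v₂ c₁ c₂ T * (c₁'.det c₁ * c₂'.det c₂) := by
  have key : (snocBasis (prodBasis c₁' c₂')).det (snocBasis (prodBasis c₁ c₂))
      = c₁'.det c₁ * c₂'.det c₂ := by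
    rw [snocBasis, snocBasis, coe_prodBasis, prodBasis_det, Basis.det_self, mul_one, coe_prodBasis,
      prodBasis_det]
  have := congrArg (fun φ : ((W₁ × W₂) × ℝ) [⋀^Fin (m₁ + m₂ + 1)]→ₗ[ℝ] ℝ =>
      φ (fun j => T (prodFrame v₁ v₂ (Fin.cast h j))))
    (AlternatingMap.eq_smul_basis_det (snocBasis (prodBasis c₁ c₂))
      (snocBasis (prodBasis c₁' c₂')).det)
  simp only [AlternatingMap.smul_apply, smul_eq_mul, key] at this
  rw [frameDet, this, frameDet, mul_comm]

/-- The determinant of `T`, with the sign that makes it depend on relative orientations only. -/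
noncomputable def orientedDet (σ₁ : LinearRelOrientation V₁ W₁ n₁ m₁)
    (σ₂ : LinearRelOrientation V₂ W₂ n₂ m₂) (h : m₁ + m₂ + 1 = n₁ + n₂)
    (v₁ : Fin n₁ → V₁) (v₂ : Fin n₂ → V₂)
    (c₁ : Basis (Fin m₁) ℝ W₁) (c₂ : Basis (Fin m₂) ℝ W₂) (T : V₁ × V₂ →ₗ[ℝ] (W₁ × W₂) × ℝ) : ℝ :=
  signOf (σ₁.Pos v₁ c₁) * signOf (σ₂.Pos v₂ c₂) * frameDet h v₁ v₂ c₁ c₂ T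

/-- The determinant and the signs of the relative orientations change by the same sign, so only a
positive factor remains. It does not depend on `T`, so one can pass between frames for all
functionals at once. -/
theorem orientedDet_change (σ₁ : LinearRelOrientation V₁ W₁ n₁ m₁)
    (σ₂ : LinearRelOrientation V₂ W₂ n₂ m₂) (h : m₁ + m₂ + 1 = n₁ + n₂)
    (b₁ : Basis (Fin n₁) ℝ V₁) (b₂ : Basis (Fin n₂) ℝ V₂)
    (c₁ c₁' : Basis (Fin m₁) ℝ W₁) (c₂ c₂' : Basis (Fin m₂) ℝ W₂)
    {v₁ : Fin n₁ → V₁} {v₂ : Fin n₂ → V₂} (h₁ : b₁.det v₁ ≠ 0) (h₂ : b₂.det v₂ ≠ 0) :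
    ∃ r : ℝ, 0 < r ∧ ∀ T, orientedDet σ₁ σ₂ h v₁ v₂ c₁' c₂' T
      = r * orientedDet σ₁ σ₂ h b₁ b₂ c₁ c₂ T := by
  have k₁ : c₁.det c₁' * c₁'.det c₁ = 1 := by rw [Basis.det_mul_det, Basis.det_self]
  have k₂ : c₂.det c₂' * c₂'.det c₂ = 1 := by rw [Basis.det_mul_det, Basis.det_self]
  have p₁ := σ₁.signOf_pos_change b₁ c₁ h₁ (left_ne_zero_of_mul_eq_one k₁)
  have p₂ := σ₂.signOf_pos_change b₂ c₂ h₂ (left_ne_zero_of_mul_eq_one k₂)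
  have q₁ := signOf_mul_self (σ₁.Pos b₁ c₁)
  have q₂ := signOf_mul_self (σ₂.Pos b₂ c₂)
  -- `p₁`, `p₂` contain `cᵢ.det cᵢ'`, while `frameDet` changes by the inverse `cᵢ'.det cᵢ`; the
  -- positive squares of the latter convert one into the other.
  refine ⟨_, mul_pos (mul_pos p₁ p₂) (mul_pos
    (pow_pos (abs_pos.2 (right_ne_zero_of_mul_eq_one k₁)) 2)
    (pow_pos (abs_pos.2 (right_ne_zero_of_mul_eq_one k₂)) 2)), fun T => ?_⟩
  rw [orientedDet, orientedDet, frameDet_change_basis h v₁ v₂ c₁ c₁' c₂ c₂',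
    frameDet_change_frame h b₁ b₂ v₁ v₂, sq_abs, sq_abs]
  generalize (signOf (σ₁.Pos b₁ c₁) : ℝ) = s₁ at *
  generalize (signOf (σ₂.Pos b₂ c₂) : ℝ) = s₂ at *
  generalize (signOf (σ₁.Pos v₁ c₁') : ℝ) = s₁' at *
  generalize (signOf (σ₂.Pos v₂ c₂') : ℝ) = s₂' at *
  generalize c₁.det c₁' = x₁ at *
  generalize c₂.det c₂' = x₂ at *
  generalize c₁'.det c₁ = y₁ at *
  generalize c₂'.det c₂ = y₂ at *
  generalize frameDet h b₁ b₂ c₁ c₂ T = d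
  generalize b₁.det v₁ = z₁
  generalize b₂.det v₂ = z₂
  linear_combination (-(s₁' * s₂' * d * z₁ * z₂ * y₁ * y₂) * (s₁ * s₁) * (s₂ * s₂)) *
    (x₂ * y₂ * k₁ + k₂) - (s₁' * s₂' * d * z₁ * z₂ * y₁ * y₂) * (s₂ * s₂ * q₁ + q₂)

end FrameDet

/-! ### Half-spaces, their boundary hyperplanes and outward vectors -/

section HalfSpace

variable {E : Type*} [NormedAddCommGroup E] [NormedSpace ℝ E] {H : Type*} [TopologicalSpace H]
  {I : ModelWithCorners ℝ E H} {l : E →L[ℝ] ℝ}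

theorem isOpenMap_of_ne_zero (hl : l ≠ 0) : IsOpenMap l := by
  have : (l : E →ₗ[ℝ] ℝ) ≠ 0 := fun h => hl (by ext x; exact LinearMap.congr_fun h x)
  exact LinearMap.isOpenMap_of_finiteDimensional (l : E →ₗ[ℝ] ℝ) (LinearMap.surjective this)

theorem interior_range_eq (hI : range I = {x | 0 ≤ l x}) (hl : l ≠ 0) :
    interior (range I) = {x | 0 < l x} := by
  have := (isOpenMap_of_ne_zero hl).preimage_interior_eq_interior_preimage l.continuous (Ici 0)
  rw [interior_Ici] at this
  rw [hI]
  exact this.symm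

theorem frontier_range_eq (hI : range I = {x | 0 ≤ l x}) (hl : l ≠ 0) :
    frontier (range I) = {x | l x = 0} := by
  have := (isOpenMap_of_ne_zero hl).preimage_frontier_eq_frontier_preimage l.continuous (Ici 0)
  rw [frontier_Ici] at this
  rw [hI]
  exact this.symm

theorem mem_boundaryTangent_iff (hI : range I = {x | 0 ≤ l x}) (hl : l ≠ 0) {x : E} :
    x ∈ boundaryTangent I ↔ l x = 0 := by
  have : frontier (range I) = (LinearMap.ker (l : E →ₗ[ℝ] ℝ) : Set E) := by
    rw [frontier_range_eq hI hl]
    rfl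
  rw [boundaryTangent, this, Submodule.span_eq]
  rfl

theorem finrank_boundaryTangent [FiniteDimensional ℝ E] (hI : range I = {x | 0 ≤ l x})
    (hl : l ≠ 0) : finrank ℝ (boundaryTangent I) + 1 = finrank ℝ E := by
  have h : boundaryTangent I = LinearMap.ker (l : E →ₗ[ℝ] ℝ) := by
    ext x
    rw [mem_boundaryTangent_iff hI hl]
    rfl
  rw [h]
  exact Module.Dual.finrank_ker_add_one_of_ne_zero
    (f := (l : E →ₗ[ℝ] ℝ)) fun h => hl (by ext x; exact LinearMap.congr_fun h x)

theorem exists_apply_neg (hl : l ≠ 0) : ∃ ν, l ν < 0 := by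
  obtain ⟨x, hx⟩ : ∃ x, l x ≠ 0 := by
    by_contra! h
    exact hl (ContinuousLinearMap.ext h)
  rcases hx.lt_or_gt with h | h
  · exact ⟨x, h⟩
  · exact ⟨-x, by simpa using h⟩

theorem isOutward_iff (hI : range I = {x | 0 ≤ l x}) (hl : l ≠ 0) {ν : E} :
    IsOutward I ν ↔ l ν < 0 := by
  rw [IsOutward, interior_range_eq hI hl]
  simp

end HalfSpace

/-! ### Frames completed by an outward vector in the last position -/

section AppendLast

theorem appendLast_succ {V : Type*} {k : ℕ} (b : Fin (k + 1 - 1) → V) (ν : V) :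
    appendLast b ν = (Fin.snoc (α := fun _ => V) (b : Fin k → V) ν : Fin (k + 1) → V) := by
  funext i
  refine Fin.lastCases ?_ (fun j => ?_) i
  · simp [appendLast]
  · simp [appendLast]

theorem append_apply {β : Type*} {m n : ℕ} (u : Fin m → β) (v : Fin n → β) (i : Fin (m + n)) :
    Fin.append u v i
      = if h : (i : ℕ) < m then u ⟨i, h⟩ else v ⟨i - m, by have := i.2; omega⟩ := by
  refine Fin.addCases (fun j => ?_) (fun j => ?_) i
  · simp
  · simp

variable {E : Type*} [NormedAddCommGroup E] [NormedSpace ℝ E] {H : Type*} [TopologicalSpace H]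
  {I : ModelWithCorners ℝ E H} {l : E →L[ℝ] ℝ} {n : ℕ}

/-- Ensures that `n - 1` in the boundary frames is a genuine subtraction. -/
theorem pos_of_basis_of_ne_zero (hl : l ≠ 0) (e : Basis (Fin n) ℝ E) : ∃ k, n = k + 1 := by
  rcases n with _ | k
  · refine absurd ?_ hl
    have : (l : E →ₗ[ℝ] ℝ) = 0 := e.ext fun i => i.elim0
    ext x
    exact LinearMap.congr_fun this x
  · exact ⟨k, rfl⟩

theorem alternatingMap_appendLast (hI : range I = {x | 0 ≤ l x}) (hl : l ≠ 0)
    (e : Basis (Fin n) ℝ E) (b : Basis (Fin (n - 1)) ℝ (boundaryTangent I))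
    (φ : E [⋀^Fin n]→ₗ[ℝ] ℝ) (ν ν' : E) :
    φ (appendLast (fun i => (b i : E)) ν') * l ν = φ (appendLast (fun i => (b i : E)) ν) * l ν' := by
  obtain ⟨k, rfl⟩ := pos_of_basis_of_ne_zero hl e
  let b' : Basis (Fin k) ℝ (boundaryTangent I) := b
  let v : Fin k → E := fun i => (b' i : E)
  let F : E →ₗ[ℝ] ℝ := φ.toMultilinearMap.toLinearMap (Fin.snoc (α := fun _ => E) v 0) (Fin.last k)
  have hF : ∀ x, φ (appendLast (fun i => (b i : E)) x) = F x := fun x => by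
    rw [appendLast_succ]
    simp only [F, MultilinearMap.toLinearMap_apply, Fin.update_snoc_last]
    rfl
  have hF0 : ∀ x, l x = 0 → F x = 0 := fun x hx => by
    have hx' := (mem_boundaryTangent_iff hI hl).2 hx
    have hsum := congrArg (Submodule.subtype _) (b'.sum_repr ⟨x, hx'⟩)
    rw [map_sum] at hsum
    simp only [map_smul, Submodule.subtype_apply] at hsum
    rw [← hsum, map_sum]
    refine Finset.sum_eq_zero fun i _ => ?_
    rw [map_smul]
    have : F (b' i : E) = 0 := by
      simp only [F, MultilinearMap.toLinearMap_apply, Fin.update_snoc_last]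
      refine φ.map_eq_zero_of_eq _ (i := i.castSucc) (j := Fin.last k) ?_ (Fin.castSucc_lt_last i).ne
      simp [v]
    rw [this, smul_zero]
  -- This combination lies in the kernel of `l`, the span of `b`; an alternating map that already
  -- contains `b` in its other slots vanishes on it.
  have := hF0 (l ν • ν' - l ν' • ν) (by simp [mul_comm])
  rw [map_sub, map_smul, map_smul, smul_eq_mul, smul_eq_mul] at this
  rw [hF, hF]
  linarith

/-- Replacing one outward vector by another multiplies every top form by the ratio of their
`l`-values, which is positive, so the existential in `BoundaryPos` may be tested on any chosen `ν`.
-/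
theorem LinearRelOrientation.boundaryPos_iff {W : Type*} [AddCommGroup W] [Module ℝ W] {m : ℕ}
    (hI : range I = {x | 0 ≤ l x}) (hl : l ≠ 0) (σ : LinearRelOrientation E W n m)
    (e : Basis (Fin n) ℝ E) (b : Basis (Fin (n - 1)) ℝ (boundaryTangent I)) {ν : E} (hν : l ν < 0)
    (w : Fin m → W) :
    σ.BoundaryPos I b w ↔ σ.Pos (appendLast (fun i => (b i : E)) ν) w := by
  refine ⟨fun ⟨ν', hν', hpos⟩ => ?_, fun h => ⟨ν, (isOutward_iff hI hl).2 hν, h⟩⟩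
  rw [isOutward_iff hI hl] at hν'
  rw [σ.pos_iff_mul_pos e] at hpos ⊢
  have := alternatingMap_appendLast hI hl e b e.orientation.someVector ν ν'
  set x := e.orientation.someVector (appendLast (fun i => (b i : E)) ν)
  set y := e.orientation.someVector (appendLast (fun i => (b i : E)) ν')
  have hx : x = y * (l ν / l ν') := by
    field_simp [hν'.ne]
    linarith
  rw [hx, mul_right_comm]
  exact mul_pos hpos (div_pos_of_neg_of_neg hν hν')

theorem det_appendLast_ne_zero (hI : range I = {x | 0 ≤ l x}) (hl : l ≠ 0)
    (e : Basis (Fin n) ℝ E) (b : Basis (Fin (n - 1)) ℝ (boundaryTangent I)) {ν : E} (hν : l ν ≠ 0) :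
    e.det (appendLast (fun i => (b i : E)) ν) ≠ 0 := by
  obtain ⟨k, rfl⟩ := pos_of_basis_of_ne_zero hl e
  let b' : Basis (Fin k) ℝ (boundaryTangent I) := b
  have hli : LinearIndependent ℝ (Fin.snoc (α := fun _ => E) (fun i => (b' i : E)) ν) := by
    rw [linearIndependent_finSnoc]
    refine ⟨b'.linearIndependent.map' (boundaryTangent I).subtype (Submodule.ker_subtype _), ?_⟩
    intro h
    refine hν ((mem_boundaryTangent_iff hI hl).1 (Submodule.span_le.2 ?_ h))
    rintro _ ⟨i, rfl⟩
    exact (b' i).2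
  have := (e.isUnit_det (basisOfLinearIndependentOfCardEqFinrank hli
    (by rw [Module.finrank_eq_card_basis e])))
  rw [coe_basisOfLinearIndependentOfCardEqFinrank] at this
  rw [appendLast_succ]
  exact this.ne_zero

end AppendLast

/-! ### The determinant of (df - dg, s) and the intersection signs at the boundary -/

section CrossSign

variable {V₁ V₂ W₁ W₂ : Type*} [AddCommGroup V₁] [Module ℝ V₁] [AddCommGroup V₂] [Module ℝ V₂]
  [AddCommGroup W₁] [Module ℝ W₁] [AddCommGroup W₂] [Module ℝ W₂] {n₁ n₂ m₁ m₂ : ℕ}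

/-- The difference `(v, w) ↦ A v - B w`, together with a functional. -/
noncomputable def diffProd (A : V₁ →ₗ[ℝ] W₁ × W₂) (B : V₂ →ₗ[ℝ] W₁ × W₂) (s : V₁ × V₂ →ₗ[ℝ] ℝ) :
    V₁ × V₂ →ₗ[ℝ] (W₁ × W₂) × ℝ :=
  (A.coprod (-B)).prod s

theorem diffProd_apply (A : V₁ →ₗ[ℝ] W₁ × W₂) (B : V₂ →ₗ[ℝ] W₁ × W₂) (s : V₁ × V₂ →ₗ[ℝ] ℝ)
    (x : V₁ × V₂) : diffProd A B s x = (A x.1 - B x.2, s x) := by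
  simp [diffProd, sub_eq_add_neg]

/-- Intersection signs use the sum of the differentials, the tangent line of the fiber product uses
their difference; each of the `n₂` columns from `B` contributes one sign. -/
theorem det_diff_prodFrame {m : ℕ} (h : m = n₁ + n₂) (c : Basis (Fin m) ℝ (W₁ × W₂))
    (A : V₁ →ₗ[ℝ] W₁ × W₂) (B : V₂ →ₗ[ℝ] W₁ × W₂) (v₁ : Fin n₁ → V₁) (v₂ : Fin n₂ → V₂) :
    c.det (fun i => A (prodFrame v₁ v₂ (Fin.cast h i)).1 - B (prodFrame v₁ v₂ (Fin.cast h i)).2)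
      = (-1) ^ n₂ * c.det (Fin.append (fun i => A (v₁ i)) (fun j => B (v₂ j)) ∘ Fin.cast h) := by
  subst h
  let ε : Fin (n₁ + n₂) → ℝ := Fin.append (fun _ => 1) (fun _ => -1)
  have e : (fun i : Fin (n₁ + n₂) => A (prodFrame v₁ v₂ (Fin.cast rfl i)).1
      - B (prodFrame v₁ v₂ (Fin.cast rfl i)).2)
      = fun i => ε i • Fin.append (fun i => A (v₁ i)) (fun j => B (v₂ j)) i := by
    funext i
    refine Fin.addCases (fun j => ?_) (fun j => ?_) i
    · simp [ε, prodFrame]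
    · simp [ε, prodFrame]
  rw [e, AlternatingMap.map_smul_univ, Fin.prod_univ_add]
  simp [ε]

theorem frameDet_eq_of_zero (h : m₁ + m₂ + 1 = n₁ + n₂) (v₁ : Fin n₁ → V₁) (v₂ : Fin n₂ → V₂)
    (c₁ : Basis (Fin m₁) ℝ W₁) (c₂ : Basis (Fin m₂) ℝ W₂)
    (A : V₁ →ₗ[ℝ] W₁ × W₂) (B : V₂ →ₗ[ℝ] W₁ × W₂) (s : V₁ × V₂ →ₗ[ℝ] ℝ) (j₀ : Fin (m₁ + m₂ + 1))
    (p : Fin (m₁ + m₂) → V₁ × V₂) (hp : ∀ i, prodFrame v₁ v₂ (Fin.cast h (j₀.succAbove i)) = p i)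
    (hs : ∀ i, s (p i) = 0) :
    frameDet h v₁ v₂ c₁ c₂ (diffProd A B s) = (-1) ^ (m₁ + m₂ + (j₀ : ℕ)) *
      s (prodFrame v₁ v₂ (Fin.cast h j₀)) *
      (prodBasis c₁ c₂).det (fun i => A (p i).1 - B (p i).2) := by
  rw [frameDet, snocBasis_det, Finset.sum_eq_single j₀]
  · simp only [diffProd_apply, hp]
  · intro j _ hj
    obtain ⟨i, rfl⟩ := Fin.exists_succAbove_eq hj
    simp only [diffProd_apply, hp, hs]
    simp
  · simp

/-- The functional is nonzero at most on `ν`, which sits in the last column, so the cofactor sign is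
+1 and only the `k` sign changes of `B` remain. -/
theorem frameDet_snoc_right {k : ℕ} (h : m₁ + m₂ + 1 = n₁ + (k + 1)) (h' : m₁ + m₂ = n₁ + k)
    (v₁ : Fin n₁ → V₁) (v₂ : Fin k → V₂) (ν : V₂)
    (c₁ : Basis (Fin m₁) ℝ W₁) (c₂ : Basis (Fin m₂) ℝ W₂)
    (A : V₁ →ₗ[ℝ] W₁ × W₂) (B : V₂ →ₗ[ℝ] W₁ × W₂) (l : V₂ →ₗ[ℝ] ℝ) (hl : ∀ i, l (v₂ i) = 0) :
    frameDet h v₁ (Fin.snoc (α := fun _ => V₂) v₂ ν) c₁ c₂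
        (diffProd A B (l ∘ₗ LinearMap.snd ℝ V₁ V₂))
      = (-1) ^ k * l ν * (prodBasis c₁ c₂).det
        (Fin.append (fun i => A (v₁ i)) (fun j => B (v₂ j)) ∘ Fin.cast h') := by
  rw [frameDet_eq_of_zero h _ _ c₁ c₂ A B _ (Fin.last _) (fun i => prodFrame v₁ v₂ (Fin.cast h' i)),
    det_diff_prodFrame h']
  · have : prodFrame v₁ (Fin.snoc (α := fun _ => V₂) v₂ ν) (Fin.cast h (Fin.last (m₁ + m₂)))
        = (0, ν) := by
      simp only [prodFrame, append_apply, Fin.val_cast, Fin.val_last]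
      rw [dif_neg (by omega)]
      congr 1
      have : (⟨m₁ + m₂ - n₁, by omega⟩ : Fin (k + 1)) = Fin.last k := by
        ext
        simp only [Fin.val_last]
        omega
      rw [this, Fin.snoc_last]
    rw [this, Fin.val_last, ← two_mul, pow_mul]
    simp only [even_two, Even.neg_pow, one_pow, LinearMap.coe_comp, Function.comp_apply,
      LinearMap.snd_apply]
    ring
  · intro i
    simp only [prodFrame, append_apply, Fin.val_cast, Fin.succAbove_last, Fin.val_castSucc]
    by_cases hi : (i : ℕ) < n₁
    · rw [dif_pos hi, dif_pos hi]
    · rw [dif_neg hi, dif_neg hi]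
      congr 1
      have : (⟨i - n₁, by omega⟩ : Fin (k + 1)) = Fin.castSucc ⟨i - n₁, by omega⟩ := rfl
      rw [this, Fin.snoc_castSucc]
  · intro i
    simp only [prodFrame, append_apply]
    split_ifs <;> simp [hl]

/-- Here `ν` is followed by the `n₂` columns of the second factor. The cofactor sign for moving it
past them cancels the `n₂` sign changes of `B`. -/
theorem frameDet_snoc_left {k : ℕ} (h : m₁ + m₂ + 1 = (k + 1) + n₂) (h' : m₁ + m₂ = k + n₂)
    (v₁ : Fin k → V₁) (ν : V₁) (v₂ : Fin n₂ → V₂)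
    (c₁ : Basis (Fin m₁) ℝ W₁) (c₂ : Basis (Fin m₂) ℝ W₂)
    (A : V₁ →ₗ[ℝ] W₁ × W₂) (B : V₂ →ₗ[ℝ] W₁ × W₂) (l : V₁ →ₗ[ℝ] ℝ) (hl : ∀ i, l (v₁ i) = 0) :
    frameDet h (Fin.snoc (α := fun _ => V₁) v₁ ν) v₂ c₁ c₂
        (diffProd A B (l ∘ₗ LinearMap.fst ℝ V₁ V₂))
      = l ν * (prodBasis c₁ c₂).det
        (Fin.append (fun i => A (v₁ i)) (fun j => B (v₂ j)) ∘ Fin.cast h') := by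
  rw [frameDet_eq_of_zero h _ _ c₁ c₂ A B _ ⟨k, by omega⟩
    (fun i => prodFrame v₁ v₂ (Fin.cast h' i)), det_diff_prodFrame h']
  · have : prodFrame (Fin.snoc (α := fun _ => V₁) v₁ ν) v₂ (Fin.cast h ⟨k, by omega⟩)
        = (ν, 0) := by
      simp only [prodFrame, append_apply, Fin.val_cast]
      rw [dif_pos (by omega)]
      congr 1
      exact Fin.snoc_last (α := fun _ => V₁) ν v₁
    rw [this]
    have e : (-1 : ℝ) ^ (m₁ + m₂ + k) * (-1) ^ n₂ = 1 := by
      rw [← pow_add, show m₁ + m₂ + k + n₂ = 2 * (k + n₂) by omega, pow_mul]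
      simp
    simp only [LinearMap.coe_comp, Function.comp_apply, LinearMap.fst_apply]
    linear_combination (l ν * (prodBasis c₁ c₂).det
        (Fin.append (fun i => A (v₁ i)) (fun j => B (v₂ j)) ∘ Fin.cast h')) * e
  · intro i
    simp only [prodFrame, append_apply, Fin.val_cast]
    by_cases hi : (i : ℕ) < k
    · have hv : ((Fin.succAbove (⟨k, by omega⟩ : Fin (m₁ + m₂ + 1)) i : Fin (m₁ + m₂ + 1)) : ℕ)
          = i := by
        rw [Fin.succAbove_of_castSucc_lt _ _ (by simpa [Fin.lt_def] using hi)]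
        simp
      simp only [hv]
      rw [dif_pos (by omega), dif_pos hi]
      congr 1
      exact Fin.snoc_castSucc (α := fun _ => V₁) ν v₁ ⟨i, hi⟩
    · have hv : ((Fin.succAbove (⟨k, by omega⟩ : Fin (m₁ + m₂ + 1)) i : Fin (m₁ + m₂ + 1)) : ℕ)
          = i + 1 := by
        rw [Fin.succAbove_of_le_castSucc _ _ (by simpa [Fin.le_def] using hi)]
        simp
      simp only [hv]
      rw [dif_neg (by omega), dif_neg hi]
      congr 3
      omega
  · intro i
    simp only [prodFrame, append_apply]
    split_ifs <;> simp [hl]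

theorem diffProd_surjective_of_frameDet_ne_zero (h : m₁ + m₂ + 1 = n₁ + n₂)
    (v₁ : Fin n₁ → V₁) (v₂ : Fin n₂ → V₂) (c₁ : Basis (Fin m₁) ℝ W₁) (c₂ : Basis (Fin m₂) ℝ W₂)
    (T : V₁ × V₂ →ₗ[ℝ] (W₁ × W₂) × ℝ) (hT : frameDet h v₁ v₂ c₁ c₂ T ≠ 0) :
    Function.Surjective T := by
  have := ((snocBasis (prodBasis c₁ c₂)).is_basis_iff_det.2 (isUnit_iff_ne_zero.2 hT)).2
  rw [← LinearMap.range_eq_top, eq_top_iff, ← this, Submodule.span_le]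
  rintro _ ⟨j, rfl⟩
  exact ⟨_, rfl⟩

/-- The oriented determinant, as a function of the functional, is evaluation at a vector in the
kernel of the difference map. -/
theorem exists_orientedDet_eq_apply (σ₁ : LinearRelOrientation V₁ W₁ n₁ m₁)
    (σ₂ : LinearRelOrientation V₂ W₂ n₂ m₂) (h : m₁ + m₂ + 1 = n₁ + n₂)
    (v₁ : Fin n₁ → V₁) (v₂ : Fin n₂ → V₂)
    (c₁ : Basis (Fin m₁) ℝ W₁) (c₂ : Basis (Fin m₂) ℝ W₂)
    (A : V₁ →ₗ[ℝ] W₁ × W₂) (B : V₂ →ₗ[ℝ] W₁ × W₂) :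
    ∃ k : V₁ × V₂, A k.1 - B k.2 = 0 ∧
      ∀ s, orientedDet σ₁ σ₂ h v₁ v₂ c₁ c₂ (diffProd A B s) = s k := by
  -- The signed maximal minors of `A - B`, a generalized cross product: expansion along the row of
  -- the functional gives its value at `k₀`.
  let a : Fin (m₁ + m₂ + 1) → ℝ := fun j => (-1) ^ (m₁ + m₂ + (j : ℕ)) *
    (prodBasis c₁ c₂).det (fun i => A (prodFrame v₁ v₂ (Fin.cast h (j.succAbove i))).1
      - B (prodFrame v₁ v₂ (Fin.cast h (j.succAbove i))).2)
  let k₀ : V₁ × V₂ := ∑ j, a j • prodFrame v₁ v₂ (Fin.cast h j)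
  have hk₀ : ∀ s, frameDet h v₁ v₂ c₁ c₂ (diffProd A B s) = s k₀ := fun s => by
    rw [frameDet, snocBasis_det, map_sum]
    refine Finset.sum_congr rfl fun j _ => ?_
    simp only [diffProd_apply, map_smul, smul_eq_mul, a]
    ring
  have hker : A k₀.1 - B k₀.2 = 0 := by
    refine (prodBasis c₁ c₂).ext_elem fun i => ?_
    let D : V₁ × V₂ →ₗ[ℝ] W₁ × W₂ := A.coprod (-B)
    have hD : ∀ x, D x = A x.1 - B x.2 := fun x => by simp [D, sub_eq_add_neg]
    -- If the functional is a coordinate of `A - B` itself, the combined map cannot hit `(0, 1)`, so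
    -- the determinant vanishes; hence every coordinate of `A - B` vanishes at `k₀`.
    have h0 : frameDet h v₁ v₂ c₁ c₂ (diffProd A B ((prodBasis c₁ c₂).coord i ∘ₗ D)) = 0 := by
      by_contra hne
      obtain ⟨x, hx⟩ := diffProd_surjective_of_frameDet_ne_zero h v₁ v₂ c₁ c₂ _ hne (0, 1)
      rw [diffProd_apply, Prod.mk.injEq, LinearMap.comp_apply, hD] at hx
      rw [hx.1, map_zero] at hx
      exact zero_ne_one hx.2
    rw [hk₀, LinearMap.comp_apply, hD] at h0
    simpa using h0
  refine ⟨(signOf (σ₁.Pos v₁ c₁) * signOf (σ₂.Pos v₂ c₂) : ℝ) • k₀, ?_, fun s => ?_⟩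
  · rw [Prod.smul_fst, Prod.smul_snd, map_smul, map_smul, ← smul_sub, hker, smul_zero]
  · rw [orientedDet, hk₀, map_smul, smul_eq_mul]

theorem finrank_prod_eq (h : m₁ + m₂ + 1 = n₁ + n₂) (b₁ : Basis (Fin n₁) ℝ V₁)
    (b₂ : Basis (Fin n₂) ℝ V₂) (c₁ : Basis (Fin m₁) ℝ W₁) (c₂ : Basis (Fin m₂) ℝ W₂) :
    finrank ℝ (V₁ × V₂) = finrank ℝ ((W₁ × W₂) × ℝ) := by
  rw [Module.finrank_eq_card_basis (prodBasis b₁ b₂),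
    Module.finrank_eq_card_basis (snocBasis (prodBasis c₁ c₂)), Fintype.card_fin, Fintype.card_fin, h]

theorem bijective_diffProd_of_orientedDet_ne_zero (σ₁ : LinearRelOrientation V₁ W₁ n₁ m₁)
    (σ₂ : LinearRelOrientation V₂ W₂ n₂ m₂) (h : m₁ + m₂ + 1 = n₁ + n₂)
    (b₁ : Basis (Fin n₁) ℝ V₁) (b₂ : Basis (Fin n₂) ℝ V₂)
    (c₁ : Basis (Fin m₁) ℝ W₁) (c₂ : Basis (Fin m₂) ℝ W₂) {T : V₁ × V₂ →ₗ[ℝ] (W₁ × W₂) × ℝ}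
    (hT : orientedDet σ₁ σ₂ h b₁ b₂ c₁ c₂ T ≠ 0) : Function.Bijective T := by
  have := Module.Finite.of_basis (prodBasis b₁ b₂)
  have := Module.Finite.of_basis (snocBasis (prodBasis c₁ c₂))
  have hs := diffProd_surjective_of_frameDet_ne_zero h b₁ b₂ c₁ c₂ T (right_ne_zero_of_mul hT)
  exact ⟨(LinearMap.injective_iff_surjective_of_finrank_eq_finrank
    (finrank_prod_eq h b₁ b₂ c₁ c₂)).2 hs, hs⟩

theorem orientedDet_ne_zero_of_surjective (σ₁ : LinearRelOrientation V₁ W₁ n₁ m₁)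
    (σ₂ : LinearRelOrientation V₂ W₂ n₂ m₂) (h : m₁ + m₂ + 1 = n₁ + n₂)
    (b₁ : Basis (Fin n₁) ℝ V₁) (b₂ : Basis (Fin n₂) ℝ V₂)
    (c₁ : Basis (Fin m₁) ℝ W₁) (c₂ : Basis (Fin m₂) ℝ W₂) {T : V₁ × V₂ →ₗ[ℝ] (W₁ × W₂) × ℝ}
    (hT : Function.Surjective T) : orientedDet σ₁ σ₂ h b₁ b₂ c₁ c₂ T ≠ 0 := by
  have := Module.Finite.of_basis (prodBasis b₁ b₂)
  have := Module.Finite.of_basis (snocBasis (prodBasis c₁ c₂))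
  have hi := (LinearMap.injective_iff_surjective_of_finrank_eq_finrank
    (finrank_prod_eq h b₁ b₂ c₁ c₂)).2 hT
  let B := ((prodBasis b₁ b₂).reindex (finCongr h.symm)).map (LinearEquiv.ofBijective T ⟨hi, hT⟩)
  have hB : frameDet h b₁ b₂ c₁ c₂ T = (snocBasis (prodBasis c₁ c₂)).det B := by
    rw [frameDet]
    congr 1
    funext j
    simp only [B, Basis.map_apply, Basis.reindex_apply, coe_prodBasis]
    rfl
  refine mul_ne_zero (mul_ne_zero ?_ ?_) (hB ▸ (Basis.isUnit_det _ B).ne_zero)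
  · exact left_ne_zero_of_mul_eq_one (signOf_mul_self _)
  · exact left_ne_zero_of_mul_eq_one (signOf_mul_self _)

/-- Both functionals are positive on the same vector `k`, which spans the kernel of the difference
map. After subtracting `t k / s k` times `s`, `t` vanishes on that kernel and factors through the
difference. -/
theorem exists_eq_smul_add_of_orientedDet_pos (σ₁ : LinearRelOrientation V₁ W₁ n₁ m₁)
    (σ₂ : LinearRelOrientation V₂ W₂ n₂ m₂) (h : m₁ + m₂ + 1 = n₁ + n₂)
    (b₁ : Basis (Fin n₁) ℝ V₁) (b₂ : Basis (Fin n₂) ℝ V₂)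
    (c₁ : Basis (Fin m₁) ℝ W₁) (c₂ : Basis (Fin m₂) ℝ W₂)
    {A : V₁ →ₗ[ℝ] W₁ × W₂} {B : V₂ →ₗ[ℝ] W₁ × W₂} {s t : V₁ × V₂ →ₗ[ℝ] ℝ}
    (hs : 0 < orientedDet σ₁ σ₂ h b₁ b₂ c₁ c₂ (diffProd A B s))
    (ht : 0 < orientedDet σ₁ σ₂ h b₁ b₂ c₁ c₂ (diffProd A B t)) :
    ∃ c : ℝ, 0 < c ∧ ∃ q : W₁ × W₂ →ₗ[ℝ] ℝ, ∀ x, t x = c * s x + q (A x.1 - B x.2) := by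
  have hbij := bijective_diffProd_of_orientedDet_ne_zero σ₁ σ₂ h b₁ b₂ c₁ c₂ hs.ne'
  obtain ⟨k, hk, hdet⟩ := exists_orientedDet_eq_apply σ₁ σ₂ h b₁ b₂ c₁ c₂ A B
  rw [hdet] at hs ht
  let e := LinearEquiv.ofBijective _ hbij
  have he : ∀ x, e x = (A x.1 - B x.2, s x) := fun x => diffProd_apply A B s x
  let q : W₁ × W₂ →ₗ[ℝ] ℝ := t ∘ₗ e.symm.toLinearMap ∘ₗ LinearMap.inl ℝ (W₁ × W₂) ℝ
  refine ⟨t k / s k, div_pos ht hs, q, fun x => ?_⟩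
  have hx : e.symm (A x.1 - B x.2, 0) = x - (s x / s k) • k := by
    rw [LinearEquiv.symm_apply_eq, map_sub, map_smul, he, he, hk]
    ext <;> simp [hs.ne']
  have : q (A x.1 - B x.2) = t (e.symm (A x.1 - B x.2, 0)) := rfl
  rw [this, hx, map_sub, map_smul, smul_eq_mul]
  field_simp
  ring

theorem signOf_neg_one_pow_mul (n : ℕ) {x : ℝ} (hx : x ≠ 0) :
    signOf (0 < (-1) ^ n * x) = (-1) ^ n * signOf (0 < x) := by
  unfold signOf
  rcases Nat.even_or_odd n with h | h
  · simp [h.neg_one_pow]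
  · rcases hx.lt_or_gt with hx | hx <;> simp [h.neg_one_pow, hx, hx.not_gt]

theorem crossSign_boundary_right {E : Type*} [NormedAddCommGroup E] [NormedSpace ℝ E]
    [FiniteDimensional ℝ E] {H : Type*} [TopologicalSpace H]
    {I : ModelWithCorners ℝ E H} {l : E →L[ℝ] ℝ} (hI : range I = {x | 0 ≤ l x}) (hl : l ≠ 0)
    (σ₁ : LinearRelOrientation V₁ W₁ n₁ m₁) (σ₂ : LinearRelOrientation E W₂ n₂ m₂)
    (h : m₁ + m₂ + 1 = n₁ + n₂) (e₁ : Basis (Fin n₁) ℝ V₁) (e₂ : Basis (Fin n₂) ℝ E)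
    (c₁ : Basis (Fin m₁) ℝ W₁) (c₂ : Basis (Fin m₂) ℝ W₂)
    (A : V₁ →ₗ[ℝ] W₁ × W₂) (B : E →ₗ[ℝ] W₁ × W₂)
    (hne : orientedDet σ₁ σ₂ h e₁ e₂ c₁ c₂
      (diffProd A B ((l : E →ₗ[ℝ] ℝ) ∘ₗ LinearMap.snd ℝ V₁ E)) ≠ 0) :
    crossSign σ₁.Pos (σ₂.BoundaryPos I) A (B.domRestrict (boundaryTangent I))
      = (-1) ^ n₂ * signOf (0 < orientedDet σ₁ σ₂ h e₁ e₂ c₁ c₂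
        (diffProd A B ((l : E →ₗ[ℝ] ℝ) ∘ₗ LinearMap.snd ℝ V₁ E))) := by
  set T := diffProd A B ((l : E →ₗ[ℝ] ℝ) ∘ₗ LinearMap.snd ℝ V₁ E)
  obtain ⟨ν, hν⟩ := exists_apply_neg hl
  -- The condition inside the existential of `crossSign` has the same truth value for all bases. The
  -- sign is (-1)^(n₂ - 1) from `frameDet_snoc_right`, with one more from `l ν < 0`.
  have key : ∀ (b₁ : Basis (Fin n₁) ℝ V₁) (b₂ : Basis (Fin (n₂ - 1)) ℝ (boundaryTangent I))
      (c₁' : Basis (Fin m₁) ℝ W₁) (c₂' : Basis (Fin m₂) ℝ W₂) (h' : m₁ + m₂ = n₁ + (n₂ - 1)),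
      (0 < (signOf (σ₁.Pos b₁ c₁') * signOf (σ₂.BoundaryPos I b₂ c₂') : ℝ) *
        (prodBasis c₁' c₂').det (Fin.append (fun i => A (b₁ i))
          (fun j => B.domRestrict (boundaryTangent I) (b₂ j)) ∘ Fin.cast h')) ↔
      0 < (-1) ^ n₂ * orientedDet σ₁ σ₂ h e₁ e₂ c₁ c₂ T := by
    intro b₁ b₂ c₁' c₂' h'
    obtain ⟨r, hr, hdet⟩ := orientedDet_change σ₁ σ₂ h e₁ e₂ c₁ c₁' c₂ c₂'
      (v₁ := b₁) (e₁.isUnit_det b₁).ne_zero (det_appendLast_ne_zero hI hl e₂ b₂ hν.ne)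
    have hd := hdet T
    obtain ⟨k, rfl⟩ := pos_of_basis_of_ne_zero hl e₂
    rw [signOf_congr (σ₂.boundaryPos_iff hI hl e₂ b₂ hν c₂')]
    have hf : frameDet h b₁ (appendLast (fun i => (b₂ i : E)) ν) c₁' c₂' T = (-1) ^ k * l ν *
        (prodBasis c₁' c₂').det (Fin.append (fun i => A (b₁ i))
          (fun j => B.domRestrict (boundaryTangent I) (b₂ j)) ∘ Fin.cast h') := by
      rw [appendLast_succ]
      exact frameDet_snoc_right h h' b₁ (fun i => (b₂ i : E)) ν c₁' c₂' A B l
        (fun i => (mem_boundaryTangent_iff hI hl).1 (b₂ i).2)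
    rw [orientedDet, hf] at hd
    have hsq : ((-1 : ℝ) ^ k) * (-1) ^ k = 1 := by
      rw [← mul_pow]
      simp
    have hQ : ∀ s₁ s₂ d D : ℝ, s₁ * s₂ * ((-1) ^ k * l ν * d) = r * D →
        s₁ * s₂ * d = r / (-l ν) * ((-1) ^ (k + 1) * D) := by
      intro s₁ s₂ d D hh
      have hν' : l ν ≠ 0 := hν.ne
      have e : (-1 : ℝ) ^ k * (r * D) = s₁ * s₂ * (l ν * d) := by
        rw [← hh]
        linear_combination (s₁ * s₂ * l ν * d) * hsq
      rw [pow_succ]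
      field_simp
      linear_combination -e
    rw [hQ _ _ _ _ hd]
    exact mul_pos_iff_of_pos_left (div_pos hr (neg_pos.2 hν))
  rw [crossSign, ← signOf_neg_one_pow_mul n₂ hne]
  refine signOf_congr ⟨fun ⟨b₁, b₂, c₁', c₂', h', hp⟩ => (key b₁ b₂ c₁' c₂' h').1 hp, fun hp => ?_⟩
  have hfin : finrank ℝ (boundaryTangent I) = n₂ - 1 := by
    have := finrank_boundaryTangent hI hl
    rw [Module.finrank_eq_card_basis e₂, Fintype.card_fin] at this
    omega
  have hn := pos_of_basis_of_ne_zero hl e₂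
  have h' : m₁ + m₂ = n₁ + (n₂ - 1) := by
    obtain ⟨k, rfl⟩ := hn
    omega
  exact ⟨e₁, finBasisOfFinrankEq ℝ _ hfin, c₁, c₂, h', (key _ _ _ _ h').2 hp⟩

theorem crossSign_boundary_left {E : Type*} [NormedAddCommGroup E] [NormedSpace ℝ E]
    [FiniteDimensional ℝ E] {H : Type*} [TopologicalSpace H]
    {I : ModelWithCorners ℝ E H} {l : E →L[ℝ] ℝ} (hI : range I = {x | 0 ≤ l x}) (hl : l ≠ 0)
    (σ₁ : LinearRelOrientation E W₁ n₁ m₁) (σ₂ : LinearRelOrientation V₂ W₂ n₂ m₂)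
    (h : m₁ + m₂ + 1 = n₁ + n₂) (e₁ : Basis (Fin n₁) ℝ E) (e₂ : Basis (Fin n₂) ℝ V₂)
    (c₁ : Basis (Fin m₁) ℝ W₁) (c₂ : Basis (Fin m₂) ℝ W₂)
    (A : E →ₗ[ℝ] W₁ × W₂) (B : V₂ →ₗ[ℝ] W₁ × W₂)
    (hne : orientedDet σ₁ σ₂ h e₁ e₂ c₁ c₂
      (diffProd A B ((l : E →ₗ[ℝ] ℝ) ∘ₗ LinearMap.fst ℝ E V₂)) ≠ 0) :
    crossSign (σ₁.BoundaryPos I) σ₂.Pos (A.domRestrict (boundaryTangent I)) B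
      = -signOf (0 < orientedDet σ₁ σ₂ h e₁ e₂ c₁ c₂
        (diffProd A B ((l : E →ₗ[ℝ] ℝ) ∘ₗ LinearMap.fst ℝ E V₂))) := by
  set T := diffProd A B ((l : E →ₗ[ℝ] ℝ) ∘ₗ LinearMap.fst ℝ E V₂)
  obtain ⟨ν, hν⟩ := exists_apply_neg hl
  -- The only sign left is that of `l ν < 0`; it is written `(-1) ^ 1` so that
  -- `signOf_neg_one_pow_mul` applies.
  have key : ∀ (b₁ : Basis (Fin (n₁ - 1)) ℝ (boundaryTangent I)) (b₂ : Basis (Fin n₂) ℝ V₂)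
      (c₁' : Basis (Fin m₁) ℝ W₁) (c₂' : Basis (Fin m₂) ℝ W₂) (h' : m₁ + m₂ = n₁ - 1 + n₂),
      (0 < (signOf (σ₁.BoundaryPos I b₁ c₁') * signOf (σ₂.Pos b₂ c₂') : ℝ) *
        (prodBasis c₁' c₂').det (Fin.append (fun i => A.domRestrict (boundaryTangent I) (b₁ i))
          (fun j => B (b₂ j)) ∘ Fin.cast h')) ↔
      0 < (-1) ^ 1 * orientedDet σ₁ σ₂ h e₁ e₂ c₁ c₂ T := by
    intro b₁ b₂ c₁' c₂' h'
    obtain ⟨r, hr, hdet⟩ := orientedDet_change σ₁ σ₂ h e₁ e₂ c₁ c₁' c₂ c₂'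
      (v₂ := b₂) (det_appendLast_ne_zero hI hl e₁ b₁ hν.ne) (e₂.isUnit_det b₂).ne_zero
    have hd := hdet T
    obtain ⟨k, rfl⟩ := pos_of_basis_of_ne_zero hl e₁
    rw [signOf_congr (σ₁.boundaryPos_iff hI hl e₁ b₁ hν c₁')]
    have hf : frameDet h (appendLast (fun i => (b₁ i : E)) ν) b₂ c₁' c₂' T = l ν *
        (prodBasis c₁' c₂').det (Fin.append (fun i => A.domRestrict (boundaryTangent I) (b₁ i))
          (fun j => B (b₂ j)) ∘ Fin.cast h') := by
      rw [appendLast_succ]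
      exact frameDet_snoc_left h h' (fun i => (b₁ i : E)) ν b₂ c₁' c₂' A B l
        (fun i => (mem_boundaryTangent_iff hI hl).1 (b₁ i).2)
    rw [orientedDet, hf] at hd
    have hQ : ∀ s₁ s₂ d D : ℝ, s₁ * s₂ * (l ν * d) = r * D →
        s₁ * s₂ * d = r / (-l ν) * ((-1) ^ 1 * D) := by
      intro s₁ s₂ d D hh
      have hν' : l ν ≠ 0 := hν.ne
      field_simp
      linear_combination hh
    rw [hQ _ _ _ _ hd]
    exact mul_pos_iff_of_pos_left (div_pos hr (neg_pos.2 hν))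
  have e := signOf_neg_one_pow_mul 1 hne
  rw [pow_one (-1 : ℤ), neg_one_mul] at e
  rw [crossSign, ← e]
  refine signOf_congr ⟨fun ⟨b₁, b₂, c₁', c₂', h', hp⟩ => (key b₁ b₂ c₁' c₂' h').1 hp, fun hp => ?_⟩
  have hfin : finrank ℝ (boundaryTangent I) = n₁ - 1 := by
    have := finrank_boundaryTangent hI hl
    rw [Module.finrank_eq_card_basis e₁, Fintype.card_fin] at this
    omega
  have hn := pos_of_basis_of_ne_zero hl e₁
  have h' : m₁ + m₂ = n₁ - 1 + n₂ := by
    obtain ⟨k, rfl⟩ := hn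
    omega
  exact ⟨finBasisOfFinrankEq ℝ _ hfin, e₂, c₁, c₂, h', (key _ _ _ _ h').2 hp⟩

end CrossSign

/-! ### Level sets of functions with surjective derivative -/

section LevelSet

variable {V W : Type*} [NormedAddCommGroup V] [NormedSpace ℝ V] [FiniteDimensional ℝ V]
  [NormedAddCommGroup W] [NormedSpace ℝ W]

/-- Two functions whose derivatives are positively proportional on the kernel of the derivative of
`F` increase in the same direction along the level set of `F`. -/
theorem eventually_lt_iff_lt_of_level {F : V → W} {D : V →L[ℝ] W} {r₁ r₂ : V → ℝ}
    {r₁' r₂' : V →L[ℝ] ℝ} {K : Set V} {x₀ : V} (hF : HasFDerivWithinAt F D K x₀)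
    (h₁ : HasFDerivWithinAt r₁ r₁' K x₀) (h₂ : HasFDerivWithinAt r₂ r₂' K x₀)
    (hinj : Function.Injective (D.prod r₁')) {c : ℝ} (hc : 0 < c) {q : W →L[ℝ] ℝ}
    (hq : r₂' = c • r₁' + q ∘L D) :
    ∀ᶠ y in 𝓝[K] x₀, F y = F x₀ →
      ((r₁ y < r₁ x₀ ↔ r₂ y < r₂ x₀) ∧ (r₁ x₀ < r₁ y ↔ r₂ x₀ < r₂ y)) := by
  have hΦ : HasFDerivWithinAt (fun y => (F y, r₁ y)) (D.prod r₁') K x₀ := hF.prodMk h₁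
  have hind : Topology.IsInducing (D.prod r₁') :=
    (LinearMap.isClosedEmbedding_of_injective (f := (D.prod r₁' : V →ₗ[ℝ] W × ℝ))
      (LinearMap.ker_eq_bot.2 hinj)).isInducing
  have hΘ := hΦ.isTheta_sub hind
  -- The remainder is o(y - x₀), and `(F, r₁)` is bounded below linearly by injectivity of its
  -- derivative. On the level set of `F` the remainder is thus small against |r₁ y - r₁ x₀|; the
  -- bound with constant `c / 2` makes both increments have the same sign.
  have hd : HasFDerivWithinAt (fun y => r₂ y - (c * r₁ y + q (F y))) (0 : V →L[ℝ] ℝ) K x₀ := by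
    have := h₂.sub ((h₁.const_mul c).add (q.hasFDerivAt.comp_hasFDerivWithinAt x₀ hF))
    rwa [hq, sub_self] at this
  have ho := hd.isLittleO
  simp only [zero_apply, sub_zero] at ho
  have hb := (ho.trans_isBigO hΘ.2).bound (half_pos hc)
  filter_upwards [hb] with y hy hFy
  rw [hFy] at hy
  have e : ‖((F x₀, r₁ y) : W × ℝ) - (F x₀, r₁ x₀)‖ = |r₁ y - r₁ x₀| := by
    simp [Prod.norm_def]
  rw [e, Real.norm_eq_abs] at hy
  have e2 : r₂ y - (c * r₁ y + q (F x₀)) - (r₂ x₀ - (c * r₁ x₀ + q (F x₀)))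
      = (r₂ y - r₂ x₀) - c * (r₁ y - r₁ x₀) := by ring
  rw [e2] at hy
  have key : ∀ a b : ℝ, |b - c * a| ≤ c / 2 * |a| → ((a < 0 ↔ b < 0) ∧ (0 < a ↔ 0 < b)) := by
    intro a b hab
    rw [abs_le] at hab
    rcases lt_trichotomy a 0 with ha | ha | ha
    · rw [abs_of_neg ha] at hab
      have : b < 0 := by nlinarith
      exact ⟨⟨fun _ => this, fun _ => ha⟩,
        ⟨fun h => absurd h ha.not_gt, fun h => absurd h this.not_gt⟩⟩
    · subst ha
      simp only [mul_zero, sub_zero, abs_zero, neg_zero] at hab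
      have : b = 0 := le_antisymm hab.2 hab.1
      simp [this]
    · rw [abs_of_pos ha] at hab
      have : 0 < b := by nlinarith
      exact ⟨⟨fun h => absurd h ha.not_gt, fun h => absurd h this.not_gt⟩,
        ⟨fun _ => this, fun _ => ha⟩⟩
  simpa only [sub_neg, sub_pos] using key _ _ hy

/-- Near `x₀` in `K`, the map `(F, s)` agrees with a homeomorphism whose second component is `s`. -/
theorem exists_homeomorph_eventuallyEq [FiniteDimensional ℝ W] {F : V → W} {D : V →L[ℝ] W} {s : V →L[ℝ] ℝ}
    {K : Set V} {x₀ : V} (hK : Convex ℝ K) (hx₀ : x₀ ∈ K) (hu : UniqueDiffWithinAt ℝ K x₀)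
    (hF : ContDiffWithinAt ℝ 1 F K x₀) (hD : HasFDerivWithinAt F D K x₀)
    (hbij : Function.Bijective (D.prod s)) :
    ∃ Ψ : V ≃ₜ W × ℝ, (∀ x, (Ψ x).2 = s x) ∧ ∀ᶠ x in 𝓝[K] x₀, Ψ x = (F x, s x) := by
  let e : V ≃L[ℝ] W × ℝ :=
    (LinearEquiv.ofBijective (D.prod s : V →ₗ[ℝ] W × ℝ) hbij).toContinuousLinearEquiv
  have he : ∀ x, e x = (D x, s x) := fun x => rfl
  set C := lipschitzExtensionConstant W
  have hC : 0 < C := lipschitzExtensionConstant_pos W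
  -- Extending a `c`-Lipschitz map to the whole space costs the factor `C`, so `c` is chosen to keep
  -- `C * c` below the threshold for a perturbation of `e` to remain a homeomorphism.
  obtain ⟨c, hc, hcN⟩ : ∃ c : ℝ≥0, 0 < c ∧
      (Subsingleton V ∨ C * c < ‖(e.symm : W × ℝ →L[ℝ] V)‖₊⁻¹) := by
    rcases e.subsingleton_or_nnnorm_symm_pos with h | h
    · exact ⟨1, one_pos, Or.inl h⟩
    · refine ⟨‖(e.symm : W × ℝ →L[ℝ] V)‖₊⁻¹ / 2 / C, by positivity, Or.inr ?_⟩
      rw [mul_div_cancel₀ _ hC.ne']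
      exact NNReal.half_lt_self (inv_pos.2 h).ne'
  obtain ⟨u, hu_mem, -, -, f', hf', hf'c⟩ :=
    (contDiffWithinAt_succ_iff_hasFDerivWithinAt' (n := 0) (by simp)).1 (by simpa using hF)
  rw [insert_eq_of_mem hx₀] at hu_mem
  have hfD : f' x₀ = D := hu.eq (hf' x₀ (mem_of_mem_nhdsWithin hx₀ hu_mem)) hD
  have hclose : ∀ᶠ x in 𝓝[K] x₀, ‖f' x - D‖ ≤ c := by
    have := hf'c.continuousWithinAt
    rw [ContinuousWithinAt, hfD] at this
    filter_upwards [this (Metric.closedBall_mem_nhds D (ε := c) hc)] with x hx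
    simpa [dist_eq_norm] using hx
  obtain ⟨ε, hε, hball⟩ := Metric.mem_nhdsWithin_iff.1 (inter_mem hu_mem hclose)
  -- Convexity gives the mean value inequality up to the boundary of `K`. The nonlinear part of `F`
  -- is then extended past `K` merely as a Lipschitz map, while the component `s` is left untouched.
  have hconv : Convex ℝ (Metric.ball x₀ ε ∩ K) := (convex_ball x₀ ε).inter hK
  have hlip : LipschitzOnWith c (fun x => F x - D x) (Metric.ball x₀ ε ∩ K) := by
    refine LipschitzOnWith.of_dist_le_mul fun x hx y hy => ?_
    have := hconv.norm_image_sub_le_of_norm_hasFDerivWithin_le' (f := F) (f' := f') (φ := D) (C := c)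
      (fun z hz => (hf' z (hball hz).1).mono inter_subset_right) (fun z hz => (hball hz).2) hy hx
    rw [dist_eq_norm, dist_eq_norm]
    rwa [show F x - D x - (F y - D y) = F x - F y - D (x - y) by rw [map_sub]; abel]
  obtain ⟨g, hg, hgeq⟩ := hlip.extend_finite_dimension
  have happ : ApproximatesLinearOn (fun x => (D x + g x, s x)) (e : V →L[ℝ] W × ℝ) univ (C * c) := by
    refine ApproximatesLinearOn.approximatesLinearOn_iff_lipschitzOnWith.2 ?_
    rw [lipschitzOnWith_univ]
    refine LipschitzWith.of_dist_le_mul fun x y => ?_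
    have h := hg.dist_le_mul x y
    have e1 : ∀ z, ((fun x => (D x + g x, s x)) - ⇑(e : V →L[ℝ] W × ℝ)) z = (g z, 0) := fun z => by
      simp [he]
    rw [e1, e1]
    simpa [Prod.dist_eq] using h
  refine ⟨happ.toHomeomorph _ hcN, fun x => rfl, ?_⟩
  filter_upwards [Metric.mem_nhdsWithin_iff.2 ⟨ε, hε, subset_rfl⟩] with x hx
  have h := hgeq hx
  change (D x + g x, s x) = (F x, s x)
  rw [← h]
  simp

end LevelSet

/-! ### Behaviour of the oriented determinant under changes of coordinates -/

section CoordinateChange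

variable {V₁ V₂ W₁ W₂ : Type*} [AddCommGroup V₁] [Module ℝ V₁] [AddCommGroup V₂] [Module ℝ V₂]
  [AddCommGroup W₁] [Module ℝ W₁] [AddCommGroup W₂] [Module ℝ W₂] {n₁ n₂ m₁ m₂ : ℕ}

theorem prodBasis_map (c₁ : Basis (Fin m₁) ℝ W₁) (c₂ : Basis (Fin m₂) ℝ W₂) {W₁' W₂' : Type*}
    [AddCommGroup W₁'] [Module ℝ W₁'] [AddCommGroup W₂'] [Module ℝ W₂']
    (S₁ : W₁ ≃ₗ[ℝ] W₁') (S₂ : W₂ ≃ₗ[ℝ] W₂') :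
    prodBasis (c₁.map S₁) (c₂.map S₂) = (prodBasis c₁ c₂).map (S₁.prodCongr S₂) := by
  refine Basis.eq_of_apply_eq fun i => ?_
  rw [Basis.map_apply, coe_prodBasis, coe_prodBasis]
  refine Fin.addCases (fun j => ?_) (fun j => ?_) i <;> simp [prodFrame]

theorem orientedDet_map {σ₁ σ₁' : LinearRelOrientation V₁ W₁ n₁ m₁}
    {σ₂ σ₂' : LinearRelOrientation V₂ W₂ n₂ m₂} (h : m₁ + m₂ + 1 = n₁ + n₂)
    (b₁ : Basis (Fin n₁) ℝ V₁) (b₂ : Basis (Fin n₂) ℝ V₂)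
    (c₁ : Basis (Fin m₁) ℝ W₁) (c₂ : Basis (Fin m₂) ℝ W₂)
    (T₁ : V₁ ≃ₗ[ℝ] V₁) (T₂ : V₂ ≃ₗ[ℝ] V₂) (S₁ : W₁ ≃ₗ[ℝ] W₁) (S₂ : W₂ ≃ₗ[ℝ] W₂)
    (h₁ : ∀ θ, Orientation.map _ S₁ (σ₁.toFun θ) = σ₁'.toFun (Orientation.map _ T₁ θ))
    (h₂ : ∀ θ, Orientation.map _ S₂ (σ₂.toFun θ) = σ₂'.toFun (Orientation.map _ T₂ θ))
    {T T' : V₁ × V₂ →ₗ[ℝ] (W₁ × W₂) × ℝ}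
    (hT : ∀ x : V₁ × V₂, T' (T₁ x.1, T₂ x.2) = ((S₁ (T x).1.1, S₂ (T x).1.2), (T x).2)) :
    orientedDet σ₁' σ₂' h (b₁.map T₁) (b₂.map T₂) (c₁.map S₁) (c₂.map S₂) T'
      = orientedDet σ₁ σ₂ h b₁ b₂ c₁ c₂ T := by
  have e₁ : σ₁'.Pos (b₁.map T₁) (c₁.map S₁) ↔ σ₁.Pos b₁ c₁ :=
    σ₁.pos_map_iff σ₁' b₁ T₁ S₁ h₁ b₁ c₁
  have e₂ : σ₂'.Pos (b₂.map T₂) (c₂.map S₂) ↔ σ₂.Pos b₂ c₂ :=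
    σ₂.pos_map_iff σ₂' b₂ T₂ S₂ h₂ b₂ c₂
  rw [orientedDet, orientedDet, signOf_congr e₁, signOf_congr e₂]
  congr 1
  have hs : snocBasis (prodBasis (c₁.map S₁) (c₂.map S₂))
      = (snocBasis (prodBasis c₁ c₂)).map
        ((S₁.prodCongr S₂).prodCongr (LinearEquiv.refl ℝ ℝ)) := by
    rw [snocBasis, snocBasis, ← prodBasis_map, prodBasis_map c₁ c₂]
    congr 1
  rw [frameDet, frameDet, hs, Basis.det_map]
  congr 1
  funext j
  have hv : ∀ i, prodFrame (b₁.map T₁) (b₂.map T₂) i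
      = (T₁ (prodFrame b₁ b₂ i).1, T₂ (prodFrame b₁ b₂ i).2) := fun i => by
    refine Fin.addCases (fun j => ?_) (fun j => ?_) i <;> simp [prodFrame]
  simp only [Function.comp_apply]
  rw [hv, hT, LinearEquiv.symm_apply_eq]
  rfl

theorem continuousAt_orientedDet {α : Type*} [TopologicalSpace α] {W₁ W₂ : Type*}
    [NormedAddCommGroup W₁] [NormedSpace ℝ W₁] [FiniteDimensional ℝ W₁]
    [NormedAddCommGroup W₂] [NormedSpace ℝ W₂] [FiniteDimensional ℝ W₂]
    (σ₁ : LinearRelOrientation V₁ W₁ n₁ m₁)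
    (σ₂ : LinearRelOrientation V₂ W₂ n₂ m₂) (h : m₁ + m₂ + 1 = n₁ + n₂)
    (v₁ : Fin n₁ → V₁) (v₂ : Fin n₂ → V₂)
    (c₁ : Basis (Fin m₁) ℝ W₁) (c₂ : Basis (Fin m₂) ℝ W₂)
    {A : α → V₁ →ₗ[ℝ] W₁ × W₂} {B : α → V₂ →ₗ[ℝ] W₁ × W₂} {x₀ : α} (s : V₁ × V₂ →ₗ[ℝ] ℝ)
    (hA : ∀ v, ContinuousAt (fun x => A x v) x₀) (hB : ∀ v, ContinuousAt (fun x => B x v) x₀) :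
    ContinuousAt (fun x => orientedDet σ₁ σ₂ h v₁ v₂ c₁ c₂ (diffProd (A x) (B x) s)) x₀ := by
  unfold orientedDet
  refine continuousAt_const.mul ?_
  simp only [frameDet, Basis.det_apply, diffProd_apply]
  have hdet : Continuous fun M : Matrix (Fin (m₁ + m₂ + 1)) (Fin (m₁ + m₂ + 1)) ℝ => M.det :=
    continuous_id.matrix_det
  refine hdet.continuousAt.comp (f := fun x => (snocBasis (prodBasis c₁ c₂)).toMatrix _) ?_
  refine continuousAt_pi.2 fun i => continuousAt_pi.2 fun j => ?_
  simp only [Basis.toMatrix_apply]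
  have hl : Continuous ((snocBasis (prodBasis c₁ c₂)).coord i) :=
    LinearMap.continuous_of_finiteDimensional _
  exact hl.continuousAt.comp (f := fun x => _) (((hA _).sub (hB _)).prodMk continuousAt_const)

end CoordinateChange

/-! ### Differentials and relative orientations read in a fixed chart -/

section TangentCoordinates

variable {E : Type*} [NormedAddCommGroup E] [NormedSpace ℝ E] {H : Type*} [TopologicalSpace H]
  (I : ModelWithCorners ℝ E H) {Z : Type*} [TopologicalSpace Z] [ChartedSpace H Z]
  [IsManifold I ∞ Z]
  {F : Type*} [NormedAddCommGroup F] [NormedSpace ℝ F] {G : Type*} [TopologicalSpace G]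
  (J : ModelWithCorners ℝ F G) {X : Type*} [TopologicalSpace X] [ChartedSpace G X]
  [IsManifold J ∞ X]

/-- The passage from the preferred chart at `u` to that at `u₀`, on the tangent space at `u`. -/
noncomputable def tangentEquiv (u₀ u : Z)
    (hu : u ∈ (trivializationAt E (TangentSpace I) u₀).baseSet) : E ≃L[ℝ] E :=
  (trivializationAt E (TangentSpace I) u₀).continuousLinearEquivAt ℝ u hu

theorem eventually_mem_baseSet (u₀ : Z) :
    ∀ᶠ u in 𝓝 u₀, u ∈ (trivializationAt E (TangentSpace I) u₀).baseSet :=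
  (trivializationAt E (TangentSpace I) u₀).open_baseSet.mem_nhds
    (FiberBundle.mem_baseSet_trivializationAt' u₀)

theorem coe_tangentEquiv {u₀ u : Z}
    (hu : u ∈ (trivializationAt E (TangentSpace I) u₀).baseSet) :
    (tangentEquiv I u₀ u hu : E →L[ℝ] E) = mfderiv I 𝓘(ℝ, E) (extChartAt I u₀) u := by
  have hu' : u ∈ (chartAt H u₀).source := by simpa using hu
  rw [← TangentBundle.continuousLinearMapAt_trivializationAt hu']
  exact (trivializationAt E (TangentSpace I) u₀).coe_continuousLinearEquivAt_eq' (R := ℝ) hu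

theorem tangentEquiv_self (u₀ : Z)
    (hu : u₀ ∈ (trivializationAt E (TangentSpace I) u₀).baseSet) :
    tangentEquiv I u₀ u₀ hu = ContinuousLinearEquiv.refl ℝ E := by
  have : (tangentEquiv I u₀ u₀ hu : E →L[ℝ] E) = ContinuousLinearMap.id ℝ E := by
    rw [coe_tangentEquiv]
    exact mfderiv_extChartAt_self
  ext x
  exact congrArg (fun φ : E →L[ℝ] E => φ x) this

theorem hasFDerivWithinAt_extChartAt_comp_symm {u₀ u : Z}
    (hu : u ∈ (trivializationAt E (TangentSpace I) u₀).baseSet) :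
    HasFDerivWithinAt (extChartAt I u₀ ∘ (extChartAt I u).symm) (tangentEquiv I u₀ u hu : E →L[ℝ] E)
      (range I) (extChartAt I u u) := by
  have hu' : u ∈ (chartAt H u₀).source := by simpa using hu
  rw [coe_tangentEquiv]
  exact (mdifferentiableAt_extChartAt hu').hasMFDerivAt.2

/-- At `u₀` the coordinate changes are the identity, which identifies the locally constant value `τ`
with the class at `u₀`. -/
theorem RelOrientation.eventually_map_eq {f : Z → X} (o : RelOrientation I J f)
    (u₀ : Z) : ∀ᶠ u in 𝓝 u₀, ∀ hu hx θ,
      Orientation.map _ (tangentEquiv J (f u₀) (f u) hx).toLinearEquiv ((o.linear u).toFun θ)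
        = (o.linear u₀).toFun (Orientation.map _ (tangentEquiv I u₀ u hu).toLinearEquiv θ) := by
  obtain ⟨τ, hτ⟩ := o.locallyConstant u₀
  have h0 : ∀ θ, (o.linear u₀).toFun θ = τ θ := fun θ => by
    have hu := FiberBundle.mem_baseSet_trivializationAt' (F := E) (E := TangentSpace I) u₀
    have hx := FiberBundle.mem_baseSet_trivializationAt' (F := F) (E := TangentSpace J) (f u₀)
    have := hτ.self_of_nhds hu hx θ
    change Orientation.map _ (tangentEquiv J (f u₀) (f u₀) hx).toLinearEquiv
      ((o.linear u₀).toFun θ) = τ (Orientation.map _ (tangentEquiv I u₀ u₀ hu).toLinearEquiv θ) at this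
    rw [tangentEquiv_self, tangentEquiv_self,
      show (ContinuousLinearEquiv.refl ℝ F).toLinearEquiv = LinearEquiv.refl ℝ F from rfl,
      show (ContinuousLinearEquiv.refl ℝ E).toLinearEquiv = LinearEquiv.refl ℝ E from rfl,
      Orientation.map_refl, Orientation.map_refl] at this
    exact this
  filter_upwards [hτ] with u hu h1 h2 θ
  rw [h0]
  exact hu h1 h2 θ

theorem inTangentCoordinates_eq_tangentEquiv (f : Z → X) {u₀ u : Z}
    (hu : u ∈ (trivializationAt E (TangentSpace I) u₀).baseSet)
    (hx : f u ∈ (trivializationAt F (TangentSpace J) (f u₀)).baseSet) :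
    inTangentCoordinates I J id f (mfderiv I J f) u₀ u
      = (tangentEquiv J (f u₀) (f u) hx : F →L[ℝ] F) ∘L mfderiv I J f u ∘L
        ((tangentEquiv I u₀ u hu).symm : E →L[ℝ] E) :=
  ContinuousLinearMap.inCoordinates_eq hu hx

theorem continuousAt_inTangentCoordinates {f : Z → X} (hf : ContMDiff I J ∞ f) (u₀ : Z) :
    ContinuousAt (inTangentCoordinates I J id f (mfderiv I J f) u₀) u₀ :=
  ((hf u₀).mfderiv_const (m := 0) (by simp)).continuousAt

end TangentCoordinates

/-! ### Arcs cut out by a coordinate, and their ends -/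

section ArcOfCoordinate

variable {α : Type*} [TopologicalSpace α] {N : Set α} {L R : α → Filter α} {p : α} {r : α → ℝ}
  {γ : ℝ → α} {T U : Set ℝ} {O : Set α} {a b : ℝ}

/-- A coordinate `r` near `p`, with inverse `γ` and values in `T`, cuts out an arc around `p`. -/
theorem isArc_of_coordinate (hO : IsOpen O) (hpO : p ∈ O) (hr : ContinuousOn r O)
    (hγr : ∀ y ∈ O ∩ N, γ (r y) = y ∧ r y ∈ T)
    (hγ : ∀ t ∈ U ∩ T, γ t ∈ O ∩ N ∧ r (γ t) = t) (hγc : ContinuousOn γ (U ∩ T))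
    (hL : ∀ y ∈ O ∩ N, L y = 𝓝[N ∩ {z | r z < r y}] y)
    (hR : ∀ y ∈ O ∩ N, R y = 𝓝[N ∩ {z | r y < r z}] y)
    (hab : a < b) (hUT : Icc a b ⊆ U ∩ T) (hnhds : Icc a b ∈ 𝓝[T] (r p)) :
    IsArc N L R (γ '' Icc a b) a b γ r ∧ γ '' Icc a b ∈ 𝓝[N] p := by
  have hrt : ∀ {y : α}, y ∈ O → Tendsto r (𝓝 y) (𝓝 (r y)) := fun hy =>
    hr.continuousAt (hO.mem_nhds hy)
  have hinC : ∀ y ∈ γ '' Icc a b, r y ∈ Icc a b := by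
    rintro _ ⟨t, ht, rfl⟩
    rwa [(hγ t (hUT ht)).2]
  refine ⟨⟨hab, hγc.mono hUT, rfl, ?_, fun t ht => (hγ t (hUT ht)).2, ?_, ?_, ?_, ?_, ?_⟩, ?_⟩
  · rintro _ ⟨t, ht, rfl⟩
    exact (hγ t (hUT ht)).1.2
  · refine hr.mono ?_
    rintro _ ⟨t, ht, rfl⟩
    exact (hγ t (hUT ht)).1.1
  · intro t ht
    have htI : t ∈ Icc a b := ⟨ht.1.le, ht.2⟩
    have hm := hγ t (hUT htI)
    have hlt : Ioo a t ∈ 𝓝[<] t := Ioo_mem_nhdsLT ht.1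
    rw [hL _ hm.1, hm.2]
    apply le_antisymm
    · intro S hS
      have h1 : Tendsto r (𝓝[N ∩ {z | r z < t}] γ t) (𝓝[<] t) := by
        refine tendsto_nhdsWithin_of_tendsto_nhds_of_eventually_within _ ?_ ?_
        · have := (hrt hm.1.1).mono_left (nhdsWithin_le_nhds (s := N ∩ {z | r z < t}))
          rwa [hm.2] at this
        · filter_upwards [self_mem_nhdsWithin] with z hz using hz.2
      filter_upwards [h1 hS, self_mem_nhdsWithin, nhdsWithin_le_nhds (hO.mem_nhds hm.1.1)]
        with y hy hyN hyO
      have := (hγr y ⟨hyO, hyN.1⟩).1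
      rw [mem_preimage, mem_preimage, this] at hy
      exact hy
    · refine tendsto_nhdsWithin_of_tendsto_nhds_of_eventually_within _ ?_ ?_
      · refine (hγc t (hUT htI)).mono_left (nhdsWithin_le_iff.2 ?_)
        filter_upwards [hlt] with z hz using hUT ⟨hz.1.le, hz.2.le.trans ht.2⟩
      · filter_upwards [hlt] with z hz
        have := hγ z (hUT ⟨hz.1.le, hz.2.le.trans ht.2⟩)
        exact ⟨this.1.2, by simpa [this.2] using hz.2⟩
  · have hm := hγ a (hUT ⟨le_rfl, hab.le⟩)
    rw [hL _ hm.1, hm.2]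
    filter_upwards [self_mem_nhdsWithin] with y hy hyC
    exact absurd (hinC y hyC).1 (not_le.2 hy.2)
  · intro t ht
    have htI : t ∈ Icc a b := ⟨ht.1, ht.2.le⟩
    have hm := hγ t (hUT htI)
    have hlt : Ioo t b ∈ 𝓝[>] t := Ioo_mem_nhdsGT ht.2
    rw [hR _ hm.1, hm.2]
    apply le_antisymm
    · intro S hS
      have h1 : Tendsto r (𝓝[N ∩ {z | t < r z}] γ t) (𝓝[>] t) := by
        refine tendsto_nhdsWithin_of_tendsto_nhds_of_eventually_within _ ?_ ?_
        · have := (hrt hm.1.1).mono_left (nhdsWithin_le_nhds (s := N ∩ {z | t < r z}))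
          rwa [hm.2] at this
        · filter_upwards [self_mem_nhdsWithin] with z hz using hz.2
      filter_upwards [h1 hS, self_mem_nhdsWithin, nhdsWithin_le_nhds (hO.mem_nhds hm.1.1)]
        with y hy hyN hyO
      have := (hγr y ⟨hyO, hyN.1⟩).1
      rw [mem_preimage, mem_preimage, this] at hy
      exact hy
    · refine tendsto_nhdsWithin_of_tendsto_nhds_of_eventually_within _ ?_ ?_
      · refine (hγc t (hUT htI)).mono_left (nhdsWithin_le_iff.2 ?_)
        filter_upwards [hlt] with z hz using hUT ⟨ht.1.trans hz.1.le, hz.2.le⟩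
      · filter_upwards [hlt] with z hz
        have := hγ z (hUT ⟨ht.1.trans hz.1.le, hz.2.le⟩)
        exact ⟨this.1.2, by simpa [this.2] using hz.1⟩
  · have hm := hγ b (hUT ⟨hab.le, le_rfl⟩)
    rw [hR _ hm.1, hm.2]
    filter_upwards [self_mem_nhdsWithin] with y hy hyC
    exact absurd (hinC y hyC).2 (not_le.2 hy.2)
  · have h1 : Tendsto r (𝓝[N] p) (𝓝[T] (r p)) := by
      refine tendsto_nhdsWithin_of_tendsto_nhds_of_eventually_within _
        ((hrt hpO).mono_left nhdsWithin_le_nhds) ?_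
      filter_upwards [self_mem_nhdsWithin, nhdsWithin_le_nhds (hO.mem_nhds hpO)] with y hy hyO
      exact (hγr y ⟨hyO, hy⟩).2
    filter_upwards [h1 hnhds, self_mem_nhdsWithin, nhdsWithin_le_nhds (hO.mem_nhds hpO)]
      with y hy hyN hyO
    exact ⟨r y, hy, (hγr y ⟨hyO, hyN⟩).1⟩

/-- The set of parameters of an arc near an interior, an initial or a final point. -/
inductive IsSide : Set ℝ → ℝ → ℤ → Prop
  | inside (t : ℝ) : IsSide univ t 0
  | initial (t : ℝ) : IsSide (Ici t) t (-1)
  | final (t : ℝ) : IsSide (Iic t) t 1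

theorem IsSide.exists_Icc {t : ℝ} {ε : ℤ} (h : IsSide T t ε) {U : Set ℝ} (hU : U ∈ 𝓝 t) :
    ∃ a b, a < b ∧ t ∈ Icc a b ∧ Icc a b ⊆ U ∩ T ∧ Icc a b ∈ 𝓝[T] t := by
  obtain ⟨δ, hδ, hsub⟩ := Metric.mem_nhds_iff.1 hU
  have hI : Icc (t - δ / 2) (t + δ / 2) ⊆ U := fun x hx => hsub (by
    rw [Metric.mem_ball, Real.dist_eq, abs_lt]
    constructor <;> linarith [hx.1, hx.2])
  have hδ' : 0 < δ / 2 := half_pos hδ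
  cases h with
  | inside =>
    refine ⟨t - δ / 2, t + δ / 2, by linarith, ⟨by linarith, by linarith⟩, by simpa using hI, ?_⟩
    rw [nhdsWithin_univ]
    exact Icc_mem_nhds (by linarith) (by linarith)
  | initial =>
    refine ⟨t, t + δ / 2, by linarith, ⟨le_rfl, by linarith⟩,
      fun x hx => ⟨hI ⟨by linarith [hx.1], hx.2⟩, hx.1⟩, Icc_mem_nhdsGE (by linarith)⟩
  | final =>
    refine ⟨t - δ / 2, t, by linarith, ⟨by linarith, le_rfl⟩,
      fun x hx => ⟨hI ⟨hx.1, by linarith [hx.2]⟩, hx.2⟩, Icc_mem_nhdsLE (by linarith)⟩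

/-- Along the arc, sides are images of nontrivial filters on the line. At an end the outer side
would lie in the arc, a neighbourhood in N, and also avoid it, so it is `⊥`. -/
theorem IsArc.endSign_eq {C : Set α} (hC : IsArc N L R C a b γ r) {t : ℝ} {ε : ℤ}
    (hT : IsSide T t ε) (ht : t ∈ Icc a b) (hsub : Icc a b ⊆ T) (hnhds : Icc a b ∈ 𝓝[T] t)
    (hCp : C ∈ 𝓝[N] (γ t)) (hL : L (γ t) ≤ 𝓝[N] (γ t)) (hR : R (γ t) ≤ 𝓝[N] (γ t)) :
    endSign L R (γ t) = ε := by
  have hl : a < t → L (γ t) ≠ ⊥ := fun h => by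
    rw [hC.left t ⟨h, ht.2⟩]
    exact NeBot.ne inferInstance
  have hr : t < b → R (γ t) ≠ ⊥ := fun h => by
    rw [hC.right t ⟨ht.1, h⟩]
    exact NeBot.ne inferInstance
  cases hT with
  | inside =>
    rw [nhdsWithin_univ, Icc_mem_nhds_iff] at hnhds
    simp [endSign, hl hnhds.1, hr hnhds.2]
  | initial =>
    have hat : a = t := le_antisymm ht.1 (hsub ⟨le_rfl, hC.lt.le⟩)
    have hbot : L (γ t) = ⊥ := by
      rw [← empty_mem_iff_bot]
      have h1 := hC.left_end
      rw [hat] at h1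
      filter_upwards [h1, hL hCp] with y h1 h2 using h1 h2
    have := hr (hat ▸ hC.lt)
    simp [endSign, hbot, this]
  | final =>
    have hat : t = b := le_antisymm ht.2 (hsub ⟨hC.lt.le, le_rfl⟩)
    have hbot : R (γ t) = ⊥ := by
      rw [← empty_mem_iff_bot]
      have h1 := hC.right_end
      rw [← hat] at h1
      filter_upwards [h1, hR hCp] with y h1 h2 using h1 h2
    have := hl (hat ▸ hC.lt)
    simp [endSign, hbot, this]

end ArcOfCoordinate

/-! ### Compactness of the fiber product -/

section Compactness

variable {Z Υ Y : Type*} [TopologicalSpace Z] [TopologicalSpace Υ] [TopologicalSpace Y]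

/-- The fiber product of `f` and `g`. -/
def fiberProd (f : Z → Y) (g : Υ → Y) : Set (Z × Υ) := {p | f p.1 = g p.2}

/-- An ultrafilter containing a compact set converges; one that contains none contains every
complement `Kᶜ`, so its image limit lies in every closure defining the limit set. -/
theorem exists_le_nhds_or_mem_limitSet (f : Z → Y) (U : Ultrafilter Z) {y : Y}
    (hy : Tendsto f U (𝓝 y)) : (∃ u, (U : Filter Z) ≤ 𝓝 u) ∨ y ∈ limitSet f := by
  by_contra! h
  refine h.2 (mem_iInter₂.2 fun K hK => ?_)
  have hKU : K ∉ U := fun hKU => by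
    obtain ⟨u, -, hu⟩ := hK.ultrafilter_le_nhds U (le_principal_iff.2 hKU)
    exact h.1 u hu
  exact mem_closure_of_tendsto hy
    (Filter.mem_of_superset (Ultrafilter.compl_mem_iff_notMem.2 hKU : Kᶜ ∈ (U : Filter Z))
      fun z hz => mem_image_of_mem f hz)

theorem isCompact_fiberProd [T2Space Y] {f : Z → Y} {g : Υ → Y} (hf : Continuous f)
    (hg : Continuous g) (hK : IsCompact (closure (range f)))
    (h₁ : ∀ y ∈ limitSet f, y ∉ range g) (h₂ : ∀ y ∈ limitSet g, y ∉ range f)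
    (h₃ : ∀ y ∈ limitSet f, y ∉ limitSet g) : IsCompact (fiberProd f g) := by
  rw [isCompact_iff_ultrafilter_le_nhds]
  intro U hU
  have hN : ∀ᶠ p in (U : Filter (Z × Υ)), f p.1 = g p.2 := le_principal_iff.1 hU
  obtain ⟨y, -, hy⟩ := hK.ultrafilter_le_nhds (U.map fun p => f p.1) (le_principal_iff.2
    (Ultrafilter.mem_map.2 (Filter.univ_mem' fun p => subset_closure (mem_range_self p.1))))
  have hyf : Tendsto (fun p : Z × Υ => f p.1) U (𝓝 y) := hy
  have hyg : Tendsto (fun p : Z × Υ => g p.2) U (𝓝 y) := hyf.congr' hN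
  have hf' := exists_le_nhds_or_mem_limitSet f (U.map Prod.fst) (y := y) hyf
  have hg' := exists_le_nhds_or_mem_limitSet g (U.map Prod.snd) (y := y) hyg
  have conv : ∀ u, ((U.map Prod.fst : Ultrafilter Z) : Filter Z) ≤ 𝓝 u → f u = y := fun u hu =>
    tendsto_nhds_unique ((hf.tendsto u).comp (show Tendsto Prod.fst (U : Filter (Z × Υ)) (𝓝 u) from hu)) hyf
  have conv' : ∀ P, ((U.map Prod.snd : Ultrafilter Υ) : Filter Υ) ≤ 𝓝 P → g P = y := fun P hP =>
    tendsto_nhds_unique ((hg.tendsto P).comp (show Tendsto Prod.snd (U : Filter (Z × Υ)) (𝓝 P) from hP)) hyg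
  rcases hf' with ⟨u, hu⟩ | hyf'
  · rcases hg' with ⟨P, hP⟩ | hyg'
    · refine ⟨(u, P), (conv u hu).trans (conv' P hP).symm, ?_⟩
      have : Tendsto id (U : Filter (Z × Υ)) (𝓝 (u, P)) := by
        rw [nhds_prod_eq]
        exact Tendsto.prodMk (f := (U : Filter (Z × Υ))) hu hP
      exact this
    · exact absurd ⟨u, conv u hu⟩ (h₂ y hyg')
  · rcases hg' with ⟨P, hP⟩ | hyg'
    · exact absurd ⟨P, conv' P hP⟩ (h₁ y hyf')
    · exact absurd hyg' (h₃ y hyf')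

end Compactness

theorem finrank_le_of_sup_range_eq_top {V₁ V₂ W : Type*} [AddCommGroup V₁] [Module ℝ V₁]
    [AddCommGroup V₂] [Module ℝ V₂] [AddCommGroup W] [Module ℝ W] [FiniteDimensional ℝ V₁]
    [FiniteDimensional ℝ V₂] {A : V₁ →ₗ[ℝ] W} {B : V₂ →ₗ[ℝ] W} (h : A.range ⊔ B.range = ⊤) :
    finrank ℝ W ≤ finrank ℝ V₁ + finrank ℝ V₂ := by
  rw [← finrank_top ℝ W, ← h]
  exact (Submodule.finrank_add_le_finrank_add_finrank _ _).trans
    (add_le_add A.finrank_range_le B.finrank_range_le)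

/-! ### The fiber product as a zero set in charts -/

section LevelMap

variable {E₁ H₁ E₂ H₂ F G : Type*}
  [NormedAddCommGroup E₁] [NormedSpace ℝ E₁] [TopologicalSpace H₁]
  [NormedAddCommGroup E₂] [NormedSpace ℝ E₂] [TopologicalSpace H₂]
  [NormedAddCommGroup F] [NormedSpace ℝ F] [TopologicalSpace G]
  (I₁ : ModelWithCorners ℝ E₁ H₁) (I₂ : ModelWithCorners ℝ E₂ H₂) (J : ModelWithCorners ℝ F G)
  {Z Υ Y : Type*}
  [TopologicalSpace Z] [ChartedSpace H₁ Z]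
  [TopologicalSpace Υ] [ChartedSpace H₂ Υ]
  [TopologicalSpace Y] [ChartedSpace G Y]

/-- The difference of `f` and `g`, read in charts. -/
noncomputable def levelMap (f : Z → Y) (g : Υ → Y) (p : Z × Υ) (v : E₁ × E₂) : F :=
  extChartAt J (f p.1) (f ((extChartAt I₁ p.1).symm v.1))
    - extChartAt J (g p.2) (g ((extChartAt I₂ p.2).symm v.2))

variable {I₁ I₂ J} {f : Z → Y} {g : Υ → Y}

variable (I₁ I₂ J f g) in
/-- The difference of the differentials of `f` and `g`. -/
noncomputable def levelDeriv (p : Z × Υ) : E₁ × E₂ →L[ℝ] F :=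
  let A : E₁ →L[ℝ] F := mfderiv I₁ J f p.1
  let B : E₂ →L[ℝ] F := mfderiv I₂ J g p.2
  A ∘L ContinuousLinearMap.fst ℝ E₁ E₂ - B ∘L ContinuousLinearMap.snd ℝ E₁ E₂

theorem hasFDerivWithinAt_levelMap (hf : ContMDiff I₁ J ∞ f) (hg : ContMDiff I₂ J ∞ g)
    (p : Z × Υ) :
    HasFDerivWithinAt (levelMap I₁ I₂ J f g p) (levelDeriv I₁ I₂ J f g p)
      (range (I₁.prod I₂)) (extChartAt (I₁.prod I₂) p p) := by
  rw [ModelWithCorners.range_prod]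
  have h₁ : HasFDerivWithinAt (fun v => extChartAt J (f p.1) (f ((extChartAt I₁ p.1).symm v)))
      (mfderiv I₁ J f p.1 : E₁ →L[ℝ] F) (range I₁) (extChartAt I₁ p.1 p.1) :=
    ((hf p.1).mdifferentiableAt (by simp)).hasMFDerivAt.2
  have h₂ : HasFDerivWithinAt (fun v => extChartAt J (g p.2) (g ((extChartAt I₂ p.2).symm v)))
      (mfderiv I₂ J g p.2 : E₂ →L[ℝ] F) (range I₂) (extChartAt I₂ p.2 p.2) :=
    ((hg p.2).mdifferentiableAt (by simp)).hasMFDerivAt.2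
  have h₁' := HasFDerivWithinAt.comp (f := Prod.fst) (s := range I₁ ×ˢ range I₂)
    (extChartAt (I₁.prod I₂) p p) h₁ hasFDerivWithinAt_fst (fun x hx => hx.1)
  have h₂' := HasFDerivWithinAt.comp (f := Prod.snd) (s := range I₁ ×ˢ range I₂)
    (extChartAt (I₁.prod I₂) p p) h₂ hasFDerivWithinAt_snd (fun x hx => hx.2)
  exact h₁'.sub h₂'

theorem contDiffWithinAt_levelMap (hf : ContMDiff I₁ J ∞ f) (hg : ContMDiff I₂ J ∞ g)
    (p : Z × Υ) :
    ContDiffWithinAt ℝ 1 (levelMap I₁ I₂ J f g p)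
      (range (I₁.prod I₂)) (extChartAt (I₁.prod I₂) p p) := by
  rw [ModelWithCorners.range_prod]
  have h₁ : ContDiffWithinAt ℝ 1 (fun v => extChartAt J (f p.1) (f ((extChartAt I₁ p.1).symm v)))
      (range I₁) (extChartAt I₁ p.1 p.1) :=
    (contMDiffAt_iff.1 ((hf p.1).of_le (m := 1) (by simp))).2
  have h₂ : ContDiffWithinAt ℝ 1 (fun v => extChartAt J (g p.2) (g ((extChartAt I₂ p.2).symm v)))
      (range I₂) (extChartAt I₂ p.2 p.2) :=
    (contMDiffAt_iff.1 ((hg p.2).of_le (m := 1) (by simp))).2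
  have h₁' := ContDiffWithinAt.comp (f := Prod.fst) (s := range I₁ ×ˢ range I₂)
    (extChartAt (I₁.prod I₂) p p) h₁ contDiffWithinAt_fst (fun x hx => hx.1)
  have h₂' := ContDiffWithinAt.comp (f := Prod.snd) (s := range I₁ ×ˢ range I₂)
    (extChartAt (I₁.prod I₂) p p) h₂ contDiffWithinAt_snd (fun x hx => hx.2)
  exact h₁'.sub h₂'

theorem eventually_levelMap_eq_zero_iff (hf : Continuous f) (hg : Continuous g) {p : Z × Υ}
    (hp : p ∈ fiberProd f g) :
    ∀ᶠ y in 𝓝 p, levelMap I₁ I₂ J f g p (extChartAt (I₁.prod I₂) p y) = 0 ↔ y ∈ fiberProd f g := by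
  have h1 : ∀ᶠ y in 𝓝 p, y.1 ∈ (extChartAt I₁ p.1).source :=
    continuous_fst.continuousAt.eventually (extChartAt_source_mem_nhds p.1)
  have h2 : ∀ᶠ y in 𝓝 p, y.2 ∈ (extChartAt I₂ p.2).source :=
    continuous_snd.continuousAt.eventually (extChartAt_source_mem_nhds p.2)
  have h3 : ∀ᶠ y in 𝓝 p, f y.1 ∈ (extChartAt J (f p.1)).source :=
    (hf.comp continuous_fst).continuousAt.eventually (extChartAt_source_mem_nhds (f p.1))
  have h4 : ∀ᶠ y in 𝓝 p, g y.2 ∈ (extChartAt J (g p.2)).source :=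
    (hg.comp continuous_snd).continuousAt.eventually (extChartAt_source_mem_nhds (g p.2))
  have hp' : f p.1 = g p.2 := hp
  filter_upwards [h1, h2, h3, h4] with y h1 h2 h3 h4
  have e : levelMap I₁ I₂ J f g p (extChartAt (I₁.prod I₂) p y)
      = extChartAt J (f p.1) (f y.1) - extChartAt J (g p.2) (g y.2) := by
    rw [levelMap, extChartAt_prod]
    simp only [PartialEquiv.prod_coe]
    rw [(extChartAt I₁ p.1).left_inv h1, (extChartAt I₂ p.2).left_inv h2]
  rw [e, sub_eq_zero, ← hp']
  rw [← hp'] at h4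
  exact ⟨fun h => (extChartAt J (f p.1)).injOn h3 h4 h, fun h => congrArg _ h⟩

end LevelMap

theorem differential_prod {Z E H F₁ G₁ F₂ G₂ X M : Type*} [NormedAddCommGroup E] [NormedSpace ℝ E]
    [TopologicalSpace H] {I : ModelWithCorners ℝ E H} [TopologicalSpace Z] [ChartedSpace H Z]
    [NormedAddCommGroup F₁] [NormedSpace ℝ F₁] [TopologicalSpace G₁]
    [NormedAddCommGroup F₂] [NormedSpace ℝ F₂] [TopologicalSpace G₂]
    {J₁ : ModelWithCorners ℝ F₁ G₁} {J₂ : ModelWithCorners ℝ F₂ G₂}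
    [TopologicalSpace X] [ChartedSpace G₁ X] [TopologicalSpace M] [ChartedSpace G₂ M]
    {f : Z → X × M} (hf : ContMDiff I (J₁.prod J₂) ∞ f) (u : Z) (v : E) :
    differential I (J₁.prod J₂) f u v
      = ((mfderiv I J₁ (fun u => (f u).1) u : E →L[ℝ] F₁) v,
        (mfderiv I J₂ (fun u => (f u).2) u : E →L[ℝ] F₂) v) := by
  have h := mfderiv_prodMk (hf.fst.mdifferentiable (by simp) u) (hf.snd.mdifferentiable (by simp) u)
  exact congrArg (fun φ : E →L[ℝ] F₁ × F₂ => φ v) h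

/-- Allows points `f u` and `g P`, equal only propositionally on the fiber product, to be exchanged
despite the dependent membership proofs. -/
theorem tangentEquiv_congr {E H Z : Type*} [NormedAddCommGroup E] [NormedSpace ℝ E]
    [TopologicalSpace H] {I : ModelWithCorners ℝ E H} [TopologicalSpace Z] [ChartedSpace H Z]
    [IsManifold I ∞ Z] {u₀ u u₀' u' : Z} (h₀ : u₀ = u₀') (h : u = u') (hu hu') :
    tangentEquiv I u₀ u hu = tangentEquiv I u₀' u' hu' := by
  subst h₀ h
  rfl

/-! ### Local constancy of the orientation of the fiber product -/

section FiberDet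

variable {E₁ H₁ E₂ H₂ F₁ G₁ F₂ G₂ : Type*}
  [NormedAddCommGroup E₁] [NormedSpace ℝ E₁] [FiniteDimensional ℝ E₁] [TopologicalSpace H₁]
  [NormedAddCommGroup E₂] [NormedSpace ℝ E₂] [FiniteDimensional ℝ E₂] [TopologicalSpace H₂]
  [NormedAddCommGroup F₁] [NormedSpace ℝ F₁] [FiniteDimensional ℝ F₁] [TopologicalSpace G₁]
  [NormedAddCommGroup F₂] [NormedSpace ℝ F₂] [FiniteDimensional ℝ F₂] [TopologicalSpace G₂]
  {I₁ : ModelWithCorners ℝ E₁ H₁} {I₂ : ModelWithCorners ℝ E₂ H₂}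
  {J₁ : ModelWithCorners ℝ F₁ G₁} {J₂ : ModelWithCorners ℝ F₂ G₂}
  {Z Υ X M : Type*}
  [TopologicalSpace Z] [ChartedSpace H₁ Z] [IsManifold I₁ ∞ Z]
  [TopologicalSpace Υ] [ChartedSpace H₂ Υ] [IsManifold I₂ ∞ Υ]
  [TopologicalSpace X] [ChartedSpace G₁ X] [IsManifold J₁ ∞ X]
  [TopologicalSpace M] [ChartedSpace G₂ M] [IsManifold J₂ ∞ M]
  {f : Z → X × M} {g : Υ → X × M}

/-- The oriented determinant of the difference of the differentials of `f` and `g`, completed by a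
functional. -/
noncomputable def fiberDet (o₁ : RelOrientation I₁ J₁ (fun u => (f u).1))
    (o₂ : RelOrientation I₂ J₂ (fun P => (g P).2))
    (h : finrank ℝ F₁ + finrank ℝ F₂ + 1 = finrank ℝ E₁ + finrank ℝ E₂)
    (p : Z × Υ) (s : E₁ × E₂ →L[ℝ] ℝ) : ℝ :=
  orientedDet (o₁.linear p.1) (o₂.linear p.2) h (finBasis ℝ E₁) (finBasis ℝ E₂) (finBasis ℝ F₁)
    (finBasis ℝ F₂) (diffProd (differential I₁ (J₁.prod J₂) f p.1)
      (differential I₂ (J₁.prod J₂) g p.2) s)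

/-- A functional that is positive at `p` is positive at nearby points of the fiber product. -/
theorem eventually_fiberDet_pos (hf : ContMDiff I₁ (J₁.prod J₂) ∞ f)
    (hg : ContMDiff I₂ (J₁.prod J₂) ∞ g)
    (o₁ : RelOrientation I₁ J₁ (fun u => (f u).1)) (o₂ : RelOrientation I₂ J₂ (fun P => (g P).2))
    (h : finrank ℝ F₁ + finrank ℝ F₂ + 1 = finrank ℝ E₁ + finrank ℝ E₂)
    {p : Z × Υ} (hp : p ∈ fiberProd f g) {s : E₁ × E₂ →L[ℝ] ℝ} (hs : 0 < fiberDet o₁ o₂ h p s) :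
    ∀ᶠ x in 𝓝 p, x ∈ fiberProd f g → ∀ h₁ h₂, 0 < fiberDet o₁ o₂ h x
      (s ∘L ((tangentEquiv I₁ p.1 x.1 h₁ : E₁ →L[ℝ] E₁).prodMap
        (tangentEquiv I₂ p.2 x.2 h₂ : E₂ →L[ℝ] E₂))) := by
  let A₁ := inTangentCoordinates I₁ J₁ id (fun u => (f u).1) (mfderiv I₁ J₁ fun u => (f u).1) p.1
  let A₂ := inTangentCoordinates I₁ J₂ id (fun u => (f u).2) (mfderiv I₁ J₂ fun u => (f u).2) p.1
  let B₁ := inTangentCoordinates I₂ J₁ id (fun P => (g P).1) (mfderiv I₂ J₁ fun P => (g P).1) p.2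
  let B₂ := inTangentCoordinates I₂ J₂ id (fun P => (g P).2) (mfderiv I₂ J₂ fun P => (g P).2) p.2
  have cA₁ : ContinuousAt A₁ p.1 := continuousAt_inTangentCoordinates I₁ J₁ hf.fst p.1
  have cA₂ : ContinuousAt A₂ p.1 := continuousAt_inTangentCoordinates I₁ J₂ hf.snd p.1
  have cB₁ : ContinuousAt B₁ p.2 := continuousAt_inTangentCoordinates I₂ J₁ hg.fst p.2
  have cB₂ : ContinuousAt B₂ p.2 := continuousAt_inTangentCoordinates I₂ J₂ hg.snd p.2
  -- The determinant with all differentials moved to the frames at `p`. It is continuous at `p`; on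
  -- the fiber product it is a positive multiple of the `fiberDet` at `x` with `s` transported
  -- there, by invariance under coordinate changes.
  let Q : Z × Υ → ℝ := fun x => orientedDet (o₁.linear p.1) (o₂.linear p.2) h (finBasis ℝ E₁)
    (finBasis ℝ E₂) (finBasis ℝ F₁) (finBasis ℝ F₂)
    (diffProd ((A₁ x.1).prod (A₂ x.1) : E₁ →L[ℝ] F₁ × F₂).toLinearMap
      ((B₁ x.2).prod (B₂ x.2) : E₂ →L[ℝ] F₁ × F₂).toLinearMap s)
  have hQc : ContinuousAt Q p := by
    refine continuousAt_orientedDet _ _ h _ _ _ _ _ (fun v => ?_) (fun v => ?_)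
    · exact ((cA₁.comp continuousAt_fst).clm_apply continuousAt_const).prodMk
        ((cA₂.comp continuousAt_fst).clm_apply continuousAt_const)
    · exact ((cB₁.comp continuousAt_snd).clm_apply continuousAt_const).prodMk
        ((cB₂.comp continuousAt_snd).clm_apply continuousAt_const)
  have key : ∀ᶠ x in 𝓝 p, x ∈ fiberProd f g → ∀ h₁ h₂, ∃ r : ℝ, 0 < r ∧
      r * fiberDet o₁ o₂ h x (s ∘L ((tangentEquiv I₁ p.1 x.1 h₁ : E₁ →L[ℝ] E₁).prodMap
        (tangentEquiv I₂ p.2 x.2 h₂ : E₂ →L[ℝ] E₂))) = Q x := by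
    have e₁ := continuousAt_fst.eventually (o₁.eventually_map_eq I₁ J₁ p.1)
    have e₂ := continuousAt_snd.eventually (o₂.eventually_map_eq I₂ J₂ p.2)
    have e₃ := (hf.fst.continuous.comp continuous_fst).continuousAt.eventually
      (eventually_mem_baseSet J₁ (f p.1).1)
    have e₄ := (hg.snd.continuous.comp continuous_snd).continuousAt.eventually
      (eventually_mem_baseSet J₂ (g p.2).2)
    filter_upwards [e₁, e₂, e₃, e₄] with x e₁ e₂ e₃ e₄ hx h₁ h₂
    have hp₁ : (f p.1).1 = (g p.2).1 := congrArg Prod.fst hp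
    have hp₂ : (f p.1).2 = (g p.2).2 := congrArg Prod.snd hp
    have hx₁ : (f x.1).1 = (g x.2).1 := congrArg Prod.fst hx
    have hx₂ : (f x.1).2 = (g x.2).2 := congrArg Prod.snd hx
    have e₃' : (f x.1).1 ∈ (trivializationAt F₁ (TangentSpace J₁) (f p.1).1).baseSet := e₃
    have e₄' : (g x.2).2 ∈ (trivializationAt F₂ (TangentSpace J₂) (g p.2).2).baseSet := e₄
    have e₅ : (g x.2).1 ∈ (trivializationAt F₁ (TangentSpace J₁) (g p.2).1).baseSet := by
      rw [← hx₁, ← hp₁]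
      exact e₃'
    have e₆ : (f x.1).2 ∈ (trivializationAt F₂ (TangentSpace J₂) (f p.1).2).baseSet := by
      rw [hx₂, hp₂]
      exact e₄'
    let T₁ := tangentEquiv I₁ p.1 x.1 h₁
    let T₂ := tangentEquiv I₂ p.2 x.2 h₂
    let S₁ := tangentEquiv J₁ (f p.1).1 (f x.1).1 e₃'
    let S₂ := tangentEquiv J₂ (g p.2).2 (g x.2).2 e₄'
    have a₁ : ∀ v, A₁ x.1 (T₁ v) = S₁ ((mfderiv I₁ J₁ (fun u => (f u).1) x.1 : E₁ →L[ℝ] F₁) v) := by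
      intro v
      rw [show A₁ x.1 = _ from inTangentCoordinates_eq_tangentEquiv I₁ J₁ (fun u => (f u).1) h₁ e₃']
      exact congrArg (fun w => S₁ ((mfderiv I₁ J₁ (fun u => (f u).1) x.1 : E₁ →L[ℝ] F₁) w))
        (T₁.symm_apply_apply v)
    have a₂ : ∀ v, A₂ x.1 (T₁ v) = S₂ ((mfderiv I₁ J₂ (fun u => (f u).2) x.1 : E₁ →L[ℝ] F₂) v) := by
      intro v
      rw [show A₂ x.1 = _ from inTangentCoordinates_eq_tangentEquiv I₁ J₂ (fun u => (f u).2) h₁ e₆,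
        tangentEquiv_congr hp₂ hx₂ e₆ e₄']
      exact congrArg (fun w => S₂ ((mfderiv I₁ J₂ (fun u => (f u).2) x.1 : E₁ →L[ℝ] F₂) w))
        (T₁.symm_apply_apply v)
    have b₁ : ∀ v, B₁ x.2 (T₂ v) = S₁ ((mfderiv I₂ J₁ (fun P => (g P).1) x.2 : E₂ →L[ℝ] F₁) v) := by
      intro v
      rw [show B₁ x.2 = _ from inTangentCoordinates_eq_tangentEquiv I₂ J₁ (fun P => (g P).1) h₂ e₅,
        tangentEquiv_congr hp₁.symm hx₁.symm e₅ e₃']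
      exact congrArg (fun w => S₁ ((mfderiv I₂ J₁ (fun P => (g P).1) x.2 : E₂ →L[ℝ] F₁) w))
        (T₂.symm_apply_apply v)
    have b₂ : ∀ v, B₂ x.2 (T₂ v) = S₂ ((mfderiv I₂ J₂ (fun P => (g P).2) x.2 : E₂ →L[ℝ] F₂) v) := by
      intro v
      rw [show B₂ x.2 = _ from inTangentCoordinates_eq_tangentEquiv I₂ J₂ (fun P => (g P).2) h₂ e₄']
      exact congrArg (fun w => S₂ ((mfderiv I₂ J₂ (fun P => (g P).2) x.2 : E₂ →L[ℝ] F₂) w))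
        (T₂.symm_apply_apply v)
    have hmap := orientedDet_map (σ₁ := o₁.linear x.1) (σ₁' := o₁.linear p.1)
      (σ₂ := o₂.linear x.2) (σ₂' := o₂.linear p.2) h (finBasis ℝ E₁) (finBasis ℝ E₂) (finBasis ℝ F₁)
      (finBasis ℝ F₂) T₁.toLinearEquiv T₂.toLinearEquiv S₁.toLinearEquiv S₂.toLinearEquiv
      (e₁ h₁ e₃') (e₂ h₂ e₄')
      (T := diffProd (differential I₁ (J₁.prod J₂) f x.1) (differential I₂ (J₁.prod J₂) g x.2)
        (s ∘L ((T₁ : E₁ →L[ℝ] E₁).prodMap (T₂ : E₂ →L[ℝ] E₂))))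
      (T' := diffProd ((A₁ x.1).prod (A₂ x.1) : E₁ →L[ℝ] F₁ × F₂).toLinearMap
        ((B₁ x.2).prod (B₂ x.2) : E₂ →L[ℝ] F₁ × F₂).toLinearMap s) (fun y => by
        rw [diffProd_apply, diffProd_apply, differential_prod hf, differential_prod hg]
        refine Prod.ext (Prod.ext ?_ ?_) rfl
        · exact (congrArg₂ (· - ·) (a₁ y.1) (b₁ y.2)).trans (map_sub S₁ _ _).symm
        · exact (congrArg₂ (· - ·) (a₂ y.1) (b₂ y.2)).trans (map_sub S₂ _ _).symm)
    obtain ⟨r, hr, hrT⟩ := orientedDet_change (o₁.linear p.1) (o₂.linear p.2) h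
      ((finBasis ℝ E₁).map T₁.toLinearEquiv) ((finBasis ℝ E₂).map T₂.toLinearEquiv)
      ((finBasis ℝ F₁).map S₁.toLinearEquiv) ((finBasis ℝ F₂).map S₂.toLinearEquiv)
      (c₁' := finBasis ℝ F₁) (c₂' := finBasis ℝ F₂) (v₁ := finBasis ℝ E₁) (v₂ := finBasis ℝ E₂)
      ((Basis.isUnit_det _ _).ne_zero) ((Basis.isUnit_det _ _).ne_zero)
    refine ⟨r, hr, ?_⟩
    change _ = orientedDet _ _ _ _ _ _ _ _
    rw [hrT, hmap]
    rfl
  have hQp : 0 < Q p := by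
    obtain ⟨r, hr, he⟩ := key.self_of_nhds hp (FiberBundle.mem_baseSet_trivializationAt' p.1)
      (FiberBundle.mem_baseSet_trivializationAt' p.2)
    rw [← he, tangentEquiv_self, tangentEquiv_self]
    exact mul_pos hr hs
  filter_upwards [key, hQc.eventually (lt_mem_nhds hQp)] with x hx hQx hxN h₁ h₂
  obtain ⟨r, hr, he⟩ := hx hxN h₁ h₂
  rw [← he] at hQx
  exact (mul_pos_iff_of_pos_left hr).1 hQx

end FiberDet

/-- The derivative at `x` of a function linear in the chart at `p` is the transported functional of
`eventually_fiberDet_pos`, so that function increases along the orientation at all nearby points of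
N. -/
theorem hasFDerivWithinAt_functional_comp_extChartAt {E₁ H₁ E₂ H₂ Z Υ : Type*}
    [NormedAddCommGroup E₁] [NormedSpace ℝ E₁] [TopologicalSpace H₁]
    [NormedAddCommGroup E₂] [NormedSpace ℝ E₂] [TopologicalSpace H₂]
    {I₁ : ModelWithCorners ℝ E₁ H₁} {I₂ : ModelWithCorners ℝ E₂ H₂}
    [TopologicalSpace Z] [ChartedSpace H₁ Z] [IsManifold I₁ ∞ Z]
    [TopologicalSpace Υ] [ChartedSpace H₂ Υ] [IsManifold I₂ ∞ Υ]
    {p x : Z × Υ} (s : E₁ × E₂ →L[ℝ] ℝ)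
    (h₁ : x.1 ∈ (trivializationAt E₁ (TangentSpace I₁) p.1).baseSet)
    (h₂ : x.2 ∈ (trivializationAt E₂ (TangentSpace I₂) p.2).baseSet) :
    HasFDerivWithinAt ((fun z => s (extChartAt (I₁.prod I₂) p z)) ∘ (extChartAt (I₁.prod I₂) x).symm)
      (s ∘L ((tangentEquiv I₁ p.1 x.1 h₁ : E₁ →L[ℝ] E₁).prodMap
        (tangentEquiv I₂ p.2 x.2 h₂ : E₂ →L[ℝ] E₂)))
      (range (I₁.prod I₂)) (extChartAt (I₁.prod I₂) x x) := by
  rw [ModelWithCorners.range_prod]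
  have a := HasFDerivWithinAt.comp (f := Prod.fst) (s := range I₁ ×ˢ range I₂)
    (extChartAt (I₁.prod I₂) x x) (hasFDerivWithinAt_extChartAt_comp_symm I₁ h₁)
    hasFDerivWithinAt_fst (fun x hx => hx.1)
  have b := HasFDerivWithinAt.comp (f := Prod.snd) (s := range I₁ ×ˢ range I₂)
    (extChartAt (I₁.prod I₂) x x) (hasFDerivWithinAt_extChartAt_comp_symm I₂ h₂)
    hasFDerivWithinAt_snd (fun x hx => hx.2)
  exact s.hasFDerivAt.comp_hasFDerivWithinAt _ (a.prodMk b)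

/-! ### The fiber product is locally an oriented arc -/

section LocalArc

variable {E₁ H₁ E₂ H₂ F₁ G₁ F₂ G₂ : Type*}
  [NormedAddCommGroup E₁] [NormedSpace ℝ E₁] [FiniteDimensional ℝ E₁] [TopologicalSpace H₁]
  [NormedAddCommGroup E₂] [NormedSpace ℝ E₂] [FiniteDimensional ℝ E₂] [TopologicalSpace H₂]
  [NormedAddCommGroup F₁] [NormedSpace ℝ F₁] [FiniteDimensional ℝ F₁] [TopologicalSpace G₁]
  [NormedAddCommGroup F₂] [NormedSpace ℝ F₂] [FiniteDimensional ℝ F₂] [TopologicalSpace G₂]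
  {I₁ : ModelWithCorners ℝ E₁ H₁} {I₂ : ModelWithCorners ℝ E₂ H₂}
  {J₁ : ModelWithCorners ℝ F₁ G₁} {J₂ : ModelWithCorners ℝ F₂ G₂}
  {Z Υ X M : Type*}
  [TopologicalSpace Z] [ChartedSpace H₁ Z] [IsManifold I₁ ∞ Z]
  [TopologicalSpace Υ] [ChartedSpace H₂ Υ] [IsManifold I₂ ∞ Υ]
  [TopologicalSpace X] [ChartedSpace G₁ X] [IsManifold J₁ ∞ X]
  [TopologicalSpace M] [ChartedSpace G₂ M] [IsManifold J₂ ∞ M]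
  {f : Z → X × M} {g : Υ → X × M}
  {o₁ : RelOrientation I₁ J₁ (fun u => (f u).1)} {o₂ : RelOrientation I₂ J₂ (fun P => (g P).2)}
  {h : finrank ℝ F₁ + finrank ℝ F₂ + 1 = finrank ℝ E₁ + finrank ℝ E₂}

theorem bijective_levelDeriv_prod {p : Z × Υ} {s : E₁ × E₂ →L[ℝ] ℝ}
    (hs : fiberDet o₁ o₂ h p s ≠ 0) :
    Function.Bijective ((levelDeriv I₁ I₂ (J₁.prod J₂) f g p).prod s) := by
  have hb := bijective_diffProd_of_orientedDet_ne_zero _ _ h _ _ _ _ hs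
  have e : ⇑((levelDeriv I₁ I₂ (J₁.prod J₂) f g p).prod s)
      = diffProd (differential I₁ (J₁.prod J₂) f p.1) (differential I₂ (J₁.prod J₂) g p.2) s :=
    funext fun v => by rw [diffProd_apply]; rfl
  rwa [e]

/-- Two functions with positive derivatives along the fiber product have the same sides at `p`. -/
theorem nhdsWithin_side_eq (hf : ContMDiff I₁ (J₁.prod J₂) ∞ f)
    (hg : ContMDiff I₂ (J₁.prod J₂) ∞ g) {p : Z × Υ} (hp : p ∈ fiberProd f g)
    {r₁ r₂ : Z × Υ → ℝ} {r₁' r₂' : E₁ × E₂ →L[ℝ] ℝ}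
    (h₁ : HasFDerivWithinAt (r₁ ∘ (extChartAt (I₁.prod I₂) p).symm) r₁' (range (I₁.prod I₂))
      (extChartAt (I₁.prod I₂) p p))
    (h₂ : HasFDerivWithinAt (r₂ ∘ (extChartAt (I₁.prod I₂) p).symm) r₂' (range (I₁.prod I₂))
      (extChartAt (I₁.prod I₂) p p))
    (hr₁ : 0 < fiberDet o₁ o₂ h p r₁') (hr₂ : 0 < fiberDet o₁ o₂ h p r₂') :
    𝓝[fiberProd f g ∩ {z | r₁ z < r₁ p}] p = 𝓝[fiberProd f g ∩ {z | r₂ z < r₂ p}] p ∧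
    𝓝[fiberProd f g ∩ {z | r₁ p < r₁ z}] p = 𝓝[fiberProd f g ∩ {z | r₂ p < r₂ z}] p := by
  obtain ⟨c, hc, q, hq⟩ := exists_eq_smul_add_of_orientedDet_pos _ _ h _ _ _ _ hr₁ hr₂
  have key := eventually_lt_iff_lt_of_level (hasFDerivWithinAt_levelMap hf hg p) h₁ h₂
    (bijective_levelDeriv_prod hr₁.ne').1 hc (q := q.toContinuousLinearMap)
    (ContinuousLinearMap.ext hq)
  have hQ : Tendsto (extChartAt (I₁.prod I₂) p) (𝓝 p)
      (𝓝[range (I₁.prod I₂)] (extChartAt (I₁.prod I₂) p p)) :=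
    tendsto_nhdsWithin_of_tendsto_nhds_of_eventually_within _ (continuousAt_extChartAt p)
      (Filter.univ_mem' fun y => ⟨chartAt (ModelProd H₁ H₂) p y, rfl⟩)
  have hN := eventually_levelMap_eq_zero_iff (I₁ := I₁) (I₂ := I₂) (J := J₁.prod J₂)
    hf.continuous hg.continuous hp
  have hp0 := hN.self_of_nhds.2 hp
  have hall : ∀ᶠ z in 𝓝 p, z ∈ fiberProd f g →
      ((r₁ z < r₁ p ↔ r₂ z < r₂ p) ∧ (r₁ p < r₁ z ↔ r₂ p < r₂ z)) := by
    filter_upwards [hQ.eventually key, hN, extChartAt_source_mem_nhds (I := I₁.prod I₂) p]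
      with z hz hzN hzs hzm
    have := hz ((hzN.2 hzm).trans hp0.symm)
    simpa only [Function.comp_apply, (extChartAt (I₁.prod I₂) p).left_inv hzs,
      extChartAt_to_inv] using this
  constructor
  · refine nhdsWithin_eq_iff_eventuallyEq.2 ?_
    filter_upwards [hall] with z hz
    exact propext (and_congr_right fun hm => (hz hm).1)
  · refine nhdsWithin_eq_iff_eventuallyEq.2 ?_
    filter_upwards [hall] with z hz
    exact propext (and_congr_right fun hm => (hz hm).2)

/-- Near a point where the model is given by one inequality on a transverse functional, the fiber
product is an arc. -/
theorem exists_isArc (hf : ContMDiff I₁ (J₁.prod J₂) ∞ f)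
    (hg : ContMDiff I₂ (J₁.prod J₂) ∞ g) (hK : Convex ℝ (range (I₁.prod I₂)))
    {L R : Z × Υ → Filter (Z × Υ)} {ξ : Z × Υ → E₁ × E₂ →L[ℝ] ℝ}
    (hξ : ∀ x ∈ fiberProd f g, 0 < fiberDet o₁ o₂ h x (ξ x))
    (hL : ∀ x, L x = 𝓝[fiberProd f g ∩ {z | ξ x (extChartAt (I₁.prod I₂) x z)
      < ξ x (extChartAt (I₁.prod I₂) x x)}] x)
    (hR : ∀ x, R x = 𝓝[fiberProd f g ∩ {z | ξ x (extChartAt (I₁.prod I₂) x x)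
      < ξ x (extChartAt (I₁.prod I₂) x z)}] x)
    {p : Z × Υ} (hp : p ∈ fiberProd f g) {s : E₁ × E₂ →L[ℝ] ℝ} (hs : 0 < fiberDet o₁ o₂ h p s)
    {T : Set ℝ} {ε : ℤ} (hT : IsSide T (s (extChartAt (I₁.prod I₂) p p)) ε)
    (hsT : ∀ᶠ v in 𝓝 (extChartAt (I₁.prod I₂) p p), v ∈ range (I₁.prod I₂) ↔ s v ∈ T) :
    (∃ C a b γ r, IsArc (fiberProd f g) L R C a b γ r ∧ C ∈ 𝓝[fiberProd f g] p) ∧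
      endSign L R p = ε := by
  set Q := extChartAt (I₁.prod I₂) p with hQ
  -- Extended charts factor through the model, so their values lie in its range even outside the
  -- chart source.
  have hQK : ∀ y, Q y ∈ range (I₁.prod I₂) := fun y => ⟨chartAt (ModelProd H₁ H₂) p y, rfl⟩
  obtain ⟨Ψ, hΨs, hΨ⟩ := exists_homeomorph_eventuallyEq hK (hQK p)
    ((I₁.prod I₂).uniqueDiffOn _ (hQK p)) (contDiffWithinAt_levelMap hf hg p)
    (hasFDerivWithinAt_levelMap hf hg p) (bijective_levelDeriv_prod hs.ne')
  have hN := eventually_levelMap_eq_zero_iff (I₁ := I₁) (I₂ := I₂) (J := J₁.prod J₂)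
    hf.continuous hg.continuous hp
  -- The functionals `ξ x` are chosen independently at each point; the single function `s ∘ Q`
  -- describes the sides they define at all nearby points of N.
  have hside : ∀ᶠ x in 𝓝 p, x ∈ fiberProd f g →
      L x = 𝓝[fiberProd f g ∩ {z | s (Q z) < s (Q x)}] x ∧
      R x = 𝓝[fiberProd f g ∩ {z | s (Q x) < s (Q z)}] x := by
    filter_upwards [eventually_fiberDet_pos hf hg o₁ o₂ h hp hs,
      continuousAt_fst.eventually (eventually_mem_baseSet I₁ p.1),
      continuousAt_snd.eventually (eventually_mem_baseSet I₂ p.2)] with x hx h₁ h₂ hxN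
    rw [hL, hR]
    refine nhdsWithin_side_eq hf hg hxN (r₁ := fun z => ξ x (extChartAt (I₁.prod I₂) x z))
      (r₂ := fun z => s (Q z)) ?_
      (hasFDerivWithinAt_functional_comp_extChartAt s h₁ h₂) (hξ x hxN) (hx hxN h₁ h₂)
    have := hasFDerivWithinAt_functional_comp_extChartAt (ξ x)
      (FiberBundle.mem_baseSet_trivializationAt' (F := E₁) (E := TangentSpace I₁) x.1)
      (FiberBundle.mem_baseSet_trivializationAt' (F := E₂) (E := TangentSpace I₂) x.2)
    rw [tangentEquiv_self, tangentEquiv_self] at this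
    exact this
  obtain ⟨O', hO', hO'o, hpO'⟩ := eventually_nhds_iff.1 (hN.and hside)
  have hev : ∀ᶠ v in 𝓝 (Q p), (v ∈ range (I₁.prod I₂) →
      Ψ v = (levelMap I₁ I₂ (J₁.prod J₂) f g p v, s v)) ∧ (v ∈ range (I₁.prod I₂) ↔ s v ∈ T) ∧
      (v ∈ range (I₁.prod I₂) → v ∈ Q.target) ∧ Q.symm v ∈ O' := by
    have hsymm : Tendsto Q.symm (𝓝 (Q p)) (𝓝 p) := by
      have := continuousAt_extChartAt_symm (I := I₁.prod I₂) p
      rwa [ContinuousAt, extChartAt_to_inv] at this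
    filter_upwards [eventually_nhdsWithin_iff.1 hΨ, hsT,
      eventually_nhdsWithin_iff.1 (extChartAt_target_mem_nhdsWithin (I := I₁.prod I₂) p),
      hsymm.eventually (hO'o.mem_nhds hpO')] with v a b c d using ⟨a, b, c, d⟩
  obtain ⟨B, hB, hBo, hpB⟩ := eventually_nhds_iff.1 hev
  have hp0 : levelMap I₁ I₂ (J₁.prod J₂) f g p (Q p) = 0 := hN.self_of_nhds.2 hp
  have hΨp : Ψ (Q p) = (0, s (Q p)) := by rw [(hB _ hpB).1 (hQK p), hp0]
  have hΨp' : Ψ.symm (0, s (Q p)) = Q p := by rw [← hΨp, Ψ.symm_apply_apply]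
  -- In the coordinates `Ψ` the fiber product is the line over 0; pulled back to the chart, this
  -- line parametrizes the arc.
  have hline : Continuous fun t : ℝ => Ψ.symm ((0 : F₁ × F₂), t) :=
    Ψ.symm.continuous.comp (continuous_const.prodMk continuous_id)
  have hUo : {t : ℝ | Ψ.symm (0, t) ∈ B} ∈ 𝓝 (s (Q p)) :=
    hline.continuousAt.preimage_mem_nhds (hBo.mem_nhds (by rwa [hΨp']))
  have hOopen : IsOpen (O' ∩ (Q.source ∩ Q ⁻¹' B)) := hO'o.inter
    ((continuousOn_extChartAt p).isOpen_inter_preimage (isOpen_extChartAt_source p) hBo)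
  have hpO : p ∈ O' ∩ (Q.source ∩ Q ⁻¹' B) := ⟨hpO', mem_extChartAt_source p, hpB⟩
  have hγ : ∀ t ∈ {t : ℝ | Ψ.symm (0, t) ∈ B} ∩ T,
      Ψ.symm (0, t) ∈ Q.target ∧ (Q.symm (Ψ.symm (0, t)) ∈ (O' ∩ (Q.source ∩ Q ⁻¹' B)) ∩ fiberProd f g
        ∧ s (Q (Q.symm (Ψ.symm (0, t)))) = t) := by
    rintro t ⟨htB, htT⟩
    have hst : s (Ψ.symm (0, t)) = t := by rw [← hΨs, Ψ.apply_symm_apply]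
    obtain ⟨k1, k2, k3, k4⟩ := hB _ htB
    have hK' := k2.2 (by rwa [hst])
    have hQv := Q.right_inv (k3 hK')
    refine ⟨k3 hK', ⟨⟨k4, Q.map_target (k3 hK'), ?_⟩, ?_⟩, ?_⟩
    · rw [mem_preimage, hQv]
      exact htB
    · rw [← (hO' _ k4).1, hQv]
      have := k1 hK'
      rw [Ψ.apply_symm_apply] at this
      exact (congrArg Prod.fst this).symm
    · rw [hQv, hst]
  obtain ⟨a, b, hab, htab, hsub, hnhds⟩ := hT.exists_Icc hUo
  obtain ⟨harc, hC⟩ := isArc_of_coordinate (N := fiberProd f g) (L := L) (R := R) (p := p)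
    (r := fun z => s (Q z)) (γ := fun t => Q.symm (Ψ.symm (0, t))) hOopen hpO
    (s.continuous.comp_continuousOn ((continuousOn_extChartAt p).mono fun y hy => hy.2.1))
    (fun y hy => by
      obtain ⟨k1, k2, -, -⟩ := hB _ hy.1.2.2
      refine ⟨?_, k2.1 (hQK y)⟩
      have hy0 : levelMap I₁ I₂ (J₁.prod J₂) f g p (Q y) = 0 := (hO' _ hy.1.1).1.2 hy.2
      have := k1 (hQK y)
      rw [hy0] at this
      show Q.symm (Ψ.symm (0, s (Q y))) = y
      rw [← this, Ψ.symm_apply_apply, Q.left_inv hy.1.2.1])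
    (fun t ht => (hγ t ht).2)
    ((continuousOn_extChartAt_symm p).comp hline.continuousOn fun t ht => (hγ t ht).1)
    (fun y hy => ((hO' _ hy.1.1).2 hy.2).1) (fun y hy => ((hO' _ hy.1.1).2 hy.2).2)
    hab hsub hnhds
  refine ⟨⟨_, a, b, _, _, harc, hC⟩, ?_⟩
  have hγp : Q.symm (Ψ.symm (0, s (Q p))) = p := by
    rw [hΨp']
    exact extChartAt_to_inv p
  have := harc.endSign_eq hT htab (fun t ht => (hsub ht).2) hnhds (by simpa only [hγp] using hC)
    (by rw [hL]; exact nhdsWithin_mono _ inter_subset_left)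
    (by rw [hR]; exact nhdsWithin_mono _ inter_subset_left)
  simpa only [hγp] using this

end LocalArc

/-! ### Boundary points of bordered models -/

section BoundaryPoints

variable {E H Z : Type*} [NormedAddCommGroup E] [NormedSpace ℝ E] [TopologicalSpace H]
  {I : ModelWithCorners ℝ E H} [TopologicalSpace Z] [ChartedSpace H Z] {l : E →L[ℝ] ℝ} {u : Z}

theorem IsBorderedModel.convex_range (hI : IsBorderedModel I) : Convex ℝ (range I) := by
  obtain ⟨l, hl⟩ := hI
  rw [hl]
  exact convex_halfSpace_ge l.toLinearMap.isLinear 0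

/-- For `l = 0` the range is the whole space, whose frontier is empty. -/
theorem ne_zero_of_mem_boundary (hI : range I = {x | 0 ≤ l x}) (hu : u ∈ I.boundary Z) : l ≠ 0 := by
  rintro rfl
  have hu' : extChartAt I u u ∈ frontier (range I) := hu
  simp [hI] at hu'

theorem apply_extChartAt_eq_zero (hI : range I = {x | 0 ≤ l x}) (hu : u ∈ I.boundary Z) :
    l (extChartAt I u u) = 0 := by
  have hu' : extChartAt I u u ∈ frontier (range I) := hu
  rw [frontier_range_eq hI (ne_zero_of_mem_boundary hI hu)] at hu'
  exact hu'

theorem range_mem_nhds_of_notMem_boundary (hu : u ∉ I.boundary Z) :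
    range I ∈ 𝓝 (extChartAt I u u) :=
  mem_interior_iff_mem_nhds.1 ((I.isInteriorPoint_or_isBoundaryPoint u).resolve_right hu)

end BoundaryPoints

/-! ### From transversality to surjectivity of (df - dg, s) -/

section Surjectivity

variable {V₁ V₂ W₁ W₂ : Type*} [AddCommGroup V₁] [Module ℝ V₁] [AddCommGroup V₂] [Module ℝ V₂]
  [AddCommGroup W₁] [Module ℝ W₁] [AddCommGroup W₂] [Module ℝ W₂]

/-- First reach the value of `l`, then correct the remaining components by vectors of the boundary
hyperplane, which do not change it. -/
theorem surjective_diffProd_snd {V₁ E H : Type*} [AddCommGroup V₁] [Module ℝ V₁]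
    [NormedAddCommGroup E] [NormedSpace ℝ E] [TopologicalSpace H] {I : ModelWithCorners ℝ E H}
    {l : E →L[ℝ] ℝ} (hI : range I = {x | 0 ≤ l x}) (hl : l ≠ 0)
    {A : V₁ →ₗ[ℝ] W₁ × W₂} {B : E →ₗ[ℝ] W₁ × W₂}
    (h : A.range ⊔ (B.domRestrict (boundaryTangent I)).range = ⊤) :
    Function.Surjective (diffProd A B ((l : E →ₗ[ℝ] ℝ) ∘ₗ LinearMap.snd ℝ V₁ E)) := by
  rintro ⟨w, t⟩
  obtain ⟨e, he⟩ := LinearMap.surjective (f := (l : E →ₗ[ℝ] ℝ))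
    (fun h0 => hl (ContinuousLinearMap.coe_injective h0)) t
  have hw : w + B e ∈ A.range ⊔ (B.domRestrict (boundaryTangent I)).range := h ▸ Submodule.mem_top
  obtain ⟨_, ⟨x, rfl⟩, _, ⟨y, rfl⟩, hxy⟩ := Submodule.mem_sup.1 hw
  have hy : l y = 0 := (mem_boundaryTangent_iff hI hl).1 y.2
  refine ⟨(x, e - y), ?_⟩
  rw [diffProd_apply]
  refine Prod.ext ?_ ?_
  · have hxy' : A x + B y = w + B e := hxy
    simp only [map_sub]
    rw [eq_sub_of_add_eq hxy']
    abel
  · have he' : l e = t := he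
    simp [he', hy]

theorem surjective_diffProd_fst {V₂ E H : Type*} [AddCommGroup V₂] [Module ℝ V₂]
    [NormedAddCommGroup E] [NormedSpace ℝ E] [TopologicalSpace H] {I : ModelWithCorners ℝ E H}
    {l : E →L[ℝ] ℝ} (hI : range I = {x | 0 ≤ l x}) (hl : l ≠ 0)
    {A : E →ₗ[ℝ] W₁ × W₂} {B : V₂ →ₗ[ℝ] W₁ × W₂}
    (h : B.range ⊔ (A.domRestrict (boundaryTangent I)).range = ⊤) :
    Function.Surjective (diffProd A B ((l : E →ₗ[ℝ] ℝ) ∘ₗ LinearMap.fst ℝ E V₂)) := by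
  rintro ⟨w, t⟩
  obtain ⟨⟨x, y⟩, hxy⟩ := surjective_diffProd_snd hI hl h (-w, t)
  rw [diffProd_apply, Prod.mk.injEq] at hxy
  refine ⟨(y, x), ?_⟩
  rw [diffProd_apply, Prod.mk.injEq, ← neg_sub, hxy.1, neg_neg]
  exact ⟨rfl, hxy.2⟩

theorem exists_surjective_diffProd [FiniteDimensional ℝ V₁] [FiniteDimensional ℝ V₂]
    [FiniteDimensional ℝ W₁] [FiniteDimensional ℝ W₂]
    {A : V₁ →ₗ[ℝ] W₁ × W₂} {B : V₂ →ₗ[ℝ] W₁ × W₂}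
    (hd : finrank ℝ W₁ + finrank ℝ W₂ + 1 = finrank ℝ V₁ + finrank ℝ V₂)
    (h : A.range ⊔ B.range = ⊤) : ∃ s, Function.Surjective (diffProd A B s) := by
  have hlt : finrank ℝ (W₁ × W₂) < finrank ℝ (V₁ × V₂) := by
    rw [finrank_prod, finrank_prod]
    omega
  have hker := LinearMap.ker_ne_bot_of_finrank_lt (f := A.coprod (-B)) hlt
  obtain ⟨k, hk, hk0⟩ := (Submodule.ne_bot_iff _).1 hker
  -- With `s k = 1` on a kernel vector `k` of the difference, adding multiples of `k` adjusts the
  -- last component alone.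
  obtain ⟨s, hs⟩ := Module.Projective.exists_dual_eq_one ℝ hk0
  have hk' : A k.1 - B k.2 = 0 := by
    simpa [sub_eq_add_neg] using hk
  refine ⟨s, fun ⟨w, t⟩ => ?_⟩
  have hw : w ∈ A.range ⊔ B.range := h ▸ Submodule.mem_top
  obtain ⟨_, ⟨x, rfl⟩, _, ⟨y, rfl⟩, hxy⟩ := Submodule.mem_sup.1 hw
  have h0 : diffProd A B s k = (0, 1) := by rw [diffProd_apply, hk', hs]
  refine ⟨(x, -y) + (t - s (x, -y)) • k, ?_⟩
  rw [map_add, map_smul, h0, diffProd_apply, map_neg, sub_neg_eq_add, hxy]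
  simp

end Surjectivity

/-! ### End signs and intersection signs at the points of the fiber product -/

section Ends

variable {E₁ H₁ E₂ H₂ F₁ G₁ F₂ G₂ : Type*}
  [NormedAddCommGroup E₁] [NormedSpace ℝ E₁] [FiniteDimensional ℝ E₁] [TopologicalSpace H₁]
  [NormedAddCommGroup E₂] [NormedSpace ℝ E₂] [FiniteDimensional ℝ E₂] [TopologicalSpace H₂]
  [NormedAddCommGroup F₁] [NormedSpace ℝ F₁] [FiniteDimensional ℝ F₁] [TopologicalSpace G₁]
  [NormedAddCommGroup F₂] [NormedSpace ℝ F₂] [FiniteDimensional ℝ F₂] [TopologicalSpace G₂]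
  {I₁ : ModelWithCorners ℝ E₁ H₁} {I₂ : ModelWithCorners ℝ E₂ H₂}
  {J₁ : ModelWithCorners ℝ F₁ G₁} {J₂ : ModelWithCorners ℝ F₂ G₂}
  {Z Υ X M : Type*}
  [TopologicalSpace Z] [ChartedSpace H₁ Z] [IsManifold I₁ ∞ Z]
  [TopologicalSpace Υ] [ChartedSpace H₂ Υ] [IsManifold I₂ ∞ Υ]
  [TopologicalSpace X] [ChartedSpace G₁ X] [IsManifold J₁ ∞ X]
  [TopologicalSpace M] [ChartedSpace G₂ M] [IsManifold J₂ ∞ M]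
  {f : Z → X × M} {g : Υ → X × M}
  {o₁ : RelOrientation I₁ J₁ (fun u => (f u).1)} {o₂ : RelOrientation I₂ J₂ (fun P => (g P).2)}
  {h : finrank ℝ F₁ + finrank ℝ F₂ + 1 = finrank ℝ E₁ + finrank ℝ E₂}

theorem fiberDet_neg (p : Z × Υ) (s : E₁ × E₂ →L[ℝ] ℝ) :
    fiberDet o₁ o₂ h p (-s) = -fiberDet o₁ o₂ h p s := by
  obtain ⟨k, -, hk⟩ := exists_orientedDet_eq_apply (o₁.linear p.1) (o₂.linear p.2) h
    (finBasis ℝ E₁) (finBasis ℝ E₂) (finBasis ℝ F₁) (finBasis ℝ F₂)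
    (differential I₁ (J₁.prod J₂) f p.1) (differential I₂ (J₁.prod J₂) g p.2)
  rw [fiberDet, fiberDet, hk, hk]
  rfl

variable (o₁ o₂ h) in
theorem exists_fiberDet_pos {p : Z × Υ}
    (ht : (differential I₁ (J₁.prod J₂) f p.1).range ⊔ (differential I₂ (J₁.prod J₂) g p.2).range = ⊤) :
    ∃ s : E₁ × E₂ →L[ℝ] ℝ, 0 < fiberDet o₁ o₂ h p s := by
  obtain ⟨s, hs⟩ := exists_surjective_diffProd h ht
  have hne : fiberDet o₁ o₂ h p s.toContinuousLinearMap ≠ 0 :=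
    orientedDet_ne_zero_of_surjective _ _ h _ _ _ _ hs
  rcases hne.lt_or_gt with hlt | hgt
  · exact ⟨-s.toContinuousLinearMap, by rw [fiberDet_neg]; exact neg_pos.2 hlt⟩
  · exact ⟨_, hgt⟩

/-- The local structure of the fiber product at a point where the model is a half-space. -/
theorem exists_isArc_of_halfSpace (hf : ContMDiff I₁ (J₁.prod J₂) ∞ f)
    (hg : ContMDiff I₂ (J₁.prod J₂) ∞ g) (hK : Convex ℝ (range (I₁.prod I₂)))
    {L R : Z × Υ → Filter (Z × Υ)} {ξ : Z × Υ → E₁ × E₂ →L[ℝ] ℝ}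
    (hξ : ∀ x ∈ fiberProd f g, 0 < fiberDet o₁ o₂ h x (ξ x))
    (hL : ∀ x, L x = 𝓝[fiberProd f g ∩ {z | ξ x (extChartAt (I₁.prod I₂) x z)
      < ξ x (extChartAt (I₁.prod I₂) x x)}] x)
    (hR : ∀ x, R x = 𝓝[fiberProd f g ∩ {z | ξ x (extChartAt (I₁.prod I₂) x x)
      < ξ x (extChartAt (I₁.prod I₂) x z)}] x)
    {p : Z × Υ} (hp : p ∈ fiberProd f g) {s : E₁ × E₂ →L[ℝ] ℝ} (hs : fiberDet o₁ o₂ h p s ≠ 0)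
    (hsT : ∀ᶠ v in 𝓝 (extChartAt (I₁.prod I₂) p p),
      v ∈ range (I₁.prod I₂) ↔ s (extChartAt (I₁.prod I₂) p p) ≤ s v) :
    (∃ C a b γ r, IsArc (fiberProd f g) L R C a b γ r ∧ C ∈ 𝓝[fiberProd f g] p) ∧
      endSign L R p = -signOf (0 < fiberDet o₁ o₂ h p s) := by
  -- The model lies where `s` is at least its value at `p`. If `s` is positive for the orientation,
  -- the arc starts at `p`; otherwise `-s` is the positive parameter and the arc ends there.
  rcases hs.lt_or_gt with hlt | hgt
  · have := exists_isArc hf hg hK hξ hL hR hp (s := -s) (by rw [fiberDet_neg]; exact neg_pos.2 hlt)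
      (IsSide.final _) (by simpa using hsT)
    simpa [signOf, not_lt.2 hlt.le] using this
  · have := exists_isArc hf hg hK hξ hL hR hp hgt (IsSide.initial _) hsT
    simpa [signOf, hgt] using this

theorem endSign_boundary_right (hf : ContMDiff I₁ (J₁.prod J₂) ∞ f)
    (hg : ContMDiff I₂ (J₁.prod J₂) ∞ g) (hK : Convex ℝ (range (I₁.prod I₂)))
    {L R : Z × Υ → Filter (Z × Υ)} {ξ : Z × Υ → E₁ × E₂ →L[ℝ] ℝ}
    (hξ : ∀ x ∈ fiberProd f g, 0 < fiberDet o₁ o₂ h x (ξ x))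
    (hL : ∀ x, L x = 𝓝[fiberProd f g ∩ {z | ξ x (extChartAt (I₁.prod I₂) x z)
      < ξ x (extChartAt (I₁.prod I₂) x x)}] x)
    (hR : ∀ x, R x = 𝓝[fiberProd f g ∩ {z | ξ x (extChartAt (I₁.prod I₂) x x)
      < ξ x (extChartAt (I₁.prod I₂) x z)}] x)
    (hI₂ : IsBorderedModel I₂) (ht : TransverseBoundary I₁ I₂ (J₁.prod J₂) f g)
    {p : Z × Υ} (hp : p ∈ fiberProd f g) (hp₁ : p.1 ∉ I₁.boundary Z) (hp₂ : p.2 ∈ I₂.boundary Υ) :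
    (∃ C a b γ r, IsArc (fiberProd f g) L R C a b γ r ∧ C ∈ 𝓝[fiberProd f g] p) ∧
      endSign L R p ≠ 0 ∧
      signRight f g o₁ o₂ p = -((-1) ^ finrank ℝ E₂ * endSign L R p) := by
  obtain ⟨l, hl⟩ := hI₂
  have hl0 := ne_zero_of_mem_boundary hl hp₂
  have hlp := apply_extChartAt_eq_zero hl hp₂
  have hne : fiberDet o₁ o₂ h p (l ∘L ContinuousLinearMap.snd ℝ E₁ E₂) ≠ 0 :=
    orientedDet_ne_zero_of_surjective _ _ h _ _ _ _
      (surjective_diffProd_snd hl hl0 (ht p.1 p.2 hp₂ hp))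
  obtain ⟨harc, hend⟩ := exists_isArc_of_halfSpace hf hg hK hξ hL hR hp hne (by
    have h₁ : ∀ᶠ v : E₁ × E₂ in 𝓝 (extChartAt (I₁.prod I₂) p p), v.1 ∈ range I₁ :=
      continuousAt_fst.eventually (range_mem_nhds_of_notMem_boundary hp₁)
    filter_upwards [h₁] with v hv
    rw [ModelWithCorners.range_prod, mem_prod, hl]
    have : (l ∘L ContinuousLinearMap.snd ℝ E₁ E₂) (extChartAt (I₁.prod I₂) p p) = 0 := hlp
    rw [this]
    exact and_iff_right hv)
  refine ⟨harc, ?_, ?_⟩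
  · rw [hend, signOf]
    split_ifs <;> decide
  · have := crossSign_boundary_right hl hl0 (o₁.linear p.1) (o₂.linear p.2) h (finBasis ℝ E₁)
      (finBasis ℝ E₂) (finBasis ℝ F₁) (finBasis ℝ F₂) (differential I₁ (J₁.prod J₂) f p.1)
      (differential I₂ (J₁.prod J₂) g p.2) hne
    rw [hend, mul_neg, neg_neg]
    exact this

theorem endSign_boundary_left (hf : ContMDiff I₁ (J₁.prod J₂) ∞ f)
    (hg : ContMDiff I₂ (J₁.prod J₂) ∞ g) (hK : Convex ℝ (range (I₁.prod I₂)))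
    {L R : Z × Υ → Filter (Z × Υ)} {ξ : Z × Υ → E₁ × E₂ →L[ℝ] ℝ}
    (hξ : ∀ x ∈ fiberProd f g, 0 < fiberDet o₁ o₂ h x (ξ x))
    (hL : ∀ x, L x = 𝓝[fiberProd f g ∩ {z | ξ x (extChartAt (I₁.prod I₂) x z)
      < ξ x (extChartAt (I₁.prod I₂) x x)}] x)
    (hR : ∀ x, R x = 𝓝[fiberProd f g ∩ {z | ξ x (extChartAt (I₁.prod I₂) x x)
      < ξ x (extChartAt (I₁.prod I₂) x z)}] x)
    (hI₁ : IsBorderedModel I₁) (ht : TransverseBoundary I₂ I₁ (J₁.prod J₂) g f)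
    {p : Z × Υ} (hp : p ∈ fiberProd f g) (hp₁ : p.1 ∈ I₁.boundary Z) (hp₂ : p.2 ∉ I₂.boundary Υ) :
    (∃ C a b γ r, IsArc (fiberProd f g) L R C a b γ r ∧ C ∈ 𝓝[fiberProd f g] p) ∧
      endSign L R p ≠ 0 ∧ signLeft f g o₁ o₂ p = endSign L R p := by
  obtain ⟨l, hl⟩ := hI₁
  have hl0 := ne_zero_of_mem_boundary hl hp₁
  have hlp := apply_extChartAt_eq_zero hl hp₁
  have hp' : f p.1 = g p.2 := hp
  have hne : fiberDet o₁ o₂ h p (l ∘L ContinuousLinearMap.fst ℝ E₁ E₂) ≠ 0 :=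
    orientedDet_ne_zero_of_surjective _ _ h _ _ _ _
      (surjective_diffProd_fst hl hl0 (ht p.2 p.1 hp₁ hp'.symm))
  obtain ⟨harc, hend⟩ := exists_isArc_of_halfSpace hf hg hK hξ hL hR hp hne (by
    have h₂ : ∀ᶠ v : E₁ × E₂ in 𝓝 (extChartAt (I₁.prod I₂) p p), v.2 ∈ range I₂ :=
      continuousAt_snd.eventually (range_mem_nhds_of_notMem_boundary hp₂)
    filter_upwards [h₂] with v hv
    rw [ModelWithCorners.range_prod, mem_prod, hl]
    have : (l ∘L ContinuousLinearMap.fst ℝ E₁ E₂) (extChartAt (I₁.prod I₂) p p) = 0 := hlp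
    rw [this]
    exact and_iff_left hv)
  refine ⟨harc, ?_, ?_⟩
  · rw [hend, signOf]
    split_ifs <;> decide
  · have := crossSign_boundary_left hl hl0 (o₁.linear p.1) (o₂.linear p.2) h (finBasis ℝ E₁)
      (finBasis ℝ E₂) (finBasis ℝ F₁) (finBasis ℝ F₂) (differential I₁ (J₁.prod J₂) f p.1)
      (differential I₂ (J₁.prod J₂) g p.2) hne
    rw [hend]
    exact this

theorem endSign_interior (hf : ContMDiff I₁ (J₁.prod J₂) ∞ f)
    (hg : ContMDiff I₂ (J₁.prod J₂) ∞ g) (hK : Convex ℝ (range (I₁.prod I₂)))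
    {L R : Z × Υ → Filter (Z × Υ)} {ξ : Z × Υ → E₁ × E₂ →L[ℝ] ℝ}
    (hξ : ∀ x ∈ fiberProd f g, 0 < fiberDet o₁ o₂ h x (ξ x))
    (hL : ∀ x, L x = 𝓝[fiberProd f g ∩ {z | ξ x (extChartAt (I₁.prod I₂) x z)
      < ξ x (extChartAt (I₁.prod I₂) x x)}] x)
    (hR : ∀ x, R x = 𝓝[fiberProd f g ∩ {z | ξ x (extChartAt (I₁.prod I₂) x x)
      < ξ x (extChartAt (I₁.prod I₂) x z)}] x)
    {p : Z × Υ} (hp : p ∈ fiberProd f g) (hp₁ : p.1 ∉ I₁.boundary Z) (hp₂ : p.2 ∉ I₂.boundary Υ) :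
    (∃ C a b γ r, IsArc (fiberProd f g) L R C a b γ r ∧ C ∈ 𝓝[fiberProd f g] p) ∧
      endSign L R p = 0 := by
  refine exists_isArc hf hg hK hξ hL hR hp (hξ p hp) (IsSide.inside _) ?_
  have h₁ : ∀ᶠ v : E₁ × E₂ in 𝓝 (extChartAt (I₁.prod I₂) p p), v.1 ∈ range I₁ :=
    continuousAt_fst.eventually (range_mem_nhds_of_notMem_boundary hp₁)
  have h₂ : ∀ᶠ v : E₁ × E₂ in 𝓝 (extChartAt (I₁.prod I₂) p p), v.2 ∈ range I₂ :=
    continuousAt_snd.eventually (range_mem_nhds_of_notMem_boundary hp₂)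
  filter_upwards [h₁, h₂] with v h₁ h₂
  rw [ModelWithCorners.range_prod]
  exact iff_of_true ⟨h₁, h₂⟩ trivial

end Ends

/-! ### Consequences of the dimension count -/

section Dimension

variable {E₁ H₁ E₂ H₂ F G : Type*}
  [NormedAddCommGroup E₁] [NormedSpace ℝ E₁] [FiniteDimensional ℝ E₁] [TopologicalSpace H₁]
  [NormedAddCommGroup E₂] [NormedSpace ℝ E₂] [FiniteDimensional ℝ E₂] [TopologicalSpace H₂]
  [NormedAddCommGroup F] [NormedSpace ℝ F] [TopologicalSpace G]
  {I₁ : ModelWithCorners ℝ E₁ H₁} {I₂ : ModelWithCorners ℝ E₂ H₂} {J : ModelWithCorners ℝ F G}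
  {Z Υ Y : Type*} [TopologicalSpace Z] [ChartedSpace H₁ Z] [TopologicalSpace Υ] [ChartedSpace H₂ Υ]
  [TopologicalSpace Y] [ChartedSpace G Y] {f : Z → Y} {g : Υ → Y}

/-- The two boundary hyperplanes have total dimension dim Y - 1, too small to span the tangent space
of Y, so the fiber product has no corner points. -/
theorem notMem_boundary_of_mem_boundary (hI₁ : IsBorderedModel I₁) (hI₂ : IsBorderedModel I₂)
    (ht : BoundaryTransverseBoundary I₁ I₂ J f g)
    (hd : finrank ℝ E₁ + finrank ℝ E₂ = finrank ℝ F + 1) {p : Z × Υ} (hp : p ∈ fiberProd f g)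
    (hp₁ : p.1 ∈ I₁.boundary Z) : p.2 ∉ I₂.boundary Υ := by
  intro hp₂
  obtain ⟨l₁, hl₁⟩ := hI₁
  obtain ⟨l₂, hl₂⟩ := hI₂
  have d₁ := finrank_boundaryTangent hl₁ (ne_zero_of_mem_boundary hl₁ hp₁)
  have d₂ := finrank_boundaryTangent hl₂ (ne_zero_of_mem_boundary hl₂ hp₂)
  have d := finrank_le_of_sup_range_eq_top (ht _ hp₁ _ hp₂ hp)
  omega

theorem Transverse.disjoint_range (ht : Transverse I₁ I₂ J f g)
    (hd : Nonempty Z → Nonempty Υ → finrank ℝ E₁ + finrank ℝ E₂ < finrank ℝ F) {y : Y}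
    (hf : y ∈ range f) : y ∉ range g := by
  rintro ⟨P, rfl⟩
  obtain ⟨u, hu⟩ := hf
  exact (hd ⟨u⟩ ⟨P⟩).not_ge (finrank_le_of_sup_range_eq_top (ht u P hu))

theorem TransversePseudocycles.isCompact_fiberProd [T2Space Y]
    (hfg : TransversePseudocycles I₁ I₂ J f g)
    (hd : finrank ℝ E₁ + finrank ℝ E₂ = finrank ℝ F + 1) (hK : IsCompact (closure (range f))) :
    IsCompact (fiberProd f g) := by
  obtain ⟨h₁, h₂, d₁, d₂, l₁, l₂, t₁, -, t₂, -, t₁₂⟩ := hfg.exists_maps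
  refine Steenrod.isCompact_fiberProd hfg.stronglyTransverse.smooth_left.continuous
    hfg.stronglyTransverse.smooth_right.continuous hK
    (fun y hy => t₁.disjoint_range (fun n₁ _ => ?_) (l₁ hy))
    (fun y hy => t₂.disjoint_range (fun n₂ _ => ?_) (l₂ hy))
    (fun y hy hy' => t₁₂.disjoint_range (fun n₁ n₂ => ?_) (l₁ hy) (l₂ hy'))
  · have := d₁ n₁
    rw [finrank_euclideanSpace_fin]
    omega
  · have := d₂ n₂
    rw [finrank_euclideanSpace_fin]
    omega
  · have := d₁ n₁
    have := d₂ n₂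
    rw [finrank_euclideanSpace_fin, finrank_euclideanSpace_fin]
    omega

end Dimension

end Steenrod

/-! ### Conclusion: the signed count of the ends -/

theorem lemma3p4
    {E₁ H₁ E₂ H₂ F₁ G₁ F₂ G₂ Z Υ X M : Type*}
    [NormedAddCommGroup E₁] [NormedSpace ℝ E₁] [FiniteDimensional ℝ E₁] [TopologicalSpace H₁]
    [NormedAddCommGroup E₂] [NormedSpace ℝ E₂] [FiniteDimensional ℝ E₂] [TopologicalSpace H₂]
    [NormedAddCommGroup F₁] [NormedSpace ℝ F₁] [FiniteDimensional ℝ F₁] [TopologicalSpace G₁]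
    [NormedAddCommGroup F₂] [NormedSpace ℝ F₂] [FiniteDimensional ℝ F₂] [TopologicalSpace G₂]
    (I₁ : ModelWithCorners ℝ E₁ H₁) (I₂ : ModelWithCorners ℝ E₂ H₂)
    (J₁ : ModelWithCorners ℝ F₁ G₁) (J₂ : ModelWithCorners ℝ F₂ G₂)
    (hI₁ : Steenrod.IsBorderedModel I₁) (hI₂ : Steenrod.IsBorderedModel I₂)
    (hJ₁ : Steenrod.IsBorderedModel J₁) (hJ₂ : Steenrod.IsBorderedModel J₂)
    [TopologicalSpace Z] [T2Space Z] [SecondCountableTopology Z]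
    [ChartedSpace H₁ Z] [IsManifold I₁ ∞ Z]
    [TopologicalSpace Υ] [T2Space Υ] [SecondCountableTopology Υ]
    [ChartedSpace H₂ Υ] [IsManifold I₂ ∞ Υ]
    [TopologicalSpace X] [T2Space X] [SecondCountableTopology X]
    [ChartedSpace G₁ X] [IsManifold J₁ ∞ X]
    [TopologicalSpace M] [T2Space M] [SecondCountableTopology M]
    [ChartedSpace G₂ M] [IsManifold J₂ ∞ M]
    (f : Z → X × M) (g : Υ → X × M)
    (o₁ : Steenrod.RelOrientation I₁ J₁ (fun u => (f u).1))
    (o₂ : Steenrod.RelOrientation I₂ J₂ (fun P => (g P).2))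
    (hdim : Module.finrank ℝ E₁ + Module.finrank ℝ E₂
      = Module.finrank ℝ F₁ + Module.finrank ℝ F₂ + 1)
    (Z₀ : Set Z) (hf : Steenrod.IsBorderedPseudocycle I₁ (J₁.prod J₂) f Z₀)
    (Υ₀ : Set Υ) (hg : Steenrod.IsBorderedPseudocycle I₂ (J₁.prod J₂) g Υ₀)
    (hfg : Steenrod.TransversePseudocycles I₁ I₂ (J₁.prod J₂) f g) :
    (Steenrod.fiberProdBoundary I₂ f g).Finite ∧
    (Steenrod.boundaryFiberProd I₁ f g).Finite ∧
    ∑ᶠ p ∈ Steenrod.fiberProdBoundary I₂ f g, Steenrod.signRight f g o₁ o₂ p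
      = (-1) ^ Module.finrank ℝ E₂ *
        ∑ᶠ p ∈ Steenrod.boundaryFiberProd I₁ f g, Steenrod.signLeft f g o₁ o₂ p := by
  have ht := hfg.stronglyTransverse
  have h : finrank ℝ F₁ + finrank ℝ F₂ + 1 = finrank ℝ E₁ + finrank ℝ E₂ := hdim.symm
  have hd : finrank ℝ E₁ + finrank ℝ E₂ = finrank ℝ (F₁ × F₂) + 1 := by rw [finrank_prod, hdim]
  have hcompact := hfg.isCompact_fiberProd hd hf.isCompact_closure
  have hK : Convex ℝ (range (I₁.prod I₂)) := by
    rw [ModelWithCorners.range_prod]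
    exact hI₁.convex_range.prod hI₂.convex_range
  have hex : ∀ x : Z × Υ, ∃ s : E₁ × E₂ →L[ℝ] ℝ,
      x ∈ Steenrod.fiberProd f g → 0 < Steenrod.fiberDet o₁ o₂ h x s := fun x => by
    by_cases hx : x ∈ Steenrod.fiberProd f g
    · obtain ⟨s, hs⟩ := Steenrod.exists_fiberDet_pos o₁ o₂ h (ht.transverse x.1 x.2 hx)
      exact ⟨s, fun _ => hs⟩
    · exact ⟨0, fun hx' => absurd hx' hx⟩
  -- A pointwise choice without any continuity suffices, since the sides do not depend on it; off
  -- the fiber product the choice is irrelevant.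
  choose ξ hξ using hex
  obtain ⟨L, hL⟩ : ∃ L : Z × Υ → Filter (Z × Υ), ∀ x, L x = 𝓝[Steenrod.fiberProd f g ∩
      {z | ξ x (extChartAt (I₁.prod I₂) x z) < ξ x (extChartAt (I₁.prod I₂) x x)}] x :=
    ⟨_, fun _ => rfl⟩
  obtain ⟨R, hR⟩ : ∃ R : Z × Υ → Filter (Z × Υ), ∀ x, R x = 𝓝[Steenrod.fiberProd f g ∩
      {z | ξ x (extChartAt (I₁.prod I₂) x x) < ξ x (extChartAt (I₁.prod I₂) x z)}] x :=
    ⟨_, fun _ => rfl⟩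
  have hnot : ∀ p ∈ Steenrod.fiberProd f g, p.1 ∈ I₁.boundary Z → p.2 ∉ I₂.boundary Υ := fun p hp =>
    Steenrod.notMem_boundary_of_mem_boundary hI₁ hI₂ ht.boundary_transverse_boundary hd hp
  have right := fun p (hp : p ∈ Steenrod.fiberProd f g) (hp₂ : p.2 ∈ I₂.boundary Υ) =>
    Steenrod.endSign_boundary_right ht.smooth_left ht.smooth_right hK hξ hL hR hI₂
      ht.transverse_boundary hp (fun hp₁ => hnot p hp hp₁ hp₂) hp₂
  have left := fun p (hp : p ∈ Steenrod.fiberProd f g) (hp₁ : p.1 ∈ I₁.boundary Z) =>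
    Steenrod.endSign_boundary_left ht.smooth_left ht.smooth_right hK hξ hL hR hI₁
      ht.boundary_transverse hp hp₁ (hnot p hp hp₁)
  have inner := fun p (hp : p ∈ Steenrod.fiberProd f g) =>
    Steenrod.endSign_interior ht.smooth_left ht.smooth_right hK hξ hL hR hp
  obtain ⟨hfin, hsum⟩ := Steenrod.finsum_endSign_eq_zero (L := L) (R := R) hcompact
    (fun x _ => by rw [hL]; exact nhdsWithin_mono _ inter_subset_left)
    (fun x _ => by rw [hR]; exact nhdsWithin_mono _ inter_subset_left)
    (fun p hp => by
      by_cases hp₁ : p.1 ∈ I₁.boundary Z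
      · exact (left p hp hp₁).1
      · by_cases hp₂ : p.2 ∈ I₂.boundary Υ
        · exact (right p hp hp₂).1
        · exact (inner p hp hp₁ hp₂).1)
  have finR : (Steenrod.fiberProdBoundary I₂ f g).Finite :=
    hfin.subset fun p hp => ⟨hp.2, (right p hp.2 hp.1).2.1⟩
  have finL : (Steenrod.boundaryFiberProd I₁ f g).Finite :=
    hfin.subset fun p hp => ⟨hp.2, (left p hp.2 hp.1).2.1⟩
  refine ⟨finR, finL, ?_⟩
  have hdisj : Disjoint (Steenrod.fiberProdBoundary I₂ f g) (Steenrod.boundaryFiberProd I₁ f g) :=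
    disjoint_left.2 fun p hpR hpL => hnot p hpL.2 hpL.1 hpR.1
  have hunion : ∑ᶠ p ∈ Steenrod.fiberProd f g, Steenrod.endSign L R p
      = ∑ᶠ p ∈ Steenrod.fiberProdBoundary I₂ f g ∪ Steenrod.boundaryFiberProd I₁ f g,
        Steenrod.endSign L R p := by
    refine finsum_mem_inter_support_eq _ _ _ (Set.ext fun p => and_congr_left fun hp0 => ?_)
    refine ⟨fun hp => ?_, fun hp => hp.elim And.right And.right⟩
    by_contra hcon
    exact hp0 (inner p hp (fun hp₁ => hcon (Or.inr ⟨hp₁, hp⟩)) fun hp₂ => hcon (Or.inl ⟨hp₂, hp⟩)).2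
  rw [hunion, finsum_mem_union hdisj finR finL] at hsum
  -- The end signs over ∂Υ and ∂Z add up to zero. Intersection signs equal end signs on ∂Z and
  -- -(-1)^(dim Υ) times them on ∂Υ, so the two minus signs cancel.
  rw [finsum_mem_congr rfl fun p hp => (right p hp.2 hp.1).2.2,
    finsum_mem_congr rfl fun p hp => (left p hp.2 hp.1).2.2,
    eq_neg_of_add_eq_zero_right hsum, finsum_mem_neg_distrib _ finR, ← mul_finsum_mem, mul_neg]
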